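/- **Theorem 2.7.** Let $\phi:\mathbb R\to\mathbb R$ be everywhere differentiable and such that $f=e^{\phi}$ is a probability density; put $\pi(dx)=f(x)\,dx$, $\mu=\pi^{\otimes\infty}$ on $\mathbb R^\infty$, and $\mathcal H=L^2(\mathbb R^\infty,\mu)$. Assume that $$\mathcal I=\int_{\mathbb R}|\phi'(x)|^2f(x)\,dx<\infty$$ and that, for some $k>0$, $0<\gamma<1$ and $\alpha>1$, $$|\phi'(x+v)-\phi'(x)|\le k\max\{|v|^\gamma,|v|^\alpha\}\qquad\text{for all }x,v\in\mathbb R .$$ Fix $\tau>0$. Let $X=(X_1,X_2,\dots)$ be i.i.d. with law $\pi$, $W=(W_1,W_2,\dots)$ i.i.d. standard normal, and $U$ uniform on $(0,1)$, with $X,W,U$ independent. For $n\ge1$ let $X^{(n)}(0)=X$, let $$a_n(X,W)=1\wedge\prod_{i=1}^n\frac{f(X_i+\tau n^{-1/2}W_i)}{f(X_i)},$$ and let $X^{(n)}(1)$ be obtained from $X$ by adding $\tau n^{-1/2}W_i$ to the $i$-th component for every $i\le n$ if $U<a_n(X,W)$, and $X^{(n)}(1)=X$ otherwise. For $h\in\mathcal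 H$ define $$\Phi_n(h)=\frac n2\,\mathbb E\big[\big(h(X^{(n)}(1))-h(X^{(n)}(0))\big)^2\big].$$ Let $S=W^{1,2}(\mathbb R^\infty,\mu)\subset\mathcal H$ be the closure, in the norm $\|h\|_S^2=\mathbb E[|h(X)|^2+|\nabla h(X)|^2]$, of the set of all functions $h(x)=u(x_1,\dots,x_N)$ with $N\ge1$ and $u\in C_0^\infty(\mathbb R^N)$ (infinitely differentiable with compact support); the $\ell^2$-valued gradient $\nabla$ is extended to $S$ by continuity. Define $$\Phi(h)=\tfrac12\tau^2c(\tau)\,\mathbb E[|\nabla h(X)|^2]\ \text{ for }h\in S,\qquad \Phi(h)=\infty\ \text{ for }h\in\mathcal H\setminus S,$$ where $c(\tau)=\mathbb E[1\wedge e^{Z}]$ with $Z\sim\mathcal N(-\tfrac{\tau^2}{2}\mathcal I,\ \tau^2\mathcal I)$. Then $\Phi_n$ converges to $\Phi$ in the sense of Mosco, that is: (M1) whenever $h_n\to h$ weakly in $\mathcal H$, $\liminf_{n\to\infty}\Phi_n(h_n)\ge\Phi(h)$; (M2) for every $h\in\mathcal H$ there are $h_n\in\mathcal H$ with $h_n\to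 h$ strongly in $\mathcal H$ and $\limsup_{n\to\infty}\Phi_n(h_n)\le\Phi(h)$. -/

import Mathlib

open MeasureTheory ProbabilityTheory Filter Topology
open scoped ENNReal NNReal ContDiff

noncomputable section

namespace MHRW

/-! ### Mosco convergence -/

/-- Mosco convergence `Φₙ → Φ` of quadratic functionals with values in `[0, ∞]` on a real
Hilbert space (a form is extended by `∞` outside its domain). -/
structure MoscoConverges {H : Type*} [NormedAddCommGroup H] [InnerProductSpace ℝ H]
    (Φn : ℕ → H → ℝ≥0∞) (Φ : H → ℝ≥0∞) : Prop where
  /-- (M1): lower bound along weakly convergent sequences. -/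
  liminf_le : ∀ (h : H) (hn : ℕ → H),
    (∀ g : H, Tendsto (fun n => inner ℝ (hn n) g) atTop (𝓝 (inner ℝ h g))) →
      Φ h ≤ liminf (fun n => Φn n (hn n)) atTop
  /-- (M2): existence of strongly convergent recovery sequences. -/
  exists_limsup_le : ∀ h : H, ∃ hn : ℕ → H,
    Tendsto hn atTop (𝓝 h) ∧ limsup (fun n => Φn n (hn n)) atTop ≤ Φ h

/-! ### The target measure -/

/-- The measure `π(dx) = f(x) dx` on `ℝ` with `f = exp ∘ φ`. -/
def target (φ : ℝ → ℝ) : Measure ℝ :=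
  volume.withDensity fun x => ENNReal.ofReal (Real.exp (φ x))

/-- The infinite product measure `π^{⊗∞}` on `ℝ^∞ = (ℕ → ℝ)`; the coordinates
`x₁, x₂, …` are indexed by `0, 1, …`. -/
def targetInf (φ : ℝ → ℝ) [IsProbabilityMeasure (target φ)] : Measure (ℕ → ℝ) :=
  Measure.infinitePi fun _ : ℕ => target φ

/-- The Hilbert space `L²(ℝ^∞, π^{⊗∞})`. -/
abbrev L2Target (φ : ℝ → ℝ) [IsProbabilityMeasure (target φ)] : Type :=
  Lp ℝ 2 (targetInf φ)

/-- The Fisher information `I = ∫ |φ'(x)|² f(x) dx`. -/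
def fisherInfo (φ : ℝ → ℝ) : ℝ :=
  ∫ x, |deriv φ x| ^ 2 * Real.exp (φ x)

/-! ### The Metropolis-Hastings random walk and its rescaled Dirichlet forms -/

/-- The acceptance probability
`a(x, w) = 1 ∧ ∏_{i ≤ n} f(x_i + τ w_i / √n) / ∏_{i ≤ n} f(x_i)`. -/
def acceptProb (φ : ℝ → ℝ) (τ : ℝ) (n : ℕ) (x w : ℕ → ℝ) : ℝ :=
  min 1 ((∏ i ∈ Finset.range n, Real.exp (φ (x i + τ / √(n : ℝ) * w i))) /
    ∏ i ∈ Finset.range n, Real.exp (φ (x i)))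

open Classical in
/-- The first step `X^{(n)}(1)` from `X^{(n)}(0) = x`, with Gaussian noise `w` and uniform
variable `u`: the first `n` components move by `τ w_i / √n` if `u < a(x, w)`; all others, and
all components upon rejection, stay put. -/
def step (φ : ℝ → ℝ) (τ : ℝ) (n : ℕ) (x w : ℕ → ℝ) (u : ℝ) : ℕ → ℝ :=
  fun i => x i + if i < n ∧ u < acceptProb φ τ n x w then τ / √(n : ℝ) * w i else 0

/-- The joint law of `(X, W, U)`: independent, with `X ∼ π^{⊗∞}`, `W` an i.i.d. standard
normal sequence, and `U` uniform on `(0, 1)`. -/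
def noiseLaw (φ : ℝ → ℝ) [IsProbabilityMeasure (target φ)] :
    Measure ((ℕ → ℝ) × (ℕ → ℝ) × ℝ) :=
  (targetInf φ).prod
    ((Measure.infinitePi fun _ : ℕ => gaussianReal 0 1).prod
      (volume.restrict (Set.Ioo (0 : ℝ) 1)))

/-- The time-rescaled form `Φₙ(h) = (n/2) E[(h(X^{(n)}(1)) - h(X^{(n)}(0)))²]`. -/
def rwForm (φ : ℝ → ℝ) [IsProbabilityMeasure (target φ)] (τ : ℝ) (n : ℕ)
    (h : L2Target φ) : ℝ≥0∞ :=
  (n : ℝ≥0∞) / 2 *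
    ∫⁻ p, ENNReal.ofReal ((h (step φ τ n p.1 p.2.1 p.2.2) - h p.1) ^ 2) ∂(noiseLaw φ)

/-! ### The Sobolev space and the limiting form -/

/-- The sequence space `ℓ²`. -/
abbrev EllTwo : Type := lp (fun _ : ℕ => ℝ) 2

/-- The pairs `(h, ∇h)`, where `h(x) = u(x₁, …, x_N)` for some `N > 0` and some
`u ∈ C_0^∞(ℝ^N)`, and `∇h = (∂₁u, …, ∂_N u, 0, 0, …)` is regarded as an `ℓ²`-valued function. -/
def smoothGradientGraph (φ : ℝ → ℝ) [IsProbabilityMeasure (target φ)] :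
    Set (L2Target φ × Lp EllTwo 2 (targetInf φ)) :=
  {p | ∃ N : ℕ, 0 < N ∧ ∃ u : (Fin N → ℝ) → ℝ, ContDiff ℝ ∞ u ∧ HasCompactSupport u ∧
    (∀ᵐ x ∂(targetInf φ), p.1 x = u fun j => x j) ∧
    ∀ᵐ x ∂(targetInf φ), ∀ i : ℕ, p.2 x i =
      if hi : i < N then fderiv ℝ u (fun j => x j) (Pi.single ⟨i, hi⟩ 1) else 0}

/-- `g` is the gradient of `h` in the Sobolev sense: `(h, g)` is a limit, in the Sobolev norm
`‖h‖² + ‖g‖²`, of pairs `(hₖ, ∇hₖ)` with `hₖ` smooth, compactly supported and depending on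
finitely many coordinates. For locally bounded `φ'` integration by parts shows that `h`
determines `g`. -/
def IsSobolevGradient (φ : ℝ → ℝ) [IsProbabilityMeasure (target φ)]
    (h : L2Target φ) (g : Lp EllTwo 2 (targetInf φ)) : Prop :=
  (h, g) ∈ closure (smoothGradientGraph φ)

/-- The Sobolev space `W^{1,2}(ℝ^∞, π^{⊗∞})`, the closure of the smooth compactly supported
functions of finitely many coordinates in the Sobolev norm. -/
def sobolev (φ : ℝ → ℝ) [IsProbabilityMeasure (target φ)] : Set (L2Target φ) :=
  {h | ∃ g, IsSobolevGradient φ h g}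

/-- The gradient `∇h` of an element of the Sobolev space. -/
def grad (φ : ℝ → ℝ) [IsProbabilityMeasure (target φ)]
    (h : L2Target φ) (hh : h ∈ sobolev φ) : Lp EllTwo 2 (targetInf φ) :=
  hh.choose

/-- The constant `c(τ) = E[1 ∧ exp(Z)]` with `Z ∼ N(-τ² I / 2, τ² I)`. -/
def accRate (φ : ℝ → ℝ) (τ : ℝ) : ℝ :=
  ∫ z, min 1 (Real.exp z)
    ∂(gaussianReal (-(τ ^ 2 / 2) * fisherInfo φ) (τ ^ 2 * fisherInfo φ).toNNReal)

open Classical in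
/-- The limiting form: `Φ(h) = ½ τ² c(τ) E[|∇h|²]` on the Sobolev space and `∞` elsewhere. -/
def limitForm (φ : ℝ → ℝ) [IsProbabilityMeasure (target φ)] (τ : ℝ)
    (h : L2Target φ) : ℝ≥0∞ :=
  if hh : h ∈ sobolev φ then
    ENNReal.ofReal (1 / 2 * τ ^ 2 * accRate φ τ) *
      ∫⁻ x, ENNReal.ofReal (‖grad φ h hh x‖ ^ 2) ∂(targetInf φ)
  else ∞

end MHRW

end

/-!
Write `S = ∑_{i < n} (φ (xᵢ + t wᵢ) - φ (xᵢ))`, `t = τ / √n`, for the log-ratio of a proposal, so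
that the form is `n / 2` times the mean of `(h (x') - h (x))² min 1 (exp S)`. The acceptance
function is replaced by the smooth minorant `softAccept δ`, which is `√δ / 2`-close to it and
satisfies the same balance relation `ψ (-s) exp s = ψ s`. Detailed balance then takes the form of
an involution `(x, w) ↦ (x', -w)` whose Jacobian is `exp S` (`integral_reversal`).

Given the state, `S` is asymptotically Gaussian with mean `-τ² I / 2` and variance `τ² I`, where
`I` is the Fisher information. The variance comes from the law of large numbers applied to `φ'
(xᵢ)²`. The mean cannot be read off from `φ''`, which need not exist; it comes from the symmetric
second difference of `φ`, whose mean is computed by translating a difference of `φ` onto the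
density (`abs_integral_second_difference_add_le`). Consequently `ψ (S)` may be replaced by its
limiting mean against weakly convergent functions of the state (`tendsto_quenchedMean`,
`tendsto_integral_weak`).

Lower bound (M1). The increments of `hₙ` are tested by Cauchy–Schwarz against `∑ wᵢ Gᵢ (x)` for a
smooth vector field `G`. Detailed balance moves the increment onto `G`, and Stein's identity
removes the factor `wᵢ` (`tendsto_cross`); what remains in the limit is the pairing of `h` with
the divergence of `G`. This gives `τ² c (∫ h div G)² ≤ 2 liminf Φₙ (hₙ) ‖G‖²`
(`sq_divergence_le`), so by the Riesz theorem `h` has a weak gradient in `L²` (`exists_riesz`). A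
Meyers–Serrin argument shows that a weak gradient is a limit of gradients of smooth cylinder
functions (`IsWeakGradient.isSobolevGradient`): `h` is averaged over all but finitely many
coordinates, cut off and mollified at a scale on which the density is nearly constant. Density of
the test fields turns the inequality into the bound on the norm of the gradient
(`ScoreModulus.limitForm_le`).

Recovery sequences (M2). For a fixed smooth cylinder function, difference quotients converge to
directional derivatives and the acceptance probability decouples, so that the forms converge
(`limsup_rwForm_le_of_cylinder`). Such functions are dense in the Sobolev norm by definition, and
a diagonal argument concludes (`ScoreModulus.exists_recovery`).
-/

noncomputable section

namespace MHRW

/-! ### Product measures and resampling of coordinates -/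

section Resampling

variable {X : Type*} [MeasurableSpace X]

lemma measurable_update_prod (i : ℕ) :
    Measurable fun p : (ℕ → X) × X => Function.update p.1 i p.2 := by
  refine measurable_pi_lambda _ fun j => ?_
  by_cases h : j = i
  · subst h
    simpa using measurable_snd
  · simp only [Function.update_of_ne h]
    fun_prop

/-- Resampling one coordinate preserves a product measure. -/
lemma measurePreserving_update (ν : Measure X) [IsProbabilityMeasure ν] (i : ℕ) :
    MeasurePreserving (fun p : (ℕ → X) × X => Function.update p.1 i p.2)
      ((Measure.infinitePi fun _ : ℕ => ν).prod ν) (Measure.infinitePi fun _ : ℕ => ν) := by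
  refine ⟨measurable_update_prod i, Measure.eq_infinitePi _ fun s t ht => ?_⟩
  rw [Measure.map_apply (measurable_update_prod i)
    (MeasurableSet.pi s.countable_toSet fun j _ => ht j)]
  have hpre : (fun p : (ℕ → X) × X => Function.update p.1 i p.2) ⁻¹' (Set.pi s t)
      = (Set.pi (s.erase i : Finset ℕ) t) ×ˢ (if i ∈ s then t i else Set.univ) := by
    ext ⟨x, y⟩
    simp only [Set.mem_preimage, Set.mem_pi, Finset.mem_coe, Set.mem_prod, Finset.mem_erase]
    constructor
    · intro h
      refine ⟨fun j hj => ?_, ?_⟩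
      · simpa [Function.update_of_ne hj.1] using h j hj.2
      · split_ifs with hi
        · simpa using h i hi
        · trivial
    · rintro ⟨h1, h2⟩ j hj
      by_cases hji : j = i
      · subst hji
        simpa [hj] using h2
      · simpa [Function.update_of_ne hji] using h1 j ⟨hji, hj⟩
  rw [hpre, Measure.prod_prod, Measure.infinitePi_pi _ fun j _ => ht j]
  split_ifs with hi
  · rw [Finset.prod_erase_mul _ _ hi]
  · simp [Finset.erase_eq_of_notMem hi]

/-- The sequence whose first `N` coordinates are those of `z` and whose others are those of `y`. -/
def glue (N : ℕ) (p : (Fin N → X) × (ℕ → X)) : ℕ → X :=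
  fun i => if h : i < N then p.1 ⟨i, h⟩ else p.2 i

lemma measurable_glue (N : ℕ) : Measurable (glue (X := X) N) := by
  refine measurable_pi_lambda _ fun i => ?_
  unfold glue
  by_cases h : i < N
  · simp only [h, dite_true]
    fun_prop
  · simp only [h, dite_false]
    fun_prop

/-- Resampling the first `N` coordinates preserves a product measure. -/
lemma measurePreserving_glue (ν : Measure X) [IsProbabilityMeasure ν] (N : ℕ) :
    MeasurePreserving (glue (X := X) N)
      ((Measure.pi fun _ : Fin N => ν).prod (Measure.infinitePi fun _ : ℕ => ν))
      (Measure.infinitePi fun _ : ℕ => ν) := by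
  refine ⟨measurable_glue N, Measure.eq_infinitePi _ fun s t ht => ?_⟩
  rw [Measure.map_apply (measurable_glue N)
    (MeasurableSet.pi s.countable_toSet fun j _ => ht j)]
  have hpre : glue (X := X) N ⁻¹' (Set.pi s t)
      = (Set.univ.pi fun j : Fin N => if (j : ℕ) ∈ s then t j else Set.univ) ×ˢ
        (Set.pi (s.filter fun i => ¬ i < N : Finset ℕ) t) := by
    ext ⟨z, y⟩
    simp only [Set.mem_preimage, Set.mem_pi, Finset.mem_coe, Set.mem_prod, Finset.mem_filter, glue,
      Set.mem_univ, true_imp_iff]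
    constructor
    · intro h
      refine ⟨fun j => ?_, fun i hi => ?_⟩
      · split_ifs with hj
        · simpa using h j hj
        · trivial
      · simpa [hi.2] using h i hi.1
    · rintro ⟨h1, h2⟩ i hi
      by_cases hiN : i < N
      · simpa [hiN, hi] using h1 ⟨i, hiN⟩
      · simpa [hiN] using h2 i ⟨hi, hiN⟩
  rw [hpre, Measure.prod_prod, Measure.infinitePi_pi _ fun j _ => ht j, Measure.pi_pi,
    ← Finset.prod_filter_mul_prod_filter_not s (fun i => i < N)]
  congr 1
  have h1 : ∀ j : Fin N, ν (if (j : ℕ) ∈ s then t j else Set.univ)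
      = (fun i : ℕ => if i ∈ s then ν (t i) else 1) j := by
    intro j
    dsimp only
    split_ifs <;> simp
  rw [Finset.prod_congr rfl fun j _ => h1 j, Fin.prod_univ_eq_prod_range
    (fun i : ℕ => if i ∈ s then ν (t i) else 1) N, Finset.prod_ite, Finset.prod_const_one, mul_one]
  refine Finset.prod_congr ?_ fun _ _ => rfl
  ext i
  simp [and_comm]

/-- The first `N` coordinates of a sequence. -/
def proj (N : ℕ) (x : ℕ → X) : Fin N → X := fun j => x j

@[fun_prop]
lemma measurable_proj (N : ℕ) : Measurable (proj (X := X) N) :=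
  measurable_pi_lambda _ fun j => measurable_pi_apply (j : ℕ)

@[simp]
lemma proj_glue {Y : Type*} (N : ℕ) (p : (Fin N → Y) × (ℕ → Y)) : proj N (glue N p) = p.1 := by
  ext j
  simp [proj, glue]

lemma measurePreserving_proj (ν : Measure X) [IsProbabilityMeasure ν] (N : ℕ) :
    MeasurePreserving (proj (X := X) N) (Measure.infinitePi fun _ : ℕ => ν)
      (Measure.pi fun _ : Fin N => ν) := by
  refine ⟨measurable_proj N, ?_⟩
  rw [← (measurePreserving_glue ν N).map_eq,
    Measure.map_map (measurable_proj N) (measurable_glue N)]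
  have : proj (X := X) N ∘ glue N = Prod.fst := funext fun p => proj_glue N p
  rw [this]
  exact measurePreserving_fst.map_eq

/-- An integrable function on the sequence space has a marginal density with respect to the first
`N` coordinates. -/
lemma exists_marginal (ν : Measure X) [IsProbabilityMeasure ν] (N : ℕ) {c : (ℕ → X) → ℝ}
    (hc : Integrable c (Measure.infinitePi fun _ : ℕ => ν)) :
    ∃ k : (Fin N → X) → ℝ, Integrable k (Measure.pi fun _ : Fin N => ν) ∧
      ∀ b : (Fin N → X) → ℝ, Measurable b → (∃ C, ∀ z, |b z| ≤ C) →
        ∫ x, b (proj N x) * c x ∂(Measure.infinitePi fun _ : ℕ => ν)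
          = ∫ z, b z * k z ∂(Measure.pi fun _ : Fin N => ν) := by
  have hg := measurePreserving_glue ν N
  have hc' : Integrable (fun p => c (glue N p))
      ((Measure.pi fun _ : Fin N => ν).prod (Measure.infinitePi fun _ : ℕ => ν)) :=
    hg.integrable_comp_of_integrable hc
  refine ⟨fun z => ∫ y, c (glue N (z, y)) ∂(Measure.infinitePi fun _ : ℕ => ν),
    hc'.integral_prod_left, fun b hb ⟨C, hC⟩ => ?_⟩
  have hbc : Integrable (fun x => b (proj N x) * c x) (Measure.infinitePi fun _ : ℕ => ν) :=
    hc.bdd_mul (hb.comp (measurable_proj N)).aestronglyMeasurable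
      (Eventually.of_forall fun x => by simpa using hC (proj N x))
  have hbc' : Integrable (fun p : (Fin N → X) × (ℕ → X) => b p.1 * c (glue N p))
      ((Measure.pi fun _ : Fin N => ν).prod (Measure.infinitePi fun _ : ℕ => ν)) := by
    simpa [Function.comp_def] using hg.integrable_comp_of_integrable hbc
  have h1 := integral_map hg.aemeasurable (by rw [hg.map_eq]; exact hbc.1)
  rw [hg.map_eq] at h1
  rw [h1]
  simp only [proj_glue]
  rw [integral_prod _ hbc']
  simp only [integral_const_mul]

end Resampling

/-! ### The target measure -/

section Target

variable {φ : ℝ → ℝ}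

lemma measurable_density (hφ : Continuous φ) :
    Measurable fun x => ENNReal.ofReal (Real.exp (φ x)) := by fun_prop

lemma integral_target (hφ : Continuous φ) (g : ℝ → ℝ) :
    ∫ x, g x ∂(target φ) = ∫ x, Real.exp (φ x) * g x := by
  rw [target, integral_withDensity_eq_integral_toReal_smul (measurable_density hφ)
    (Eventually.of_forall fun _ => ENNReal.ofReal_lt_top)]
  simp [ENNReal.toReal_ofReal (Real.exp_pos _).le]

lemma integrable_target_iff (hφ : Continuous φ) {g : ℝ → ℝ} :
    Integrable g (target φ) ↔ Integrable fun x => Real.exp (φ x) * g x := by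
  rw [target, integrable_withDensity_iff_integrable_smul' (measurable_density hφ)
    (Eventually.of_forall fun _ => ENNReal.ofReal_lt_top)]
  simp [ENNReal.toReal_ofReal (Real.exp_pos _).le]

lemma lintegral_target (hφ : Continuous φ) {g : ℝ → ℝ≥0∞} (hg : Measurable g) :
    ∫⁻ x, g x ∂(target φ) = ∫⁻ x, ENNReal.ofReal (Real.exp (φ x)) * g x := by
  rw [target, lintegral_withDensity_eq_lintegral_mul _ (measurable_density hφ) hg]
  rfl

lemma integrable_exp [IsProbabilityMeasure (target φ)] (hφ : Continuous φ) :
    Integrable fun x => Real.exp (φ x) := by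
  simpa using (integrable_target_iff hφ).1 (integrable_const (1 : ℝ))

/-- The density of the product of `N` copies of the target measure. -/
def density (φ : ℝ → ℝ) (N : ℕ) (z : Fin N → ℝ) : ℝ := Real.exp (∑ j, φ (z j))

lemma density_pos (N : ℕ) (z : Fin N → ℝ) : 0 < density φ N z := Real.exp_pos _

lemma continuous_density (hφ : Continuous φ) (N : ℕ) : Continuous (density φ N) := by
  unfold density; fun_prop

lemma pi_target [IsProbabilityMeasure (target φ)] (hφ : Continuous φ) (N : ℕ) :
    (Measure.pi fun _ : Fin N => target φ)
      = volume.withDensity fun z => ENNReal.ofReal (density φ N z) := by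
  refine Measure.pi_eq fun s hs => ?_
  rw [withDensity_apply _ (MeasurableSet.univ_pi hs),
    ← lintegral_indicator (MeasurableSet.univ_pi hs)]
  have h1 : ∀ z : Fin N → ℝ, (Set.univ.pi s).indicator
      (fun z => ENNReal.ofReal (density φ N z)) z
      = ENNReal.ofReal (∏ j, (s j).indicator (fun x => Real.exp (φ x)) (z j)) := by
    intro z
    by_cases hz : z ∈ Set.univ.pi s
    · rw [Set.indicator_of_mem hz, density, Real.exp_sum]
      congr 1
      exact Finset.prod_congr rfl fun j _ => by rw [Set.indicator_of_mem (hz j trivial)]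
    · rw [Set.indicator_of_notMem hz]
      obtain ⟨j, hj⟩ : ∃ j, z j ∉ s j := by simpa [Set.mem_pi] using hz
      rw [Finset.prod_eq_zero (Finset.mem_univ j) (Set.indicator_of_notMem hj _)]
      simp
  have hint : ∀ j, Integrable ((s j).indicator fun x => Real.exp (φ x)) :=
    fun j => (integrable_exp hφ).indicator (hs j)
  have hnn : ∀ j x, 0 ≤ (s j).indicator (fun x => Real.exp (φ x)) x :=
    fun j x => Set.indicator_nonneg (fun _ _ => (Real.exp_pos _).le) _
  simp only [h1]
  rw [volume_pi, ← ofReal_integral_eq_lintegral_ofReal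
    (Integrable.fintype_prod_dep (f := fun j => (s j).indicator fun x => Real.exp (φ x)) hint)
    (Eventually.of_forall fun z => Finset.prod_nonneg fun j _ => hnn j _),
    integral_fintype_prod_eq_prod (fun j => (s j).indicator fun x => Real.exp (φ x)),
    ENNReal.ofReal_prod_of_nonneg fun j _ => integral_nonneg (hnn j)]
  refine Finset.prod_congr rfl fun j _ => ?_
  rw [ofReal_integral_eq_lintegral_ofReal (hint j) (Eventually.of_forall (hnn j)), target,
    withDensity_apply _ (hs j), ← lintegral_indicator (hs j)]
  congr 1
  ext x
  by_cases hx : x ∈ s j <;> simp [hx]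

end Target

/-! ### Integration by parts -/

/-- Integration by parts for `target φ`, acting on one coordinate of a probability space whose law
is invariant under resampling that coordinate. -/
lemma integral_deriv_add_eq_zero {Ω : Type*} [MeasurableSpace Ω] {ρ : Measure Ω}
    [IsProbabilityMeasure ρ] {φ : ℝ → ℝ} (hφ : Differentiable ℝ φ) {ν : Measure ℝ} [SFinite ν]
    (hν : ν = target φ) {e : Ω × ℝ → Ω} (he : MeasurePreserving e (ρ.prod ν) ρ) {c : Ω → ℝ}
    (hc : ∀ a v, c (e (a, v)) = v) {K K' : Ω → ℝ} (hK : Integrable K ρ)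
    (hK' : Integrable (fun a => K' a + deriv φ (c a) * K a) ρ)
    (hd : ∀ a v, HasDerivAt (fun s => K (e (a, s))) (K' (e (a, v))) v) :
    ∫ a, (K' a + deriv φ (c a) * K a) ∂ρ = 0 := by
  have h1 := integral_map he.aemeasurable (by rw [he.map_eq]; exact hK'.1)
  rw [he.map_eq] at h1
  have hi1 := he.integrable_comp_of_integrable hK
  have hi2 := he.integrable_comp_of_integrable hK'
  simp only [Function.comp_def] at hi1 hi2
  rw [h1, integral_prod _ hi2]
  refine integral_eq_zero_of_ae ?_
  filter_upwards [hi1.prod_right_ae, hi2.prod_right_ae] with a ha1 ha2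
  simp only [hc] at ha1 ha2
  simp only [hc, Pi.zero_apply]
  subst hν
  rw [integral_target hφ.continuous]
  refine integral_eq_zero_of_hasDerivAt_of_integrable
    (f := fun v => Real.exp (φ v) * K (e (a, v))) (fun v => ?_)
    ((integrable_target_iff hφ.continuous).1 ha2) ((integrable_target_iff hφ.continuous).1 ha1)
  refine ((hφ v).hasDerivAt.exp.mul (hd a v)).congr_deriv ?_
  ring

/-- Integration by parts in one coordinate under the infinite product measure. -/
lemma integral_deriv_add_targetInf_eq_zero {φ : ℝ → ℝ} (hφ : Differentiable ℝ φ)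
    [IsProbabilityMeasure (target φ)] (i : ℕ) {K K' : (ℕ → ℝ) → ℝ}
    (hK : Integrable K (targetInf φ))
    (hK' : Integrable (fun x => K' x + deriv φ (x i) * K x) (targetInf φ))
    (hd : ∀ x, HasDerivAt (fun s => K (Function.update x i s)) (K' x) (x i)) :
    ∫ x, (K' x + deriv φ (x i) * K x) ∂(targetInf φ) = 0 := by
  have : IsProbabilityMeasure (targetInf φ) := by unfold targetInf; infer_instance
  refine integral_deriv_add_eq_zero hφ (c := fun x => x i) rfl
    (measurePreserving_update (target φ) i) (fun x v => by simp) hK hK' fun x v => ?_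
  have := hd (Function.update x i v)
  simpa using this

/-- The logarithm of the standard normal density. -/
def gaussPot (v : ℝ) : ℝ := -v ^ 2 / 2 + Real.log (√(2 * Real.pi))⁻¹

lemma hasDerivAt_gaussPot (v : ℝ) : HasDerivAt gaussPot (-v) v := by
  unfold gaussPot
  refine (((hasDerivAt_pow 2 v).neg.div_const 2).add_const _).congr_deriv ?_
  push_cast
  ring

lemma gaussianReal_eq_target : gaussianReal 0 1 = target gaussPot := by
  rw [gaussianReal_of_var_ne_zero _ one_ne_zero, target]
  congr 1
  ext x
  rw [gaussianPDF, gaussianPDFReal, gaussPot, Real.exp_add, Real.exp_log (by positivity), mul_comm]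
  simp

/-- The law of the Gaussian noise sequence. -/
def noise : Measure (ℕ → ℝ) := Measure.infinitePi fun _ : ℕ => gaussianReal 0 1

instance : IsProbabilityMeasure noise := by unfold noise; infer_instance

instance (φ : ℝ → ℝ) [IsProbabilityMeasure (target φ)] : IsProbabilityMeasure (targetInf φ) := by
  unfold targetInf; infer_instance

/-- The joint law of the state and the noise. -/
def joint (φ : ℝ → ℝ) [IsProbabilityMeasure (target φ)] : Measure ((ℕ → ℝ) × (ℕ → ℝ)) :=
  (targetInf φ).prod noise

section Joint

variable {φ : ℝ → ℝ} [IsProbabilityMeasure (target φ)]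

instance : IsProbabilityMeasure (joint φ) := by unfold joint; infer_instance

lemma measurePreserving_fst_joint : MeasurePreserving Prod.fst (joint φ) (targetInf φ) :=
  measurePreserving_fst

lemma measurePreserving_snd_joint : MeasurePreserving Prod.snd (joint φ) noise :=
  measurePreserving_snd

lemma measurePreserving_coord (i : ℕ) :
    MeasurePreserving (fun x : ℕ → ℝ => x i) (targetInf φ) (target φ) :=
  measurePreserving_eval_infinitePi (fun _ : ℕ => target φ) i

lemma measurePreserving_noise_coord (i : ℕ) :
    MeasurePreserving (fun w : ℕ → ℝ => w i) noise (gaussianReal 0 1) :=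
  measurePreserving_eval_infinitePi (fun _ : ℕ => gaussianReal 0 1) i

lemma measurePreserving_update_noise (i : ℕ) :
    MeasurePreserving
      (fun p : ((ℕ → ℝ) × (ℕ → ℝ)) × ℝ => (p.1.1, Function.update p.1.2 i p.2))
      ((joint φ).prod (gaussianReal 0 1)) (joint φ) :=
  ((MeasurePreserving.id (targetInf φ)).prod (measurePreserving_update (gaussianReal 0 1) i)).comp
    (measurePreserving_prodAssoc (targetInf φ) noise (gaussianReal 0 1))

/-- Stein's identity in the `i`-th noise coordinate. -/
lemma integral_noise_mul (i : ℕ) {K K' : (ℕ → ℝ) × (ℕ → ℝ) → ℝ}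
    (hK : Integrable K (joint φ)) (hwK : Integrable (fun p => p.2 i * K p) (joint φ))
    (hK' : Integrable K' (joint φ))
    (hd : ∀ p, HasDerivAt (fun s => K (p.1, Function.update p.2 i s)) (K' p) (p.2 i)) :
    ∫ p, p.2 i * K p ∂(joint φ) = ∫ p, K' p ∂(joint φ) := by
  have hder : ∀ v, deriv gaussPot v = -v := fun v => (hasDerivAt_gaussPot v).deriv
  have h := integral_deriv_add_eq_zero (ρ := joint φ)
    (fun v => (hasDerivAt_gaussPot v).differentiableAt)
    gaussianReal_eq_target (measurePreserving_update_noise i) (c := fun p => p.2 i)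
    (fun p v => by simp) hK (K' := K')
    (by
      simp only [hder]
      refine (hK'.sub hwK).congr (Eventually.of_forall fun p => ?_)
      simp only [Pi.sub_apply]; ring)
    (fun p v => by simpa using hd (p.1, Function.update p.2 i v))
  simp only [hder, neg_mul, ← sub_eq_add_neg] at h
  rw [integral_sub hK' hwK] at h
  linarith

/-! ### Detailed balance -/

/-- Resampling the `k`-th coordinate of both state and noise. -/
lemma lintegral_joint_resample (k : ℕ) {G : (ℕ → ℝ) × (ℕ → ℝ) → ℝ≥0∞} (hG : Measurable G) :
    ∫⁻ p, G p ∂(joint φ) = ∫⁻ p, ∫⁻ v, ∫⁻ y,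
      G (Function.update p.1 k y, Function.update p.2 k v)
        ∂(target φ) ∂(gaussianReal 0 1) ∂(joint φ) := by
  have hu := measurable_update_prod (X := ℝ) k
  have h1 : ∀ {H : (ℕ → ℝ) × (ℕ → ℝ) → ℝ≥0∞}, Measurable H → ∫⁻ p, H p ∂(joint φ)
      = ∫⁻ p, ∫⁻ v, H (p.1, Function.update p.2 k v) ∂(gaussianReal 0 1) ∂(joint φ) := by
    intro H hH
    rw [← (measurePreserving_update_noise k).lintegral_comp hH]
    exact lintegral_prod _ (hH.comp (measurePreserving_update_noise (φ := φ) k).measurable).aemeasurable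
  have h2 : ∫⁻ p, G p ∂(joint φ)
      = ∫⁻ p, ∫⁻ y, G (Function.update p.1 k y, p.2) ∂(target φ) ∂(joint φ) := by
    have hm : Measurable fun q : (ℕ → ℝ) × (ℕ → ℝ) × ℝ => G (Function.update q.2.1 k q.2.2, q.1) := by
      fun_prop
    unfold joint
    rw [lintegral_prod_symm _ hG.aemeasurable, lintegral_prod_symm _ (by
      refine Measurable.aemeasurable (Measurable.lintegral_prod_right' (f := fun q :
        ((ℕ → ℝ) × (ℕ → ℝ)) × ℝ => G (Function.update q.1.1 k q.2, q.1.2)) ?_)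
      exact hG.comp ((hu.comp ((measurable_fst.comp measurable_fst).prodMk measurable_snd)).prodMk
        (measurable_snd.comp measurable_fst)))]
    refine lintegral_congr fun w => ?_
    have hGw : Measurable fun x => G (x, w) := hG.comp (measurable_id.prodMk measurable_const)
    rw [targetInf, ← (measurePreserving_update (target φ) k).lintegral_comp hGw]
    exact lintegral_prod _ (hGw.comp hu).aemeasurable
  rw [h2, h1]
  refine Measurable.lintegral_prod_right' (f := fun q :
        ((ℕ → ℝ) × (ℕ → ℝ)) × ℝ => G (Function.update q.1.1 k q.2, q.1.2)) ?_
  exact hG.comp ((hu.comp ((measurable_fst.comp measurable_fst).prodMk measurable_snd)).prodMk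
        (measurable_snd.comp measurable_fst))

/-- The proposal: the first `n` coordinates of `x` move by `t w_i`. -/
def shift (t : ℝ) (n : ℕ) (p : (ℕ → ℝ) × (ℕ → ℝ)) : ℕ → ℝ :=
  fun i => p.1 i + if i < n then t * p.2 i else 0

/-- The involution `(x, w) ↦ (x', -w)` that exchanges a state with its proposal, acting on the
first `n` coordinates. -/
def reversal (t : ℝ) (n : ℕ) (p : (ℕ → ℝ) × (ℕ → ℝ)) : (ℕ → ℝ) × (ℕ → ℝ) :=
  (shift t n p, fun i => if i < n then -p.2 i else p.2 i)

/-- The logarithm of the Metropolis–Hastings ratio. -/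
def logRatio (φ : ℝ → ℝ) (t : ℝ) (n : ℕ) (p : (ℕ → ℝ) × (ℕ → ℝ)) : ℝ :=
  ∑ i ∈ Finset.range n, (φ (p.1 i + t * p.2 i) - φ (p.1 i))

lemma continuous_shift (t : ℝ) (n : ℕ) : Continuous (shift t n) := by
  refine continuous_pi fun i => ?_
  unfold shift
  split_ifs <;> fun_prop

lemma continuous_reversal (t : ℝ) (n : ℕ) : Continuous (reversal t n) := by
  refine (continuous_shift t n).prodMk (continuous_pi fun i => ?_)
  split_ifs <;> fun_prop

@[fun_prop]
lemma measurable_shift (t : ℝ) (n : ℕ) : Measurable (shift t n) := (continuous_shift t n).measurable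

@[fun_prop]
lemma measurable_reversal (t : ℝ) (n : ℕ) : Measurable (reversal t n) :=
  (continuous_reversal t n).measurable

lemma continuous_logRatio {φ : ℝ → ℝ} (hφ : Continuous φ) (t : ℝ) (n : ℕ) :
    Continuous (logRatio φ t n) := by
  unfold logRatio; fun_prop

lemma shift_reversal (t : ℝ) (n : ℕ) (p : (ℕ → ℝ) × (ℕ → ℝ)) :
    shift t n (reversal t n p) = p.1 := by
  ext i
  by_cases h : i < n <;> simp [shift, reversal, h]

lemma logRatio_reversal (φ : ℝ → ℝ) (t : ℝ) (n : ℕ) (p : (ℕ → ℝ) × (ℕ → ℝ)) :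
    logRatio φ t n (reversal t n p) = -logRatio φ t n p := by
  unfold logRatio
  rw [← Finset.sum_neg_distrib]
  refine Finset.sum_congr rfl fun i hi => ?_
  have := Finset.mem_range.1 hi
  simp [shift, reversal, this]

/-- Detailed balance in one coordinate. -/
lemma lintegral_reversal_coord (hφ : Continuous φ) (t : ℝ) (k : ℕ)
    {F : (ℕ → ℝ) × (ℕ → ℝ) → ℝ≥0∞} (hF : Measurable F) :
    ∫⁻ p, F (Function.update p.1 k (p.1 k + t * p.2 k), Function.update p.2 k (-p.2 k)) *
      ENNReal.ofReal (Real.exp (φ (p.1 k + t * p.2 k) - φ (p.1 k))) ∂(joint φ)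
      = ∫⁻ p, F p ∂(joint φ) := by
  have hu := measurable_update_prod (X := ℝ) k
  have hφm := hφ.measurable
  have hmeas : Measurable fun p : (ℕ → ℝ) × (ℕ → ℝ) =>
      F (Function.update p.1 k (p.1 k + t * p.2 k), Function.update p.2 k (-p.2 k)) *
      ENNReal.ofReal (Real.exp (φ (p.1 k + t * p.2 k) - φ (p.1 k))) := by
    refine Measurable.mul (hF.comp (Measurable.prodMk ?_ ?_)) (by fun_prop)
    · exact hu.comp (measurable_fst.prodMk (by fun_prop :
        Measurable fun p : (ℕ → ℝ) × (ℕ → ℝ) => p.1 k + t * p.2 k))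
    · exact hu.comp (measurable_snd.prodMk (by fun_prop :
        Measurable fun p : (ℕ → ℝ) × (ℕ → ℝ) => -p.2 k))
  rw [lintegral_joint_resample k hmeas, lintegral_joint_resample k hF]
  refine lintegral_congr fun p => ?_
  simp only [Function.update_self, Function.update_idem]
  have hFu : Measurable fun q : ℝ × ℝ => F (Function.update p.1 k q.2, Function.update p.2 k q.1) :=
    hF.comp ((hu.comp (measurable_const.prodMk measurable_snd)).prodMk
      (hu.comp (measurable_const.prodMk measurable_fst)))
  have hFv : ∀ v, Measurable fun y => F (Function.update p.1 k y, Function.update p.2 k v) :=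
    fun v => hFu.comp (measurable_const.prodMk measurable_id)
  have hneg : ∀ v, ∫⁻ y, F (Function.update p.1 k (y + t * v), Function.update p.2 k (-v)) *
      ENNReal.ofReal (Real.exp (φ (y + t * v) - φ y)) ∂(target φ)
      = ∫⁻ y, F (Function.update p.1 k y, Function.update p.2 k (-v)) ∂(target φ) := by
    intro v
    have hFy : Measurable fun y => F (Function.update p.1 k (y + t * v), Function.update p.2 k (-v)) :=
      (hFv (-v)).comp (measurable_id.add_const (t * v))
    have hFy' : Measurable fun y =>
        F (Function.update p.1 k (y + t * v), Function.update p.2 k (-v)) *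
          ENNReal.ofReal (Real.exp (φ (y + t * v) - φ y)) := hFy.mul (by fun_prop)
    rw [lintegral_target hφ hFy', lintegral_target hφ (hFv (-v)),
      ← lintegral_add_right_eq_self (fun y => ENNReal.ofReal (Real.exp (φ y)) *
        F (Function.update p.1 k y, Function.update p.2 k (-v))) (t * v)]
    refine lintegral_congr fun y => ?_
    rw [mul_comm, mul_assoc, ← ENNReal.ofReal_mul (Real.exp_pos _).le, ← Real.exp_add, mul_comm]
    simp
  simp only [hneg]
  have hH : Measurable fun v =>
      ∫⁻ y, F (Function.update p.1 k y, Function.update p.2 k v) ∂(target φ) :=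
    Measurable.lintegral_prod_right' hFu
  have hsymm : Measure.map (fun v : ℝ => -v) (gaussianReal 0 1) = gaussianReal 0 1 := by
    simpa using gaussianReal_map_neg (μ := 0) (v := 1)
  conv_rhs => rw [← hsymm, lintegral_map hH measurable_neg]

/-- Detailed balance: the involution `reversal` has Jacobian `exp logRatio` for the joint law. -/
lemma lintegral_reversal (hφ : Continuous φ) (t : ℝ) (n : ℕ)
    {F : (ℕ → ℝ) × (ℕ → ℝ) → ℝ≥0∞} (hF : Measurable F) :
    ∫⁻ p, F (reversal t n p) * ENNReal.ofReal (Real.exp (logRatio φ t n p)) ∂(joint φ)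
      = ∫⁻ p, F p ∂(joint φ) := by
  induction n with
  | zero =>
    have h0 : ∀ p, reversal t 0 p = p := fun p => by
      refine Prod.ext (funext fun i => ?_) (funext fun i => ?_) <;> simp [reversal, shift]
    simp [h0, logRatio]
  | succ n ih =>
    rw [← ih]
    have hm : Measurable fun p => F (reversal t n p) *
        ENNReal.ofReal (Real.exp (logRatio φ t n p)) := by
      have := (continuous_logRatio hφ t n).measurable
      fun_prop
    rw [← lintegral_reversal_coord hφ t n hm]
    refine lintegral_congr fun p => ?_
    have h1 : reversal t n (Function.update p.1 n (p.1 n + t * p.2 n),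
        Function.update p.2 n (-p.2 n)) = reversal t (n + 1) p := by
      refine Prod.ext (funext fun i => ?_) (funext fun i => ?_)
      · rcases lt_trichotomy i n with h | h | h
        · simp [reversal, shift, h, h.ne, h.trans (Nat.lt_succ_self n)]
        · subst h; simp [reversal, shift]
        · simp [reversal, shift, h.ne', not_lt.2 h.le, not_lt.2 (Nat.succ_le_of_lt h)]
      · rcases lt_trichotomy i n with h | h | h
        · simp [reversal, h, h.ne, h.le]
        · subst h; simp [reversal]
        · simp [reversal, h.ne', not_lt.2 h.le, not_le.2 h]
    have h2 : logRatio φ t n (Function.update p.1 n (p.1 n + t * p.2 n),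
        Function.update p.2 n (-p.2 n)) = logRatio φ t n p := by
      unfold logRatio
      refine Finset.sum_congr rfl fun i hi => ?_
      have := (Finset.mem_range.1 hi).ne
      simp [this]
    rw [h1, h2, mul_assoc, ← ENNReal.ofReal_mul (Real.exp_pos _).le, ← Real.exp_add]
    simp only [logRatio, Finset.sum_range_succ]

/-- Detailed balance as an identity of measures. -/
lemma map_reversal (hφ : Continuous φ) (t : ℝ) (n : ℕ) :
    Measure.map (reversal t n)
      ((joint φ).withDensity fun p => ENNReal.ofReal (Real.exp (logRatio φ t n p)))
      = joint φ := by
  have hS := (continuous_logRatio hφ t n).measurable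
  refine Measure.ext_of_lintegral _ fun F hF => ?_
  rw [lintegral_map hF (measurable_reversal t n), lintegral_withDensity_eq_lintegral_mul _
    (by fun_prop) (by fun_prop), ← lintegral_reversal hφ t n hF]
  refine lintegral_congr fun p => ?_
  rw [Pi.mul_apply, mul_comm]

lemma integral_reversal (hφ : Continuous φ) (t : ℝ) (n : ℕ)
    {F : (ℕ → ℝ) × (ℕ → ℝ) → ℝ} (hF : AEStronglyMeasurable F (joint φ)) :
    ∫ p, F (reversal t n p) * Real.exp (logRatio φ t n p) ∂(joint φ) = ∫ p, F p ∂(joint φ) := by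
  have hS := (continuous_logRatio hφ t n).measurable
  have h := integral_map (measurable_reversal t n).aemeasurable (by rwa [map_reversal hφ t n])
  rw [map_reversal hφ t n] at h
  rw [h, integral_withDensity_eq_integral_toReal_smul (by fun_prop)
    (Eventually.of_forall fun _ => ENNReal.ofReal_lt_top)]
  refine integral_congr_ae (Eventually.of_forall fun p => ?_)
  simp only [ENNReal.toReal_ofReal (Real.exp_pos _).le, smul_eq_mul]
  ring

lemma integrable_reversal (hφ : Continuous φ) (t : ℝ) (n : ℕ)
    {F : (ℕ → ℝ) × (ℕ → ℝ) → ℝ} (hF : Integrable F (joint φ)) :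
    Integrable (fun p => F (reversal t n p) * Real.exp (logRatio φ t n p)) (joint φ) := by
  have hS := (continuous_logRatio hφ t n).measurable
  rw [← map_reversal hφ t n] at hF
  have h := hF.comp_measurable (measurable_reversal t n)
  rw [integrable_withDensity_iff_integrable_smul' (by fun_prop)
    (Eventually.of_forall fun _ => ENNReal.ofReal_lt_top)] at h
  refine h.congr (Eventually.of_forall fun p => ?_)
  simp only [ENNReal.toReal_ofReal (Real.exp_pos _).le, smul_eq_mul, Function.comp_apply]
  ring

/-- The law of the proposal is absolutely continuous with respect to the target. -/
lemma ae_shift (hφ : Continuous φ) (t : ℝ) (n : ℕ) {q : (ℕ → ℝ) → Prop}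
    (hq : ∀ᵐ x ∂(targetInf φ), q x) : ∀ᵐ p ∂(joint φ), q (shift t n p) := by
  have h1 : ∀ᵐ p ∂(joint φ), q p.1 := measurePreserving_fst_joint.quasiMeasurePreserving.ae hq
  have hS := (continuous_logRatio hφ t n).measurable
  rw [← map_reversal hφ t n] at h1
  have h2 := ae_of_ae_map (measurable_reversal t n).aemeasurable h1
  rw [ae_withDensity_iff (by fun_prop)] at h2
  filter_upwards [h2] with p hp
  exact hp (by simp [Real.exp_pos])

end Joint

/-! ### A smooth substitute for the acceptance function -/

/-- A smooth minorant of `s ↦ min 1 (exp s)` that satisfies the same balance relation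
`exp s * ψ (-s) = ψ s`. -/
def softAccept (δ s : ℝ) : ℝ := Real.exp ((s - √(s ^ 2 + δ)) / 2)

/-- The derivative of `softAccept δ`. -/
def softAcceptDeriv (δ s : ℝ) : ℝ := softAccept δ s * ((1 - s / √(s ^ 2 + δ)) / 2)

section SoftAccept

variable {δ : ℝ}

lemma softAccept_pos (δ s : ℝ) : 0 < softAccept δ s := Real.exp_pos _

lemma abs_le_sqrt_sq_add (hδ : 0 < δ) (s : ℝ) : |s| ≤ √(s ^ 2 + δ) :=
  Real.abs_le_sqrt (by linarith)

lemma softAccept_le_one (hδ : 0 < δ) (s : ℝ) : softAccept δ s ≤ 1 := by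
  rw [softAccept, Real.exp_le_one_iff]
  linarith [abs_le_sqrt_sq_add hδ s, le_abs_self s]

lemma softAccept_le_exp (hδ : 0 < δ) (s : ℝ) : softAccept δ s ≤ Real.exp s := by
  rw [softAccept, Real.exp_le_exp]
  linarith [abs_le_sqrt_sq_add hδ s, neg_abs_le s]

lemma softAccept_le_min (hδ : 0 < δ) (s : ℝ) : softAccept δ s ≤ min 1 (Real.exp s) :=
  le_min (softAccept_le_one hδ s) (softAccept_le_exp hδ s)

/-- `softAccept δ` approximates `min 1 ∘ exp` uniformly. -/
lemma min_le_softAccept_add (hδ : 0 < δ) (s : ℝ) :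
    min 1 (Real.exp s) ≤ softAccept δ s + √δ / 2 := by
  have h0 : min 1 (Real.exp s) = Real.exp ((s - |s|) / 2) := by
    rcases le_total 0 s with h | h
    · rw [abs_of_nonneg h, min_eq_left (Real.one_le_exp h)]; simp
    · rw [abs_of_nonpos h, min_eq_right (Real.exp_le_one_iff.2 h)]; congr 1; ring
  have h1 : √(s ^ 2 + δ) ≤ |s| + √δ := by
    rw [Real.sqrt_le_left (by positivity)]
    nlinarith [sq_abs s, Real.sq_sqrt hδ.le, abs_nonneg s, Real.sqrt_nonneg δ,
      mul_nonneg (abs_nonneg s) (Real.sqrt_nonneg δ)]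
  have h2 : softAccept δ s = Real.exp ((s - |s|) / 2) * Real.exp (-((√(s ^ 2 + δ) - |s|) / 2)) := by
    rw [softAccept, ← Real.exp_add]; congr 1; ring
  have h3 := Real.add_one_le_exp (-((√(s ^ 2 + δ) - |s|) / 2))
  have h4 : Real.exp ((s - |s|) / 2) ≤ 1 :=
    Real.exp_le_one_iff.2 (by linarith [le_abs_self s])
  have h5 := (Real.exp_pos ((s - |s|) / 2))
  rw [h0, h2]
  nlinarith [mul_le_mul_of_nonneg_left h3 h5.le, abs_le_sqrt_sq_add hδ s, Real.sqrt_nonneg δ]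

lemma exp_mul_softAccept_neg (δ s : ℝ) : softAccept δ (-s) * Real.exp s = softAccept δ s := by
  rw [softAccept, softAccept, ← Real.exp_add]
  congr 1
  rw [neg_sq]
  ring

lemma hasDerivAt_sqrt_sq_add (hδ : 0 < δ) (s : ℝ) :
    HasDerivAt (fun s => √(s ^ 2 + δ)) (s / √(s ^ 2 + δ)) s := by
  have h := ((hasDerivAt_pow 2 s).add_const δ).sqrt (by positivity)
  refine h.congr_deriv ?_
  push_cast
  field_simp

lemma hasDerivAt_softAccept (hδ : 0 < δ) (s : ℝ) :
    HasDerivAt (softAccept δ) (softAcceptDeriv δ s) s :=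
  ((((hasDerivAt_id s).sub (hasDerivAt_sqrt_sq_add hδ s)).div_const 2).exp).congr_deriv (by
    simp [softAcceptDeriv, softAccept])

lemma abs_div_sqrt_le_one (hδ : 0 < δ) (s : ℝ) : |s / √(s ^ 2 + δ)| ≤ 1 := by
  rw [abs_div, abs_of_nonneg (Real.sqrt_nonneg _)]
  exact div_le_one_of_le₀ (abs_le_sqrt_sq_add hδ s) (Real.sqrt_nonneg _)

lemma abs_softAccept_le_one (hδ : 0 < δ) (s : ℝ) : |softAccept δ s| ≤ 1 := by
  rw [abs_of_pos (softAccept_pos δ s)]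
  exact softAccept_le_one hδ s

lemma abs_softAcceptDeriv_le_one (hδ : 0 < δ) (s : ℝ) : |softAcceptDeriv δ s| ≤ 1 := by
  have h1 := abs_softAccept_le_one hδ s
  have h2 : |(1 - s / √(s ^ 2 + δ)) / 2| ≤ 1 := by
    have := abs_le.1 (abs_div_sqrt_le_one hδ s)
    rw [abs_le]; constructor <;> linarith
  rw [softAcceptDeriv, abs_mul]
  exact mul_le_one₀ h1 (abs_nonneg _) h2

lemma lipschitz_softAccept (hδ : 0 < δ) : LipschitzWith 1 (softAccept δ) :=
  lipschitzWith_of_nnnorm_deriv_le (fun s => (hasDerivAt_softAccept hδ s).differentiableAt)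
    fun s => by
      rw [(hasDerivAt_softAccept hδ s).deriv, ← NNReal.coe_le_coe]
      simpa using abs_softAcceptDeriv_le_one hδ s

lemma exists_lipschitz_softAcceptDeriv (hδ : 0 < δ) : ∃ L, LipschitzWith L (softAcceptDeriv δ) := by
  have hq : ∀ s, HasDerivAt (fun s => (1 - s / √(s ^ 2 + δ)) / 2)
      (-(δ / (√(s ^ 2 + δ) ^ 3)) / 2) s := by
    intro s
    have hpos : 0 < √(s ^ 2 + δ) := Real.sqrt_pos.2 (by positivity)
    have h := (((hasDerivAt_id s).div (hasDerivAt_sqrt_sq_add hδ s) hpos.ne').const_sub 1).div_const 2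
    refine h.congr_deriv ?_
    have hsq : √(s ^ 2 + δ) ^ 2 = s ^ 2 + δ := Real.sq_sqrt (by positivity)
    simp only [id, one_mul]
    congr 2
    rw [div_eq_div_iff (by positivity) (by positivity)]
    field_simp
    rw [hsq]; ring
  have hd : ∀ s, HasDerivAt (softAcceptDeriv δ) (softAcceptDeriv δ s * ((1 - s / √(s ^ 2 + δ)) / 2)
      + softAccept δ s * (-(δ / (√(s ^ 2 + δ) ^ 3)) / 2)) s :=
    fun s => (hasDerivAt_softAccept hδ s).mul (hq s)
  refine ⟨Real.toNNReal (1 + δ / √δ ^ 3),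
    lipschitzWith_of_nnnorm_deriv_le (fun s => (hd s).differentiableAt) fun s => ?_⟩
  rw [(hd s).deriv, ← NNReal.coe_le_coe]
  rw [coe_nnnorm, Real.norm_eq_abs, Real.coe_toNNReal _ (by positivity)]
  refine (abs_add_le _ _).trans (add_le_add ?_ ?_)
  · have h2 : |(1 - s / √(s ^ 2 + δ)) / 2| ≤ 1 := by
      have := abs_le.1 (abs_div_sqrt_le_one hδ s)
      rw [abs_le]; constructor <;> linarith
    rw [abs_mul]
    exact mul_le_one₀ (abs_softAcceptDeriv_le_one hδ s) (abs_nonneg _) h2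
  · have hle : √δ ≤ √(s ^ 2 + δ) := Real.sqrt_le_sqrt (by nlinarith [sq_nonneg s])
    have hδ' : 0 < √δ := Real.sqrt_pos.2 hδ
    have h3 : δ / √(s ^ 2 + δ) ^ 3 ≤ δ / √δ ^ 3 := by gcongr
    have h4 : 0 ≤ δ / √(s ^ 2 + δ) ^ 3 := by positivity
    have h5 : |(-(δ / (√(s ^ 2 + δ) ^ 3)) / 2)| ≤ δ / √δ ^ 3 := by
      rw [abs_le]; constructor <;> linarith
    rw [abs_mul]
    calc |softAccept δ s| * _ ≤ 1 * (δ / √δ ^ 3) :=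
          mul_le_mul (abs_softAccept_le_one hδ s) h5 (abs_nonneg _) zero_le_one
      _ = _ := one_mul _

/-- The combination `ψ' - ψ / 2` is odd for the balance relation, so that its mean under the
stationary chain vanishes. -/
lemma softAcceptDeriv_sub_half (δ s : ℝ) :
    (softAcceptDeriv δ (-s) - softAccept δ (-s) / 2) * Real.exp s
      = -(softAcceptDeriv δ s - softAccept δ s / 2) := by
  have h := exp_mul_softAccept_neg δ s
  simp only [softAcceptDeriv, neg_sq]
  linear_combination (s / √(s ^ 2 + δ) / 2) * h

end SoftAccept

/-! ### One-dimensional estimates -/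

/-- The regularity of the log-density used in the proof: the score `φ'` has a modulus of continuity
`m` of polynomial growth, uniformly in space, and finite Fisher information. -/
structure ScoreModulus (φ m : ℝ → ℝ) : Prop where
  differentiable : Differentiable ℝ φ
  bound : ∀ x v, |deriv φ (x + v) - deriv φ x| ≤ m v
  continuous_modulus : Continuous m
  modulus_zero : m 0 = 0
  mono : ∀ u v, |u| ≤ |v| → m u ≤ m v
  growth : ∃ (C : ℝ) (M : ℕ), ∀ v, m v ≤ C * (1 + |v| ^ M)
  fisher : Integrable fun x => |deriv φ x| ^ 2 * Real.exp (φ x)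

namespace ScoreModulus

variable {φ m : ℝ → ℝ} (H : ScoreModulus φ m)

include H

lemma continuous : Continuous φ := H.differentiable.continuous

lemma nonneg (v : ℝ) : 0 ≤ m v := (abs_nonneg _).trans (H.bound 0 v)

lemma bound' (x y : ℝ) : |deriv φ y - deriv φ x| ≤ m (y - x) := by
  simpa using H.bound x (y - x)

lemma continuous_deriv : Continuous (deriv φ) := by
  rw [continuous_iff_continuousAt]
  intro x
  rw [ContinuousAt, tendsto_iff_norm_sub_tendsto_zero]
  refine squeeze_zero (fun _ => norm_nonneg _) (fun y => H.bound' x y) ?_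
  have h : Tendsto (fun y => m (y - x)) (𝓝 x) (𝓝 (m (x - x))) :=
    (H.continuous_modulus.comp (continuous_id.sub continuous_const)).tendsto x
  simpa [H.modulus_zero] using h

/-- First-order expansion of `φ` along a segment, centred at any of its points. -/
lemma abs_increment_sub_le (a v s : ℝ) (hs : s ∈ Set.Icc (0 : ℝ) 1) :
    |φ (a + v) - φ a - v * deriv φ (a + s * v)| ≤ |v| * m v := by
  have hd : ∀ z, HasDerivAt (fun z => φ z - z * deriv φ (a + s * v))
      (deriv φ z - deriv φ (a + s * v)) z := fun z =>
    ((H.differentiable z).hasDerivAt.sub ((hasDerivAt_id z).mul_const _)).congr_deriv (by simp)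
  have h := (convex_uIcc a (a + v)).norm_image_sub_le_of_norm_hasDerivWithin_le
    (C := m v) (fun z _ => (hd z).hasDerivWithinAt) (fun z hz => ?_)
    Set.left_mem_uIcc Set.right_mem_uIcc
  · simp only [Real.norm_eq_abs, add_sub_cancel_left] at h
    rw [mul_comm |v|]
    refine le_of_eq_of_le ?_ h
    congr 1
    ring
  · refine (H.bound' _ _).trans (H.mono _ _ ?_)
    have h2 : a + s * v ∈ Set.uIcc a (a + v) := by
      rw [Set.mem_uIcc]
      rcases le_total 0 v with hv | hv
      · left; constructor <;> nlinarith [hs.1, hs.2]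
      · right; constructor <;> nlinarith [hs.1, hs.2]
    have := Set.abs_sub_le_of_uIcc_subset_uIcc (Set.uIcc_subset_uIcc h2 hz)
    simpa using this

lemma abs_increment_le (x v : ℝ) :
    |φ (x + v) - φ x| ≤ |v| * |deriv φ x| + |v| * m v := by
  have h := H.abs_increment_sub_le x v 0 (by simp)
  rw [zero_mul, add_zero] at h
  calc |φ (x + v) - φ x| = |v * deriv φ x + (φ (x + v) - φ x - v * deriv φ x)| := by congr 1; ring
    _ ≤ _ := (abs_add_le _ _).trans (by rw [abs_mul]; gcongr)

lemma integrable_growth (p q : ℕ) : Integrable (fun w => |w| ^ p * m w ^ q) (gaussianReal 0 1) := by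
  obtain ⟨C, M, hC⟩ := H.growth
  have hC0 : 0 ≤ C := by
    have := (H.nonneg 0).trans (hC 0)
    by_contra hneg
    have h2 : (0 : ℝ) ≤ |(0 : ℝ)| ^ M := by positivity
    nlinarith
  have hpow : ∀ j : ℕ, Integrable (fun w : ℝ => |w| ^ j) (gaussianReal 0 1) := fun j => by
    have := (memLp_id_gaussianReal (μ := 0) (v := 1) j).integrable_norm_pow'
    simpa using this
  have hb : Integrable (fun w : ℝ => (2 * C) ^ q * (|w| ^ p + |w| ^ (p + M * q)))
      (gaussianReal 0 1) := ((hpow _).add (hpow _)).const_mul _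
  refine hb.mono' ((continuous_abs.pow p).mul (H.continuous_modulus.pow q)).aestronglyMeasurable
    (Eventually.of_forall fun w => ?_)
  have h1 : m w ^ q ≤ (C * (1 + |w| ^ M)) ^ q := pow_le_pow_left₀ (H.nonneg w) (hC w) q
  have h2 : (1 + |w| ^ M) ^ q ≤ 2 ^ q * (1 + |w| ^ (M * q)) := by
    rcases le_total (|w| ^ M) 1 with hw | hw
    · calc (1 + |w| ^ M) ^ q ≤ 2 ^ q := pow_le_pow_left₀ (by positivity) (by linarith) q
        _ ≤ _ := le_mul_of_one_le_right (by positivity) (by linarith [pow_nonneg (abs_nonneg w) (M * q)])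
    · calc (1 + |w| ^ M) ^ q ≤ (2 * |w| ^ M) ^ q := pow_le_pow_left₀ (by positivity) (by linarith) q
        _ = 2 ^ q * |w| ^ (M * q) := by rw [mul_pow, pow_mul]
        _ ≤ _ := by gcongr; linarith
  rw [Real.norm_of_nonneg (mul_nonneg (by positivity) (pow_nonneg (H.nonneg w) q))]
  calc |w| ^ p * m w ^ q ≤ |w| ^ p * (C ^ q * (2 ^ q * (1 + |w| ^ (M * q)))) := by
        rw [mul_pow] at h1
        refine mul_le_mul_of_nonneg_left (h1.trans ?_) (by positivity)
        gcongr
    _ = _ := by rw [mul_pow, pow_add]; ring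

lemma continuous_scaled (T : ℝ) (p q : ℕ) : Continuous fun w => |w| ^ p * m (T * w) ^ q := by
  have := H.continuous_modulus
  fun_prop

/-- `m (T w)` has Gaussian moments of all orders. -/
lemma integrable_scaled (T : ℝ) (p q : ℕ) :
    Integrable (fun w => |w| ^ p * m (T * w) ^ q) (gaussianReal 0 1) := by
  obtain ⟨C, M, hC⟩ := H.growth
  have H' : ScoreModulus φ (fun w => m (max 1 |T| * w)) :=
    { differentiable := H.differentiable
      bound := fun x v => (H.bound x v).trans (H.mono _ _ (by
        rw [abs_mul, abs_of_nonneg (a := max 1 |T|) (by positivity)]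
        exact le_mul_of_one_le_left (abs_nonneg _) (le_max_left _ _)))
      continuous_modulus := H.continuous_modulus.comp (by fun_prop)
      modulus_zero := by simp [H.modulus_zero]
      mono := fun u v h => H.mono _ _ (by rw [abs_mul, abs_mul]; gcongr)
      growth := by
        have hC0 : 0 ≤ C := by
          have := (H.nonneg 0).trans (hC 0)
          by_contra hneg
          have h2 : (0 : ℝ) ≤ |(0 : ℝ)| ^ M := by positivity
          nlinarith
        refine ⟨C * (max 1 |T|) ^ M, M, fun v => (hC _).trans ?_⟩
        rw [abs_mul, mul_pow, abs_of_nonneg (a := max 1 |T|) (by positivity), mul_assoc]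
        have h1 : (1 : ℝ) ≤ max 1 |T| ^ M := one_le_pow₀ (le_max_left _ _)
        gcongr
        rw [mul_add]
        linarith
      fisher := H.fisher }
  refine (H'.integrable_growth p q).mono' (H.continuous_scaled T p q).aestronglyMeasurable
    (Eventually.of_forall fun w => ?_)
  rw [Real.norm_of_nonneg (mul_nonneg (by positivity) (pow_nonneg (H.nonneg _) q))]
  gcongr
  · exact H.nonneg _
  · refine H.mono _ _ ?_
    rw [abs_mul, abs_mul, abs_of_nonneg (a := max 1 |T|) (by positivity)]
    gcongr
    exact le_max_right _ _

lemma tendsto_integral_scaled {t : ℕ → ℝ} (ht : Tendsto t atTop (𝓝 0)) {T : ℝ}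
    (hT : ∀ n, |t n| ≤ T) (p q : ℕ) (hq : q ≠ 0) :
    Tendsto (fun n => ∫ w, |w| ^ p * m (t n * w) ^ q ∂(gaussianReal 0 1)) atTop (𝓝 0) := by
  have hT0 : 0 ≤ T := (abs_nonneg _).trans (hT 0)
  suffices h : Tendsto (fun n => ∫ w, |w| ^ p * m (t n * w) ^ q ∂(gaussianReal 0 1)) atTop
      (𝓝 (∫ _, (0 : ℝ) ∂(gaussianReal 0 1))) by simpa using h
  refine tendsto_integral_of_dominated_convergence (fun w => |w| ^ p * m (T * w) ^ q)
    (fun n => (H.continuous_scaled _ p q).aestronglyMeasurable) (H.integrable_scaled T p q)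
    (fun n => Eventually.of_forall fun w => ?_) (Eventually.of_forall fun w => ?_)
  · rw [Real.norm_of_nonneg (mul_nonneg (by positivity) (pow_nonneg (H.nonneg _) q))]
    gcongr
    · exact H.nonneg _
    · refine H.mono _ _ ?_
      rw [abs_mul, abs_mul, abs_of_nonneg hT0]
      gcongr
      exact hT n
  · have h1 : Tendsto (fun n => t n * w) atTop (𝓝 0) := by simpa using ht.mul_const w
    have h2 : Tendsto (fun n => m (t n * w)) atTop (𝓝 0) := by
      simpa [H.modulus_zero, Function.comp_def] using (H.continuous_modulus.tendsto 0).comp h1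
    simpa [hq] using (h2.pow q).const_mul (|w| ^ p)

lemma integrable_deriv_sq : Integrable (fun x => deriv φ x ^ 2) (target φ) := by
  rw [integrable_target_iff H.continuous]
  refine H.fisher.congr (Eventually.of_forall fun x => ?_)
  simp only [sq_abs]; ring

lemma integral_deriv_sq : ∫ x, deriv φ x ^ 2 ∂(target φ) = fisherInfo φ := by
  rw [integral_target H.continuous, fisherInfo]
  refine integral_congr_ae (Eventually.of_forall fun x => ?_)
  simp only [sq_abs]; ring

lemma memLp_deriv : MemLp (deriv φ) 2 (target φ) :=
  (memLp_two_iff_integrable_sq H.continuous_deriv.aestronglyMeasurable).2 H.integrable_deriv_sq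

lemma integrable_abs_deriv [IsProbabilityMeasure (target φ)] :
    Integrable (fun x => |deriv φ x|) (target φ) :=
  (H.memLp_deriv.integrable one_le_two).abs

end ScoreModulus

namespace ScoreModulus

variable {φ m : ℝ → ℝ} (H : ScoreModulus φ m) [IsProbabilityMeasure (target φ)]

include H

lemma integrable_increment (v : ℝ) :
    Integrable (fun x => φ (x + v) - φ x) (target φ) := by
  have hφ := H.continuous
  refine ((H.integrable_abs_deriv.const_mul |v|).add (integrable_const (|v| * m v))).mono'
    (by fun_prop : Continuous fun x => φ (x + v) - φ x).aestronglyMeasurable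
    (Eventually.of_forall fun x => H.abs_increment_le x v)

/-- A translate of the increment, tested against the score. -/
lemma abs_integral_translate_sub_le (v s : ℝ) (hs : s ∈ Set.Icc (0 : ℝ) 1) :
    |(∫ y, (φ (y + (1 - s) * v) - φ (y - s * v)) * (v * deriv φ y) ∂(target φ))
      - v ^ 2 * fisherInfo φ| ≤ v ^ 2 * m v * ∫ y, |deriv φ y| ∂(target φ) ∧
    Integrable (fun y => (φ (y + (1 - s) * v) - φ (y - s * v)) * (v * deriv φ y)) (target φ) := by
  have hφ := H.continuous
  have hφ' := H.continuous_deriv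
  have hb : ∀ y, ‖(φ (y + (1 - s) * v) - φ (y - s * v)) * (v * deriv φ y)
      - v ^ 2 * deriv φ y ^ 2‖ ≤ v ^ 2 * m v * |deriv φ y| := by
    intro y
    have h := H.abs_increment_sub_le (y - s * v) v s hs
    rw [show y - s * v + v = y + (1 - s) * v by ring, show y - s * v + s * v = y by ring] at h
    rw [show (φ (y + (1 - s) * v) - φ (y - s * v)) * (v * deriv φ y) - v ^ 2 * deriv φ y ^ 2
      = (φ (y + (1 - s) * v) - φ (y - s * v) - v * deriv φ y) * (v * deriv φ y) by ring,
      Real.norm_eq_abs, abs_mul, abs_mul, ← sq_abs v]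
    calc _ ≤ (|v| * m v) * (|v| * |deriv φ y|) := by gcongr
      _ = _ := by ring
  have hc : Continuous fun y => (φ (y + (1 - s) * v) - φ (y - s * v)) * (v * deriv φ y)
      - v ^ 2 * deriv φ y ^ 2 := by fun_prop
  have hi1 : Integrable (fun y => (φ (y + (1 - s) * v) - φ (y - s * v)) * (v * deriv φ y)
      - v ^ 2 * deriv φ y ^ 2) (target φ) :=
    (H.integrable_abs_deriv.const_mul _).mono' hc.aestronglyMeasurable (Eventually.of_forall hb)
  have hi2 : Integrable (fun y => (φ (y + (1 - s) * v) - φ (y - s * v)) * (v * deriv φ y))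
      (target φ) := by
    refine (hi1.add (H.integrable_deriv_sq.const_mul (v ^ 2))).congr
      (Eventually.of_forall fun y => ?_)
    simp
  refine ⟨?_, hi2⟩
  rw [← H.integral_deriv_sq, ← integral_const_mul, ← integral_const_mul,
    ← integral_sub hi2 (H.integrable_deriv_sq.const_mul _)]
  exact norm_integral_le_of_norm_le (H.integrable_abs_deriv.const_mul _) (Eventually.of_forall hb)

/-- The symmetric second difference of `φ` has mean `-v² I + o(v²)`; no second derivative of `φ`
is needed, because a translation turns one difference of `φ` into a difference of `exp φ`. -/
lemma abs_integral_second_difference_add_le (v : ℝ) :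
    |(∫ x, (φ (x + v) + φ (x - v) - 2 * φ x) ∂(target φ)) + v ^ 2 * fisherInfo φ|
      ≤ v ^ 2 * m v * ∫ y, |deriv φ y| ∂(target φ) := by
  have hφ := H.continuous
  have hφ' := H.continuous_deriv
  set f : ℝ → ℝ := fun x => Real.exp (φ x) with hf
  set g : ℝ → ℝ := fun x => φ (x + v) - φ x with hg
  have hgf : Integrable fun x => f x * g x := (integrable_target_iff hφ).1 (H.integrable_increment v)
  have hgf2 : Integrable fun x => f x * (φ (x - v) - φ x) := by
    have := (integrable_target_iff hφ).1 (H.integrable_increment (-v))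
    simpa [← sub_eq_add_neg] using this
  have hgf3 : Integrable fun x => f (x + v) * g x := by
    have := (hgf2.comp_add_right v).neg
    refine this.congr (Eventually.of_forall fun x => ?_)
    simp only [Pi.neg_apply, hg, add_sub_cancel_right]; ring
  -- after a translation by `v` the backward difference of `φ` becomes minus the forward one
  have e1 : ∫ x, (φ (x + v) + φ (x - v) - 2 * φ x) ∂(target φ)
      = -∫ x, g x * (f (x + v) - f x) := by
    have e2 : ∫ x, f x * (φ (x - v) - φ x) = -∫ x, f (x + v) * g x := by
      rw [← integral_add_right_eq_self _ v, ← integral_neg]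
      refine integral_congr_ae (Eventually.of_forall fun x => ?_)
      simp only [hg, add_sub_cancel_right]; ring
    rw [integral_target hφ, show (fun x => Real.exp (φ x) * (φ (x + v) + φ (x - v) - 2 * φ x))
      = fun x => f x * g x + f x * (φ (x - v) - φ x) from funext fun x => by simp only [hf, hg]; ring,
      integral_add hgf hgf2, e2, ← sub_eq_add_neg, ← integral_sub hgf hgf3, ← integral_neg]
    refine integral_congr_ae (Eventually.of_forall fun x => ?_)
    simp only; ring
  set ν : Measure ℝ := volume.restrict (Set.Ioc (0 : ℝ) 1) with hν
  have hνp : IsProbabilityMeasure ν := ⟨by simp [hν]⟩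
  set G : ℝ → ℝ → ℝ := fun x s => g x * (v * deriv φ (x + s * v) * f (x + s * v)) with hG
  have e3 : ∀ x, g x * (f (x + v) - f x) = ∫ s, G x s ∂ν := by
    intro x
    have hd : ∀ s, HasDerivAt (fun s => f (x + s * v))
        (v * deriv φ (x + s * v) * f (x + s * v)) s := by
      intro s
      have h1 : HasDerivAt (fun s => x + s * v) v s := by
        simpa using ((hasDerivAt_id s).mul_const v).const_add x
      have h2 := (((H.differentiable (x + s * v)).hasDerivAt).exp.comp s h1)
      refine h2.congr_deriv ?_
      simp only [hf]; ring
    have hc : Continuous fun s => v * deriv φ (x + s * v) * f (x + s * v) := by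
      simp only [hf]; fun_prop
    have h := intervalIntegral.integral_eq_sub_of_hasDerivAt (a := 0) (b := 1)
      (fun s _ => hd s) (hc.intervalIntegrable 0 1)
    simp only [one_mul, zero_mul, add_zero] at h
    rw [hG, integral_const_mul, ← h, intervalIntegral.integral_of_le zero_le_one]
  -- the substitution `y = x + s v` turns the slice into an expectation under the target
  have hslice : ∀ s, (fun x => G x s) = fun x => (fun y => f y *
      ((φ (y + (1 - s) * v) - φ (y - s * v)) * (v * deriv φ y))) (x + s * v) := by
    intro s
    ext x
    simp only [hG, hg]
    rw [show x + s * v + (1 - s) * v = x + v by ring, show x + s * v - s * v = x by ring]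
    ring
  have hGc : Continuous (Function.uncurry G) := by
    simp only [hG, hg, hf, Function.uncurry_def]; fun_prop
  have hGi : ∀ s ∈ Set.Icc (0 : ℝ) 1, Integrable fun x => G x s := by
    intro s hs
    rw [hslice s]
    exact (((integrable_target_iff hφ).1 (H.abs_integral_translate_sub_le v s hs).2)).comp_add_right
      (s * v)
  have hIoc : ∀ᵐ s ∂ν, s ∈ Set.Icc (0 : ℝ) 1 := by
    filter_upwards [ae_restrict_mem measurableSet_Ioc] with s hs using ⟨hs.1.le, hs.2⟩
  have hnorm : ∀ s ∈ Set.Icc (0 : ℝ) 1, ∫ x, ‖G x s‖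
      ≤ v ^ 2 * fisherInfo φ + v ^ 2 * m v * ∫ y, |deriv φ y| ∂(target φ) := by
    intro s hs
    rw [integral_congr_ae (Eventually.of_forall fun x => congrArg norm (congrFun (hslice s) x)),
      integral_add_right_eq_self (fun y => ‖f y *
      ((φ (y + (1 - s) * v) - φ (y - s * v)) * (v * deriv φ y))‖) (s * v)]
    rw [← H.integral_deriv_sq, ← integral_const_mul, ← integral_const_mul, ← integral_add
      (H.integrable_deriv_sq.const_mul _) (H.integrable_abs_deriv.const_mul _), integral_target hφ]
    refine integral_mono ((integrable_target_iff hφ).1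
      (H.abs_integral_translate_sub_le v s hs).2).norm ((integrable_target_iff hφ).1
      ((H.integrable_deriv_sq.const_mul _).add (H.integrable_abs_deriv.const_mul _))) fun y => ?_
    have h := H.abs_increment_sub_le (y - s * v) v s hs
    rw [show y - s * v + v = y + (1 - s) * v by ring, show y - s * v + s * v = y by ring] at h
    rw [norm_mul, Real.norm_of_nonneg (Real.exp_pos _).le]
    refine mul_le_mul_of_nonneg_left ?_ (Real.exp_pos _).le
    rw [Real.norm_eq_abs, abs_mul, abs_mul]
    have h2 : |φ (y + (1 - s) * v) - φ (y - s * v)| ≤ |v| * |deriv φ y| + |v| * m v := by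
      have := abs_sub_abs_le_abs_sub (φ (y + (1 - s) * v) - φ (y - s * v)) (v * deriv φ y)
      rw [abs_mul] at this
      linarith
    calc _ ≤ (|v| * |deriv φ y| + |v| * m v) * (|v| * |deriv φ y|) := by gcongr
      _ = |v| ^ 2 * |deriv φ y| ^ 2 + |v| ^ 2 * m v * |deriv φ y| := by ring
      _ = _ := by rw [sq_abs, sq_abs]
  have hGprod : Integrable (Function.uncurry G) ((volume : Measure ℝ).prod ν) := by
    rw [integrable_prod_iff' hGc.aestronglyMeasurable]
    refine ⟨hIoc.mono fun s hs => hGi s hs, ?_⟩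
    refine Integrable.of_bound (hGc.aestronglyMeasurable.norm.prod_swap.integral_prod_right')
      (v ^ 2 * fisherInfo φ + v ^ 2 * m v * ∫ y, |deriv φ y| ∂(target φ)) ?_
    filter_upwards [hIoc] with s hs
    rw [Real.norm_of_nonneg (integral_nonneg fun _ => norm_nonneg _)]
    exact hnorm s hs
  have hGswap : Integrable (fun s => ∫ x, G x s) ν := hGprod.integral_prod_right
  rw [e1, integral_congr_ae (Eventually.of_forall e3), integral_integral_swap hGprod]
  have e4 : -(∫ s, (∫ x, G x s) ∂ν) + v ^ 2 * fisherInfo φ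
      = -∫ s, ((∫ x, G x s) - v ^ 2 * fisherInfo φ) ∂ν := by
    rw [integral_sub hGswap (integrable_const _)]
    simp only [integral_const, probReal_univ, one_smul]
    ring
  rw [e4, abs_neg, ← Real.norm_eq_abs]
  refine (norm_integral_le_of_norm_le_const (μ := ν)
    (C := v ^ 2 * m v * ∫ y, |deriv φ y| ∂(target φ)) ?_).trans_eq
      (by rw [probReal_univ, mul_one])
  filter_upwards [hIoc] with s hs
  rw [integral_congr_ae (Eventually.of_forall fun x => congrFun (hslice s) x),
    integral_add_right_eq_self (fun y => f y *
      ((φ (y + (1 - s) * v) - φ (y - s * v)) * (v * deriv φ y))) (s * v), ← integral_target hφ]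
  exact (H.abs_integral_translate_sub_le v s hs).1

/-- The second-order remainder of the log-density at a Gaussian increment. -/
def _root_.MHRW.remainder (φ : ℝ → ℝ) (t x w : ℝ) : ℝ := φ (x + t * w) - φ x - t * w * deriv φ x

omit [IsProbabilityMeasure (target φ)] in
lemma abs_remainder_le (t x w : ℝ) : |remainder φ t x w| ≤ |t * w| * m (t * w) := by
  simpa [remainder] using H.abs_increment_sub_le x (t * w) 0 (by simp)

omit [IsProbabilityMeasure (target φ)] in
lemma remainder_sq_le (t x w : ℝ) :
    remainder φ t x w ^ 2 ≤ t ^ 2 * (|w| ^ 2 * m (t * w) ^ 2) := by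
  have h := pow_le_pow_left₀ (abs_nonneg _) (H.abs_remainder_le t x w) 2
  rw [sq_abs, abs_mul] at h
  calc _ ≤ _ := h
    _ = |t| ^ 2 * (|w| ^ 2 * m (t * w) ^ 2) := by ring
    _ = _ := by rw [sq_abs]

omit [IsProbabilityMeasure (target φ)] in
lemma continuous_remainder (t : ℝ) : Continuous fun q : ℝ × ℝ => remainder φ t q.1 q.2 := by
  have hφ := H.continuous
  have hφ' := H.continuous_deriv
  unfold remainder; fun_prop

lemma integrable_remainder (t : ℝ) :
    Integrable (fun q : ℝ × ℝ => remainder φ t q.1 q.2) ((target φ).prod (gaussianReal 0 1)) := by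
  refine (((H.integrable_scaled t 1 1).const_mul |t|).comp_snd (target φ)).mono'
    (H.continuous_remainder t).aestronglyMeasurable
    (Eventually.of_forall fun q => (H.abs_remainder_le t q.1 q.2).trans
      (by rw [abs_mul]; simp [mul_assoc]))

/-- The mean of the remainder is `-t² I / 2 + o(t²)`. -/
lemma abs_integral_remainder_add_le (t : ℝ) :
    |(∫ x, ∫ w, remainder φ t x w ∂(gaussianReal 0 1) ∂(target φ)) + t ^ 2 / 2 * fisherInfo φ|
      ≤ t ^ 2 / 2 * (∫ y, |deriv φ y| ∂(target φ))
        * ∫ w, |w| ^ 2 * m (t * w) ^ 1 ∂(gaussianReal 0 1) := by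
  have hφ := H.continuous
  set J := ∫ y, |deriv φ y| ∂(target φ)
  set γ := gaussianReal 0 1
  have hR := H.integrable_remainder t
  rw [integral_integral_swap hR]
  set A : ℝ → ℝ := fun w => ∫ x, remainder φ t x w ∂(target φ) with hA
  have hAi : Integrable A γ := hR.integral_prod_right
  have hsymm : Measure.map (fun v : ℝ => -v) γ = γ := by
    simpa using gaussianReal_map_neg (μ := 0) (v := 1)
  have hmp : MeasurePreserving (fun v : ℝ => -v) γ γ := ⟨measurable_neg, hsymm⟩
  have hAn : Integrable (fun w => A (-w)) γ := hmp.integrable_comp_of_integrable hAi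
  have hAneg : ∫ w, A (-w) ∂γ = ∫ w, A w ∂γ :=
    hmp.integral_comp (MeasurableEquiv.neg ℝ).measurableEmbedding A
  -- symmetrising in `w` removes the first-order term and leaves the second difference
  have hAA : ∀ w, A w + A (-w)
      = ∫ x, (φ (x + t * w) + φ (x - t * w) - 2 * φ x) ∂(target φ) := by
    intro w
    have hi : ∀ w, Integrable (fun x => remainder φ t x w) (target φ) := fun w =>
      (H.integrable_increment (t * w)).sub
        ((H.memLp_deriv.integrable one_le_two).const_mul (t * w))
    rw [hA, ← integral_add (hi w) (hi (-w))]
    refine integral_congr_ae (Eventually.of_forall fun x => ?_)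
    simp only [remainder, mul_neg, ← sub_eq_add_neg]
    ring
  have hw2 : ∫ w, w ^ 2 ∂γ = 1 := by
    have h := variance_id_gaussianReal (μ := 0) (v := 1)
    rw [variance_eq_integral measurable_id.aemeasurable] at h
    simpa [integral_id_gaussianReal] using h
  have hw2i : Integrable (fun w : ℝ => w ^ 2) γ := by
    have := (memLp_id_gaussianReal (μ := 0) (v := 1) 2).integrable_sq
    simpa using this
  have e1 : (∫ w, A w ∂γ) + t ^ 2 / 2 * fisherInfo φ
      = ∫ w, 1 / 2 * ((A w + A (-w)) + (t * w) ^ 2 * fisherInfo φ) ∂γ := by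
    rw [integral_const_mul, integral_add (f := fun w => A w + A (-w)) (hAi.add hAn)]
    · rw [integral_add hAi hAn, hAneg]
      simp only [mul_pow]
      rw [integral_mul_const, integral_const_mul, hw2]
      ring
    · simp only [mul_pow]
      exact (hw2i.const_mul _).mul_const _
  rw [e1]
  have hb : ∀ w, ‖1 / 2 * ((A w + A (-w)) + (t * w) ^ 2 * fisherInfo φ)‖
      ≤ t ^ 2 / 2 * J * (|w| ^ 2 * m (t * w) ^ 1) := by
    intro w
    rw [hAA, norm_mul, Real.norm_eq_abs, Real.norm_eq_abs, abs_of_pos (by norm_num)]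
    have := H.abs_integral_second_difference_add_le (t * w)
    calc _ ≤ 1 / 2 * ((t * w) ^ 2 * m (t * w) * J) := by gcongr
      _ = t ^ 2 / 2 * J * (w ^ 2 * m (t * w) ^ 1) := by ring
      _ = _ := by rw [sq_abs]
  refine (norm_integral_le_of_norm_le ((H.integrable_scaled t 2 1).const_mul (t ^ 2 / 2 * J))
    (Eventually.of_forall hb)).trans_eq ?_
  rw [integral_const_mul]

end ScoreModulus

/-! ### Convergence of the acceptance probability given the state -/

lemma sq_integral_le_integral_sq {Ω : Type*} [MeasurableSpace Ω] {P : Measure Ω}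
    [IsProbabilityMeasure P] {Z : Ω → ℝ} (hZ : MemLp Z 2 P) :
    (∫ a, Z a ∂P) ^ 2 ≤ ∫ a, Z a ^ 2 ∂P := by
  have h := variance_nonneg Z P
  rw [variance_eq_sub hZ] at h
  simpa using h

lemma abs_integral_le_integral {Ω : Type*} [MeasurableSpace Ω] {P : Measure Ω} {f g : Ω → ℝ}
    (hg : Integrable g P) (h : ∀ a, |f a| ≤ g a) : |∫ a, f a ∂P| ≤ ∫ a, g a ∂P := by
  rw [← Real.norm_eq_abs]
  exact norm_integral_le_of_norm_le hg (Eventually.of_forall h)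

lemma integral_abs_le_sqrt {Ω : Type*} [MeasurableSpace Ω] {P : Measure Ω}
    [IsProbabilityMeasure P] {Z : Ω → ℝ} (hZ : MemLp Z 2 P) :
    ∫ a, |Z a| ∂P ≤ √(∫ a, Z a ^ 2 ∂P) := by
  refine Real.le_sqrt_of_sq_le ?_
  simpa using sq_integral_le_integral_sq hZ.abs

/-- The second moment of a shifted sum of uncorrelated variables with a common mean. -/
lemma integral_sum_add_sq_le {Ω : Type*} [MeasurableSpace Ω] {P : Measure Ω}
    [IsProbabilityMeasure P] {Y : ℕ → Ω → ℝ} (hY : ∀ i, MemLp (Y i) 2 P) {M B : ℝ}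
    (hM : ∀ i, ∫ a, Y i a ∂P = M) (hB : ∀ i, ∫ a, Y i a ^ 2 ∂P ≤ B)
    (hcov : ∀ i j, i ≠ j → ∫ a, Y i a * Y j a ∂P = M ^ 2) (c : ℝ) (n : ℕ) :
    ∫ a, (∑ i ∈ Finset.range n, Y i a + c) ^ 2 ∂P ≤ n * B + (n * M + c) ^ 2 := by
  induction n with
  | zero => simp
  | succ n ih =>
    have hsum : MemLp (fun a => ∑ i ∈ Finset.range n, Y i a + c) 2 P :=
      (memLp_finsetSum _ fun i _ => hY i).add (memLp_const c)
    have hYi : ∀ i, Integrable (Y i) P := fun i => (hY i).integrable one_le_two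
    have hcross : ∫ a, (∑ i ∈ Finset.range n, Y i a + c) * Y n a ∂P = n * M ^ 2 + c * M := by
      simp only [add_mul, Finset.sum_mul]
      have hint : ∀ i ∈ Finset.range n, Integrable (fun a => Y i a * Y n a) P :=
        fun i _ => (hY i).integrable_mul (hY n)
      rw [integral_add (integrable_finsetSum _ hint) ((hYi n).const_mul c),
        integral_finsetSum _ hint, integral_const_mul, hM,
        Finset.sum_congr rfl fun i hi => hcov i n (Finset.mem_range.1 hi).ne]
      simp
    have e : (fun a => (∑ i ∈ Finset.range (n + 1), Y i a + c) ^ 2)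
        = fun a => (∑ i ∈ Finset.range n, Y i a + c) ^ 2
          + (2 * ((∑ i ∈ Finset.range n, Y i a + c) * Y n a) + Y n a ^ 2) := by
      ext a
      rw [Finset.sum_range_succ]; ring
    have i1 : Integrable (fun a => 2 * ((∑ i ∈ Finset.range n, Y i a + c) * Y n a)) P :=
      (hsum.integrable_mul (hY n)).const_mul 2
    have i2 := (hY n).integrable_sq
    have i3 : Integrable (fun a => 2 * ((∑ i ∈ Finset.range n, Y i a + c) * Y n a) + Y n a ^ 2) P :=
      i1.add i2
    rw [e, integral_add hsum.integrable_sq i3, integral_add i1 i2, integral_const_mul,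
      hcross]
    push_cast
    nlinarith [hB n, sq_nonneg M]

/-- Functions of different coordinates are uncorrelated. -/
lemma integral_coord_mul {X : Type*} [MeasurableSpace X] (ν : Measure X) [IsProbabilityMeasure ν]
    {i j : ℕ} (hij : i ≠ j) {f g : X → ℝ} (hf : Measurable f) (hg : Measurable g) :
    ∫ x, f (x i) * g (x j) ∂(Measure.infinitePi fun _ : ℕ => ν)
      = (∫ y, f y ∂ν) * ∫ y, g y ∂ν := by
  have hind : iIndepFun (fun (i : ℕ) (x : ℕ → X) => x i) (Measure.infinitePi fun _ : ℕ => ν) :=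
    iIndepFun_infinitePi (P := fun _ : ℕ => ν) (X := fun _ y => y) fun _ => measurable_id
  have h := (hind.indepFun hij).comp hf hg
  have h1 := h.integral_fun_mul_eq_mul_integral
    (hf.comp (measurable_pi_apply i)).aestronglyMeasurable
    (hg.comp (measurable_pi_apply j)).aestronglyMeasurable
  have hmp := fun i => measurePreserving_eval_infinitePi (fun _ : ℕ => ν) i
  simp only [Function.comp_apply] at h1
  rw [h1]
  congr 1
  · have := integral_map (hmp i).aemeasurable (f := f) hf.aestronglyMeasurable
    rw [(hmp i).map_eq] at this
    exact this.symm
  · have := integral_map (hmp j).aemeasurable (f := g) hg.aestronglyMeasurable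
    rw [(hmp j).map_eq] at this
    exact this.symm

/-- A linear combination of the noise variables is Gaussian. -/
lemma map_noise_sum (a : ℕ → ℝ) (n : ℕ) :
    noise.map (fun w => ∑ i ∈ Finset.range n, a i * w i)
      = gaussianReal 0 (∑ i ∈ Finset.range n, a i ^ 2).toNNReal := by
  have hind : iIndepFun (fun (i : ℕ) (w : ℕ → ℝ) => a i * w i) noise :=
    iIndepFun_infinitePi (P := fun _ : ℕ => gaussianReal 0 1) (X := fun i y => a i * y)
      fun i => measurable_id.const_mul (a i)
  have hmeas : ∀ i, Measurable fun w : ℕ → ℝ => a i * w i := fun i => by fun_prop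
  have hmap : ∀ i, noise.map (fun w => a i * w i) = gaussianReal 0 (a i ^ 2).toNNReal := by
    intro i
    have h := gaussianReal_map_const_mul (μ := 0) (v := 1) (a i)
    rw [← (measurePreserving_noise_coord i).map_eq, Measure.map_map (by fun_prop) (by fun_prop)] at h
    simp only [Function.comp_def, mul_zero, mul_one] at h
    rw [h]
    congr 1
    ext
    simp [sq_nonneg]
  induction n with
  | zero =>
    simp [gaussianReal_zero_var, Measure.map_const]
  | succ n ih =>
    have hI : IndepFun (fun w : ℕ → ℝ => ∑ i ∈ Finset.range n, a i * w i) (fun w => a n * w n)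
        noise := by
      have := hind.indepFun_finsetSum_of_notMem hmeas (s := Finset.range n) (i := n) (by simp)
      convert this using 1
      ext w
      simp
    have h := gaussianReal_add_gaussianReal_of_indepFun hI ih (hmap n)
    have e : (fun w : ℕ → ℝ => ∑ i ∈ Finset.range (n + 1), a i * w i)
        = (fun w : ℕ → ℝ => ∑ i ∈ Finset.range n, a i * w i) + fun w => a n * w n := by
      ext w
      simp [Finset.sum_range_succ]
    rw [e, h, Finset.sum_range_succ, add_zero,
      Real.toNNReal_add (Finset.sum_nonneg fun i _ => sq_nonneg _) (sq_nonneg _)]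

/-- The step size of the proposal in dimension `n`. -/
def stepSize (τ : ℝ) (n : ℕ) : ℝ := τ / √(n : ℝ)

lemma tendsto_stepSize (τ : ℝ) : Tendsto (stepSize τ) atTop (𝓝 0) :=
  Tendsto.div_atTop tendsto_const_nhds
    (Real.tendsto_sqrt_atTop.comp tendsto_natCast_atTop_atTop)

lemma abs_stepSize_le (τ : ℝ) (n : ℕ) : |stepSize τ n| ≤ |τ| := by
  rw [stepSize, abs_div, abs_of_nonneg (Real.sqrt_nonneg _)]
  rcases Nat.eq_zero_or_pos n with rfl | hn
  · simp
  · exact div_le_self (abs_nonneg _) (Real.one_le_sqrt.2 (by exact_mod_cast hn))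

lemma mul_stepSize_sq (τ : ℝ) {n : ℕ} (hn : n ≠ 0) : (n : ℝ) * stepSize τ n ^ 2 = τ ^ 2 := by
  have : (n : ℝ) ≠ 0 := by exact_mod_cast hn
  rw [stepSize, div_pow, Real.sq_sqrt (Nat.cast_nonneg n)]
  field_simp

lemma sqrt_mul_stepSize (τ : ℝ) {n : ℕ} (hn : n ≠ 0) : √(n : ℝ) * stepSize τ n = τ := by
  have : √(n : ℝ) ≠ 0 := (Real.sqrt_pos.2 (by exact_mod_cast Nat.pos_of_ne_zero hn)).ne'
  rw [stepSize]
  field_simp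

/-- The first-order part of the log-ratio; it is Gaussian given the state. -/
def linearPart (φ : ℝ → ℝ) (t : ℝ) (n : ℕ) (p : (ℕ → ℝ) × (ℕ → ℝ)) : ℝ :=
  ∑ i ∈ Finset.range n, t * deriv φ (p.1 i) * p.2 i

/-- The limiting mean of a function of the log-ratio. -/
def limMean (φ : ℝ → ℝ) (τ : ℝ) (ψ : ℝ → ℝ) : ℝ :=
  ∫ z, ψ z ∂(gaussianReal (-(τ ^ 2 / 2) * fisherInfo φ) (τ ^ 2 * fisherInfo φ).toNNReal)

/-- The mean of a function of the log-ratio given the state. -/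
def quenchedMean (φ : ℝ → ℝ) (τ : ℝ) (ψ : ℝ → ℝ) (n : ℕ) (x : ℕ → ℝ) : ℝ :=
  ∫ w, ψ (logRatio φ (stepSize τ n) n (x, w)) ∂noise

lemma fisherInfo_nonneg (φ : ℝ → ℝ) : 0 ≤ fisherInfo φ :=
  integral_nonneg fun _ => by positivity

lemma integral_gaussianReal_eq (mean v : ℝ) {ψ : ℝ → ℝ} (hψ : Continuous ψ) :
    ∫ z, ψ z ∂(gaussianReal mean v.toNNReal) = ∫ z, ψ (√v * z + mean) ∂(gaussianReal 0 1) := by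
  have h : gaussianReal mean v.toNNReal
      = (gaussianReal 0 1).map (fun z => √v * z + mean) := by
    have e : (fun z => √v * z + mean) = (fun z => z + mean) ∘ fun z => √v * z := rfl
    rw [e, ← Measure.map_map (by fun_prop) (by fun_prop), gaussianReal_map_const_mul,
      gaussianReal_map_add_const]
    congr 1
    · simp
    · ext
      rcases le_total 0 v with hv | hv
      · simp [hv, Real.sq_sqrt hv]
      · simp [Real.sqrt_eq_zero_of_nonpos hv, Real.toNNReal_of_nonpos hv]
  rw [h, integral_map (by fun_prop) hψ.aestronglyMeasurable]

lemma abs_sqrt_sub_sqrt_le {a b : ℝ} (ha : 0 ≤ a) (hb : 0 ≤ b) : |√a - √b| ≤ √|a - b| := by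
  refine Real.abs_le_sqrt ?_
  have h1 := Real.sq_sqrt ha
  have h2 := Real.sq_sqrt hb
  have h3 := Real.sqrt_nonneg a
  have h4 := Real.sqrt_nonneg b
  rcases le_total b a with h | h
  · rw [abs_of_nonneg (sub_nonneg.2 h)]
    nlinarith [Real.sqrt_le_sqrt h]
  · rw [abs_of_nonpos (sub_nonpos.2 h)]
    nlinarith [Real.sqrt_le_sqrt h]

lemma integrable_abs_gaussian : Integrable (fun z : ℝ => |z|) (gaussianReal 0 1) := by
  have := (memLp_id_gaussianReal (μ := 0) (v := 1) 1).integrable (by simp)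
  exact this.abs

lemma logRatio_eq (φ : ℝ → ℝ) (t : ℝ) (n : ℕ) (p : (ℕ → ℝ) × (ℕ → ℝ)) :
    logRatio φ t n p = linearPart φ t n p
      + ∑ i ∈ Finset.range n, remainder φ t (p.1 i) (p.2 i) := by
  rw [logRatio, linearPart, ← Finset.sum_add_distrib]
  refine Finset.sum_congr rfl fun i _ => ?_
  rw [remainder]; ring

namespace ScoreModulus

variable {φ m : ℝ → ℝ} (H : ScoreModulus φ m) [IsProbabilityMeasure (target φ)] (τ : ℝ)

include H

lemma memLp_remainder (t : ℝ) (i : ℕ) :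
    MemLp (fun p : (ℕ → ℝ) × (ℕ → ℝ) => remainder φ t (p.1 i) (p.2 i)) 2 (joint φ) := by
  have hc : Continuous fun p : (ℕ → ℝ) × (ℕ → ℝ) => remainder φ t (p.1 i) (p.2 i) :=
    (H.continuous_remainder t).comp (by fun_prop : Continuous fun p : (ℕ → ℝ) × (ℕ → ℝ) =>
      (p.1 i, p.2 i))
  rw [memLp_two_iff_integrable_sq hc.aestronglyMeasurable]
  have hb : Integrable (fun p : (ℕ → ℝ) × (ℕ → ℝ) => t ^ 2 * (|p.2 i| ^ 2 * m (t * p.2 i) ^ 2))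
      (joint φ) :=
    (measurePreserving_snd_joint.integrable_comp_of_integrable
      ((measurePreserving_noise_coord i).integrable_comp_of_integrable
        (H.integrable_scaled t 2 2))).const_mul _
  refine hb.mono' (hc.pow 2).aestronglyMeasurable (Eventually.of_forall fun p => ?_)
  rw [Real.norm_of_nonneg (sq_nonneg _)]
  exact H.remainder_sq_le t _ _

lemma integral_remainder_sq_le (t : ℝ) (i : ℕ) :
    ∫ p, remainder φ t (p.1 i) (p.2 i) ^ 2 ∂(joint φ)
      ≤ t ^ 2 * ∫ w, |w| ^ 2 * m (t * w) ^ 2 ∂(gaussianReal 0 1) := by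
  have hmp := (measurePreserving_noise_coord i).comp (measurePreserving_snd_joint (φ := φ))
  have hi := hmp.integrable_comp_of_integrable (H.integrable_scaled t 2 2)
  have e := integral_map hmp.aemeasurable
    (f := fun w => |w| ^ 2 * m (t * w) ^ 2) (H.continuous_scaled t 2 2).aestronglyMeasurable
  rw [hmp.map_eq] at e
  rw [e, ← integral_const_mul]
  exact integral_mono (H.memLp_remainder t i).integrable_sq (hi.const_mul _)
    fun p => H.remainder_sq_le t _ _

lemma integral_remainder (t : ℝ) (i : ℕ) :
    ∫ p, remainder φ t (p.1 i) (p.2 i) ∂(joint φ)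
      = ∫ x, ∫ w, remainder φ t x w ∂(gaussianReal 0 1) ∂(target φ) := by
  have hi := (H.memLp_remainder t i).integrable one_le_two
  have hc := H.continuous_remainder t
  rw [joint] at hi ⊢
  rw [integral_prod _ hi]
  have h1 : ∀ x : ℕ → ℝ, ∫ w, remainder φ t (x i) (w i) ∂noise
      = ∫ w, remainder φ t (x i) w ∂(gaussianReal 0 1) := by
    intro x
    have hcx : Continuous fun w => remainder φ t (x i) w := hc.comp (Continuous.prodMk_right _)
    have e := integral_map (measurePreserving_noise_coord i).aemeasurable hcx.aestronglyMeasurable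
    rw [(measurePreserving_noise_coord i).map_eq] at e
    exact e.symm
  simp only [h1]
  have hm : AEStronglyMeasurable (fun x => ∫ w, remainder φ t x w ∂(gaussianReal 0 1))
      (target φ) := (hc.stronglyMeasurable.integral_prod_right').aestronglyMeasurable
  have e := integral_map (measurePreserving_coord (φ := φ) i).aemeasurable
    (by rwa [(measurePreserving_coord i).map_eq])
  rw [(measurePreserving_coord i).map_eq] at e
  exact e.symm

lemma integral_remainder_mul (t : ℝ) {i j : ℕ} (hij : i ≠ j) :
    ∫ p, remainder φ t (p.1 i) (p.2 i) * remainder φ t (p.1 j) (p.2 j) ∂(joint φ)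
      = (∫ x, ∫ w, remainder φ t x w ∂(gaussianReal 0 1) ∂(target φ)) ^ 2 := by
  have hi : Integrable (fun p : (ℕ → ℝ) × (ℕ → ℝ) =>
      remainder φ t (p.1 i) (p.2 i) * remainder φ t (p.1 j) (p.2 j)) (joint φ) :=
    (H.memLp_remainder t i).integrable_mul (H.memLp_remainder t j)
  have hc := H.continuous_remainder t
  have hcx : ∀ x, Measurable fun w => remainder φ t x w := fun x =>
    (hc.comp (Continuous.prodMk_right _)).measurable
  rw [joint] at hi ⊢
  rw [integral_prod _ hi]
  have h1 : ∀ x : ℕ → ℝ, ∫ w, remainder φ t (x i) (w i) * remainder φ t (x j) (w j) ∂noise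
      = (∫ w, remainder φ t (x i) w ∂(gaussianReal 0 1))
        * ∫ w, remainder φ t (x j) w ∂(gaussianReal 0 1) :=
    fun x => integral_coord_mul (gaussianReal 0 1) hij (hcx (x i)) (hcx (x j))
  have hm : Measurable fun x => ∫ w, remainder φ t x w ∂(gaussianReal 0 1) :=
    hc.stronglyMeasurable.integral_prod_right'.measurable
  have h2 := integral_coord_mul (target φ) hij hm hm
  rw [sq]
  simp only [h1]
  exact h2

/-- The log-ratio is asymptotically its linear part minus `τ² I / 2`. -/
lemma tendsto_integral_logRatio_sub_sq :
    Tendsto (fun n => ∫ p, (logRatio φ (stepSize τ n) n p - linearPart φ (stepSize τ n) n p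
      + τ ^ 2 / 2 * fisherInfo φ) ^ 2 ∂(joint φ)) atTop (𝓝 0) := by
  set J := ∫ y, |deriv φ y| ∂(target φ)
  have hJ : 0 ≤ J := integral_nonneg fun _ => abs_nonneg _
  have hl1 := H.tendsto_integral_scaled (tendsto_stepSize τ) (abs_stepSize_le τ) 2 1 one_ne_zero
  have hl2 := H.tendsto_integral_scaled (tendsto_stepSize τ) (abs_stepSize_le τ) 2 2 two_ne_zero
  have hlim : Tendsto (fun n => τ ^ 2 * (∫ w, |w| ^ 2 * m (stepSize τ n * w) ^ 2
      ∂(gaussianReal 0 1)) + (τ ^ 2 / 2 * J * ∫ w, |w| ^ 2 * m (stepSize τ n * w) ^ 1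
      ∂(gaussianReal 0 1)) ^ 2) atTop (𝓝 0) := by
    simpa using (hl2.const_mul (τ ^ 2)).add ((hl1.const_mul (τ ^ 2 / 2 * J)).pow 2)
  refine squeeze_zero' (Eventually.of_forall fun n => integral_nonneg fun _ => sq_nonneg _) ?_ hlim
  filter_upwards [eventually_ne_atTop 0] with n hn
  set t := stepSize τ n
  set M := ∫ x, ∫ w, remainder φ t x w ∂(gaussianReal 0 1) ∂(target φ)
  have hn2 : (n : ℝ) * t ^ 2 = τ ^ 2 := mul_stepSize_sq τ hn
  have h := integral_sum_add_sq_le (P := joint φ) (fun i => H.memLp_remainder t i)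
    (fun i => H.integral_remainder t i) (fun i => H.integral_remainder_sq_le t i)
    (fun i j hij => H.integral_remainder_mul t hij) (τ ^ 2 / 2 * fisherInfo φ) n
  have e : ∀ p, logRatio φ t n p - linearPart φ t n p
      = ∑ i ∈ Finset.range n, remainder φ t (p.1 i) (p.2 i) := fun p => by
    rw [logRatio_eq]; ring
  simp only [e]
  refine h.trans (add_le_add ?_ ?_)
  · rw [← mul_assoc, hn2]
  · rw [← sq_abs]
    refine pow_le_pow_left₀ (abs_nonneg _) ?_ 2
    have h2 := H.abs_integral_remainder_add_le t
    calc |(n : ℝ) * M + τ ^ 2 / 2 * fisherInfo φ|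
        = (n : ℝ) * |M + t ^ 2 / 2 * fisherInfo φ| := by
          rw [← abs_of_nonneg (Nat.cast_nonneg (α := ℝ) n), ← abs_mul,
            abs_of_nonneg (Nat.cast_nonneg (α := ℝ) n), ← hn2]
          congr 1; ring
      _ ≤ (n : ℝ) * (t ^ 2 / 2 * J * ∫ w, |w| ^ 2 * m (t * w) ^ 1 ∂(gaussianReal 0 1)) := by gcongr
      _ = _ := by rw [← hn2]; ring

omit [IsProbabilityMeasure (target φ)] in
lemma continuous_linearPart (t : ℝ) (n : ℕ) : Continuous (linearPart φ t n) := by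
  have := H.continuous_deriv
  unfold linearPart; fun_prop

/-- The conditional variance of the linear part obeys the law of large numbers. -/
lemma tendsto_integral_abs_variance_sub :
    Tendsto (fun n => ∫ x : ℕ → ℝ, |∑ i ∈ Finset.range n, (stepSize τ n * deriv φ (x i)) ^ 2
      - τ ^ 2 * fisherInfo φ| ∂(targetInf φ)) atTop (𝓝 0) := by
  have hm : Measurable fun y => deriv φ y ^ 2 := (H.continuous_deriv.pow 2).measurable
  have hind : iIndepFun (fun (i : ℕ) (x : ℕ → ℝ) => deriv φ (x i) ^ 2) (targetInf φ) :=
    iIndepFun_infinitePi (P := fun _ : ℕ => target φ) (X := fun _ y => deriv φ y ^ 2) fun _ => hm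
  have hmean : ∫ x : ℕ → ℝ, deriv φ (x 0) ^ 2 ∂(targetInf φ) = fisherInfo φ := by
    have e := integral_map (measurePreserving_coord (φ := φ) 0).aemeasurable
      hm.aestronglyMeasurable
    rw [(measurePreserving_coord 0).map_eq, H.integral_deriv_sq] at e
    exact e.symm
  have hint : ∀ i, Integrable (fun x : ℕ → ℝ => deriv φ (x i) ^ 2) (targetInf φ) := fun i =>
    (measurePreserving_coord i).integrable_comp_of_integrable H.integrable_deriv_sq
  have hlln := strong_law_Lp (μ := targetInf φ) le_rfl ENNReal.one_ne_top
    (fun (i : ℕ) (x : ℕ → ℝ) => deriv φ (x i) ^ 2) (memLp_one_iff_integrable.2 (hint 0))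
    (fun i j hij => hind.indepFun hij)
    (fun i => by
      refine ⟨(hm.comp (measurable_pi_apply i)).aemeasurable,
        (hm.comp (measurable_pi_apply 0)).aemeasurable, ?_⟩
      have h : ∀ i : ℕ, (targetInf φ).map (fun x => deriv φ (x i) ^ 2)
          = (target φ).map fun y => deriv φ y ^ 2 := fun i => by
        rw [← (measurePreserving_coord i).map_eq, Measure.map_map hm (measurable_pi_apply i)]
        rfl
      rw [h, h])
  simp only [hmean] at hlln
  have hlln2 : Tendsto (fun n : ℕ => ∫ x : ℕ → ℝ, |(n : ℝ)⁻¹ *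
      (∑ i ∈ Finset.range n, deriv φ (x i) ^ 2) - fisherInfo φ| ∂(targetInf φ)) atTop (𝓝 0) := by
    have h := (ENNReal.tendsto_toReal ENNReal.zero_ne_top).comp hlln
    simp only [ENNReal.toReal_zero] at h
    refine h.congr fun n => ?_
    simp only [Function.comp_apply, eLpNorm_one_eq_lintegral_enorm]
    rw [← integral_norm_eq_lintegral_enorm]
    · rfl
    · have := H.continuous_deriv
      exact (by fun_prop : Continuous fun x : ℕ → ℝ => (n : ℝ)⁻¹ •
        (∑ i ∈ Finset.range n, deriv φ (x i) ^ 2) - fisherInfo φ).aestronglyMeasurable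
  have h3 := hlln2.const_mul (τ ^ 2)
  rw [mul_zero] at h3
  refine h3.congr' ?_
  filter_upwards [eventually_ne_atTop 0] with n hn
  rw [← integral_const_mul]
  refine integral_congr_ae (Eventually.of_forall fun x => ?_)
  have hn2 := mul_stepSize_sq τ hn
  have hn' : (n : ℝ) ≠ 0 := by exact_mod_cast hn
  dsimp only
  conv_lhs => rw [← abs_of_nonneg (sq_nonneg τ)]
  rw [← abs_mul]
  congr 1
  simp only [mul_pow]
  rw [← Finset.mul_sum, mul_sub, ← hn2]
  field_simp

variable {ψ : ℝ → ℝ}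

/-- Given the state, functions of the log-ratio have Gaussian limits, in `L¹` of the state. -/
lemma tendsto_quenchedMean {K : ℝ≥0} (hL : LipschitzWith K ψ) (hB : ∀ s, |ψ s| ≤ 1) :
    Tendsto (fun n => ∫ x, |quenchedMean φ τ ψ n x - limMean φ τ ψ| ∂(targetInf φ))
      atTop (𝓝 0) := by
  have hψ := hL.continuous
  set m₀ := τ ^ 2 / 2 * fisherInfo φ with hm₀
  set v₀ := τ ^ 2 * fisherInfo φ with hv₀
  have hv₀n : 0 ≤ v₀ := mul_nonneg (sq_nonneg _) (fisherInfo_nonneg φ)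
  set V : ℕ → (ℕ → ℝ) → ℝ := fun n x =>
    ∑ i ∈ Finset.range n, (stepSize τ n * deriv φ (x i)) ^ 2 with hV
  set D : ℕ → (ℕ → ℝ) × (ℕ → ℝ) → ℝ := fun n p => logRatio φ (stepSize τ n) n p
      - linearPart φ (stepSize τ n) n p + m₀ with hD
  have hVc : ∀ n, Continuous (V n) := fun n => by
    have := H.continuous_deriv
    simp only [hV]; fun_prop
  have hVn : ∀ n x, 0 ≤ V n x := fun n x => Finset.sum_nonneg fun i _ => sq_nonneg _
  have hSc : ∀ n, Continuous (logRatio φ (stepSize τ n) n) := fun n =>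
    continuous_logRatio H.continuous _ _
  have hLc : ∀ n, Continuous (linearPart φ (stepSize τ n) n) := fun n =>
    H.continuous_linearPart _ _
  have hDc : ∀ n, Continuous (D n) := fun n => ((hSc n).sub (hLc n)).add continuous_const
  have hDm : ∀ n, MemLp (D n) 2 (joint φ) := fun n => by
    refine ((memLp_finsetSum (Finset.range n)
      fun i _ => H.memLp_remainder (stepSize τ n) i).add (memLp_const m₀)).ae_eq
      (Eventually.of_forall fun p => ?_)
    simp only [hD, logRatio_eq, Pi.add_apply]
    ring
  have hVint : ∀ n, Integrable (V n) (targetInf φ) := fun n => by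
    simp only [hV, mul_pow]
    exact integrable_finsetSum _ fun i _ =>
      ((measurePreserving_coord i).integrable_comp_of_integrable H.integrable_deriv_sq).const_mul _
  set E₁ := ∫ z, |z| ∂(gaussianReal 0 1)
  have hbound : ∀ n, ∫ x, |quenchedMean φ τ ψ n x - limMean φ τ ψ| ∂(targetInf φ)
      ≤ K * √(∫ p, D n p ^ 2 ∂(joint φ))
        + K * E₁ * √(∫ x, |V n x - v₀| ∂(targetInf φ)) := by
    intro n
    have hDi : Integrable (fun p => |D n p|) (joint φ) := ((hDm n).integrable one_le_two).abs
    have hDi' : Integrable (fun x => ∫ w, |D n (x, w)| ∂noise) (targetInf φ) :=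
      Integrable.integral_prod_left hDi
    have hsq2 : MemLp (fun x => √|V n x - v₀|) 2 (targetInf φ) := by
      have hc : Continuous fun x => √|V n x - v₀| := by have := hVc n; fun_prop
      rw [memLp_two_iff_integrable_sq hc.aestronglyMeasurable]
      refine ((hVint n).sub (integrable_const v₀)).abs.congr (Eventually.of_forall fun x => ?_)
      exact (Real.sq_sqrt (abs_nonneg _)).symm
    have hpt : ∀ᵐ x ∂(targetInf φ), |quenchedMean φ τ ψ n x - limMean φ τ ψ|
        ≤ K * (∫ w, |D n (x, w)| ∂noise) + K * E₁ * √|V n x - v₀| := by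
      filter_upwards [Integrable.prod_right_ae hDi] with x hx
      have hb1 : ∀ {Ω : Type} [MeasurableSpace Ω] {P : Measure Ω} [IsProbabilityMeasure P]
          {g : Ω → ℝ}, AEStronglyMeasurable g P → Integrable (fun a => ψ (g a)) P :=
        fun hg => Integrable.of_bound (hψ.comp_aestronglyMeasurable hg) 1
          (Eventually.of_forall fun _ => hB _)
      have hLx : Continuous fun w => linearPart φ (stepSize τ n) n (x, w) :=
        (hLc n).comp (Continuous.prodMk_right x)
      have hSx : Continuous fun w => logRatio φ (stepSize τ n) n (x, w) :=
        (hSc n).comp (Continuous.prodMk_right x)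
      -- given the state, the linear part is Gaussian with variance `V n x`
      have e1 : ∫ w, ψ (linearPart φ (stepSize τ n) n (x, w) - m₀) ∂noise
          = ∫ z, ψ (√(V n x) * z + -m₀) ∂(gaussianReal 0 1) := by
        have hmap := map_noise_sum (fun i => stepSize τ n * deriv φ (x i)) n
        have hcont : Continuous fun z => ψ (z - m₀) := hψ.comp (by fun_prop)
        have h1 := integral_map (μ := noise) (φ := fun w => linearPart φ (stepSize τ n) n (x, w))
          hLx.measurable.aemeasurable (f := fun z => ψ (z - m₀)) hcont.aestronglyMeasurable
        have h2 := integral_gaussianReal_eq 0 (V n x) hcont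
        rw [← h1]
        simp only [add_zero] at h2
        simp only [← sub_eq_add_neg, ← h2]
        exact congrArg (fun ρ => ∫ z, ψ (z - m₀) ∂ρ) hmap
      have e2 : limMean φ τ ψ = ∫ z, ψ (√v₀ * z + -m₀) ∂(gaussianReal 0 1) := by
        rw [limMean, integral_gaussianReal_eq _ _ hψ, hm₀, neg_mul]
      have hLip : ∀ a b, |ψ a - ψ b| ≤ K * |a - b| := fun a b => by
        have := hL.dist_le_mul a b
        simpa [Real.dist_eq] using this
      have b1 : |quenchedMean φ τ ψ n x - ∫ w, ψ (linearPart φ (stepSize τ n) n (x, w) - m₀) ∂noise|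
          ≤ K * ∫ w, |D n (x, w)| ∂noise := by
        rw [quenchedMean, ← integral_sub (hb1 hSx.aestronglyMeasurable)
          (hb1 (g := fun w => linearPart φ (stepSize τ n) n (x, w) - m₀)
          (hLx.sub continuous_const).aestronglyMeasurable), ← integral_const_mul]
        refine abs_integral_le_integral (hx.const_mul _) fun w => ?_
        refine (hLip _ _).trans_eq ?_
        simp only [hD]
        congr 2
        ring
      have b2 : |(∫ z, ψ (√(V n x) * z + -m₀) ∂(gaussianReal 0 1))
          - ∫ z, ψ (√v₀ * z + -m₀) ∂(gaussianReal 0 1)| ≤ K * E₁ * √|V n x - v₀| := by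
        have hcm : ∀ a : ℝ, AEStronglyMeasurable (fun z => a * z + -m₀) (gaussianReal 0 1) :=
          fun a => (by fun_prop : Continuous fun z => a * z + -m₀).aestronglyMeasurable
        rw [← integral_sub (hb1 (hcm _)) (hb1 (hcm _)), mul_right_comm, ← integral_const_mul]
        refine abs_integral_le_integral (integrable_abs_gaussian.const_mul _) fun z => ?_
        refine (hLip _ _).trans ?_
        rw [mul_assoc]
        refine mul_le_mul_of_nonneg_left ?_ K.coe_nonneg
        calc |√(V n x) * z + -m₀ - (√v₀ * z + -m₀)| = |√(V n x) - √v₀| * |z| := by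
              rw [← abs_mul]; congr 1; ring
          _ ≤ _ := by
              gcongr
              exact abs_sqrt_sub_sqrt_le (hVn n x) hv₀n
      rw [e1] at b1
      rw [e2]
      exact (abs_sub_le _ _ _).trans (add_le_add b1 b2)
    calc _ ≤ ∫ x, (K * (∫ w, |D n (x, w)| ∂noise) + K * E₁ * √|V n x - v₀|) ∂(targetInf φ) := by
          refine integral_mono_of_nonneg (Eventually.of_forall fun _ => abs_nonneg _)
            ((hDi'.const_mul _).add ((hsq2.integrable one_le_two).const_mul _)) hpt
      _ = K * (∫ p, |D n p| ∂(joint φ)) + K * E₁ * ∫ x, √|V n x - v₀| ∂(targetInf φ) := by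
          rw [integral_add (hDi'.const_mul _) ((hsq2.integrable one_le_two).const_mul _),
            integral_const_mul, integral_const_mul]
          congr 2
          exact (integral_prod _ hDi).symm
      _ ≤ _ := by
          have h1 := integral_abs_le_sqrt (hDm n)
          have h2 := integral_abs_le_sqrt hsq2
          simp only [abs_of_nonneg (Real.sqrt_nonneg _), Real.sq_sqrt (abs_nonneg _)] at h2
          have hE : 0 ≤ E₁ := integral_nonneg fun _ => abs_nonneg _
          gcongr
  refine squeeze_zero (fun n => integral_nonneg fun _ => abs_nonneg _) hbound ?_
  have l1 := (H.tendsto_integral_logRatio_sub_sq τ).sqrt.const_mul (K : ℝ)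
  have l2 := (H.tendsto_integral_abs_variance_sub τ).sqrt.const_mul (K * E₁)
  simpa using l1.add l2

end ScoreModulus

/-! ### Limits of means under the joint law -/

lemma sq_integral_mul_le {Ω : Type*} [MeasurableSpace Ω] {P : Measure Ω} {f g : Ω → ℝ}
    (hf : MemLp f 2 P) (hg : MemLp g 2 P) :
    (∫ a, f a * g a ∂P) ^ 2 ≤ (∫ a, f a ^ 2 ∂P) * ∫ a, g a ^ 2 ∂P := by
  have hfg : Integrable (fun a => f a * g a) P := hf.integrable_mul hg
  have h : ∀ t : ℝ, 0 ≤ (∫ a, f a ^ 2 ∂P) * (t * t) + (2 * ∫ a, f a * g a ∂P) * t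
      + ∫ a, g a ^ 2 ∂P := by
    intro t
    have h0 : 0 ≤ ∫ a, (t * f a + g a) ^ 2 ∂P := integral_nonneg fun _ => sq_nonneg _
    have e : (fun a => (t * f a + g a) ^ 2)
        = fun a => (t * t * f a ^ 2 + 2 * t * (f a * g a)) + g a ^ 2 := by
      ext a; ring
    have i1 : Integrable (fun a => t * t * f a ^ 2 + 2 * t * (f a * g a)) P :=
      (hf.integrable_sq.const_mul _).add (hfg.const_mul _)
    rw [e, integral_add i1 hg.integrable_sq, integral_add (hf.integrable_sq.const_mul _)
      (hfg.const_mul _), integral_const_mul, integral_const_mul] at h0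
    linarith
  have := discrim_le_zero h
  rw [discrim] at this
  linarith

lemma abs_integral_mul_le {Ω : Type*} [MeasurableSpace Ω] {P : Measure Ω} {f g : Ω → ℝ}
    (hf : MemLp f 2 P) (hg : MemLp g 2 P) :
    |∫ a, f a * g a ∂P| ≤ √(∫ a, f a ^ 2 ∂P) * √(∫ a, g a ^ 2 ∂P) := by
  rw [← Real.sqrt_mul (integral_nonneg fun _ => sq_nonneg _)]
  exact Real.abs_le_sqrt (sq_integral_mul_le hf hg)

lemma limMean_abs_le (φ : ℝ → ℝ) (τ : ℝ) {ψ : ℝ → ℝ} (hB : ∀ s, |ψ s| ≤ 1) :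
    |limMean φ τ ψ| ≤ 1 := by
  have := norm_integral_le_of_norm_le_const (C := 1)
    (μ := gaussianReal (-(τ ^ 2 / 2) * fisherInfo φ) (τ ^ 2 * fisherInfo φ).toNNReal) (f := ψ)
    (Eventually.of_forall fun s => by simpa using hB s)
  simpa [limMean] using this

section Tools

variable {φ : ℝ → ℝ} [IsProbabilityMeasure (target φ)]

lemma memLp_comp_fst {h : (ℕ → ℝ) → ℝ} (hh : MemLp h 2 (targetInf φ)) :
    MemLp (fun p => h p.1) 2 (joint φ) :=
  hh.comp_measurePreserving measurePreserving_fst_joint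

lemma integral_comp_fst {h : (ℕ → ℝ) → ℝ} (hh : AEStronglyMeasurable h (targetInf φ)) :
    ∫ p, h p.1 ∂(joint φ) = ∫ x, h x ∂(targetInf φ) := by
  have := integral_map (measurePreserving_fst_joint (φ := φ)).aemeasurable
    (by rwa [measurePreserving_fst_joint.map_eq])
  rw [measurePreserving_fst_joint.map_eq] at this
  exact this.symm

lemma integrable_comp_noise {f : ℝ → ℝ} (hf : Integrable f (gaussianReal 0 1)) (i : ℕ) :
    Integrable (fun p => f (p.2 i)) (joint φ) :=
  ((measurePreserving_noise_coord i).comp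
    (measurePreserving_snd_joint (φ := φ))).integrable_comp_of_integrable hf

lemma memLp_noise (i : ℕ) : MemLp (fun p : (ℕ → ℝ) × (ℕ → ℝ) => p.2 i) 2 (joint φ) :=
  (memLp_id_gaussianReal (μ := 0) (v := 1) 2).comp_measurePreserving
    ((measurePreserving_noise_coord i).comp (measurePreserving_snd_joint (φ := φ)))

/-- Multiplication by a bounded continuous function preserves integrability. -/
lemma Integrable.bounded_mul {Ω : Type*} [MeasurableSpace Ω] [TopologicalSpace Ω]
    [OpensMeasurableSpace Ω] {P : Measure Ω}
    {f g : Ω → ℝ} (hf : Integrable f P) (hg : Continuous g) {C : ℝ} (hC : ∀ a, |g a| ≤ C) :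
    Integrable (fun a => g a * f a) P :=
  hf.bdd_mul hg.aestronglyMeasurable (Eventually.of_forall hC)

end Tools

namespace ScoreModulus

variable {φ m : ℝ → ℝ} (H : ScoreModulus φ m) [IsProbabilityMeasure (target φ)] {τ : ℝ}
  {ψ : ℝ → ℝ}

include H

omit [IsProbabilityMeasure (target φ)] in
lemma continuous_comp_logRatio (hψ : Continuous ψ) (n : ℕ) :
    Continuous fun p => ψ (logRatio φ (stepSize τ n) n p) :=
  hψ.comp (continuous_logRatio H.continuous _ _)

lemma integral_mul_comp_logRatio (hψ : Continuous ψ) (hB : ∀ s, |ψ s| ≤ 1)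
    {f : (ℕ → ℝ) → ℝ} (hf : Integrable f (targetInf φ)) (n : ℕ) :
    ∫ p, f p.1 * ψ (logRatio φ (stepSize τ n) n p) ∂(joint φ)
      = ∫ x, f x * quenchedMean φ τ ψ n x ∂(targetInf φ) := by
  have hf' : Integrable (fun p => f p.1) (joint φ) :=
    measurePreserving_fst_joint.integrable_comp_of_integrable hf
  have hi : Integrable (fun p => f p.1 * ψ (logRatio φ (stepSize τ n) n p)) (joint φ) := by
    have := Integrable.bounded_mul hf' (H.continuous_comp_logRatio (τ := τ) hψ n) fun p => hB _
    simpa only [mul_comm] using this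
  rw [joint] at hi ⊢
  rw [integral_prod _ hi]
  simp only [integral_const_mul, quenchedMean]

omit [IsProbabilityMeasure (target φ)] in
lemma stronglyMeasurable_quenchedMean (hψ : Continuous ψ) (n : ℕ) :
    StronglyMeasurable (quenchedMean φ τ ψ n) :=
  (H.continuous_comp_logRatio (τ := τ) hψ n).stronglyMeasurable.integral_prod_right'

omit H [IsProbabilityMeasure (target φ)] in
lemma abs_quenchedMean_le (hB : ∀ s, |ψ s| ≤ 1) (n : ℕ) (x : ℕ → ℝ) :
    |quenchedMean φ τ ψ n x| ≤ 1 := by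
  have := norm_integral_le_of_norm_le_const (C := 1) (μ := noise)
    (f := fun w => ψ (logRatio φ (stepSize τ n) n (x, w)))
    (Eventually.of_forall fun s => by simpa using hB _)
  simpa [quenchedMean] using this

/-- The log-ratio is asymptotically independent of the state, along weakly convergent functions of
the state. -/
lemma tendsto_integral_weak {K : ℝ≥0} (hL : LipschitzWith K ψ) (hB : ∀ s, |ψ s| ≤ 1)
    {h : ℕ → (ℕ → ℝ) → ℝ} (hh : ∀ n, MemLp (h n) 2 (targetInf φ)) {C : ℝ}
    (hC : ∀ n, ∫ x, h n x ^ 2 ∂(targetInf φ) ≤ C) {l : ℝ}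
    (hl : Tendsto (fun n => ∫ x, h n x ∂(targetInf φ)) atTop (𝓝 l)) :
    Tendsto (fun n => ∫ p, h n p.1 * ψ (logRatio φ (stepSize τ n) n p) ∂(joint φ)) atTop
      (𝓝 (limMean φ τ ψ * l)) := by
  have hq := H.tendsto_quenchedMean τ hL hB
  have hsm := fun n => H.stronglyMeasurable_quenchedMean (τ := τ) hL.continuous n
  set c := limMean φ τ ψ with hc
  have hcb : |c| ≤ 1 := limMean_abs_le φ τ hB
  have hqb : ∀ n x, |quenchedMean φ τ ψ n x - c| ≤ 2 := fun n x =>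
    (abs_sub _ _).trans (by linarith [abs_quenchedMean_le (φ := φ) (τ := τ) hB n x])
  have hqm : ∀ n, MemLp (fun x => quenchedMean φ τ ψ n x - c) 2 (targetInf φ) := fun n =>
    MemLp.of_bound ((hsm n).aestronglyMeasurable.sub aestronglyMeasurable_const) 2
      (Eventually.of_forall (hqb n))
  have e : ∀ n, ∫ p, h n p.1 * ψ (logRatio φ (stepSize τ n) n p) ∂(joint φ)
      = (∫ x, h n x * (quenchedMean φ τ ψ n x - c) ∂(targetInf φ))
        + c * ∫ x, h n x ∂(targetInf φ) := by
    intro n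
    have hi := (hh n).integrable one_le_two
    rw [H.integral_mul_comp_logRatio hL.continuous hB hi, ← integral_const_mul,
      ← integral_add (f := fun x => h n x * (quenchedMean φ τ ψ n x - c))
        ((hh n).integrable_mul (hqm n)) (hi.const_mul c)]
    refine integral_congr_ae (Eventually.of_forall fun x => ?_)
    simp only; ring
  simp only [e]
  rw [show c * l = 0 + c * l by ring]
  refine Tendsto.add ?_ (hl.const_mul c)
  have hbound : ∀ n, |∫ x, h n x * (quenchedMean φ τ ψ n x - c) ∂(targetInf φ)|
      ≤ √C * √(2 * ∫ x, |quenchedMean φ τ ψ n x - c| ∂(targetInf φ)) := by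
    intro n
    refine (abs_integral_mul_le (hh n) (hqm n)).trans ?_
    gcongr
    · exact hC n
    · rw [← integral_const_mul]
      refine integral_mono (hqm n).integrable_sq
        (((hqm n).integrable one_le_two).abs.const_mul 2) fun x => ?_
      simp only
      rw [← sq_abs, sq]
      exact mul_le_mul_of_nonneg_right (hqb n x) (abs_nonneg _)
  refine squeeze_zero_norm hbound ?_
  simpa using ((hq.const_mul 2).sqrt).const_mul (√C)

/-- The case of a constant sequence of functions of the state. -/
lemma tendsto_integral_mul {K : ℝ≥0} (hL : LipschitzWith K ψ) (hB : ∀ s, |ψ s| ≤ 1)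
    {V : (ℕ → ℝ) → ℝ} (hV : MemLp V 2 (targetInf φ)) :
    Tendsto (fun n => ∫ p, V p.1 * ψ (logRatio φ (stepSize τ n) n p) ∂(joint φ)) atTop
      (𝓝 (limMean φ τ ψ * ∫ x, V x ∂(targetInf φ))) :=
  H.tendsto_integral_weak hL hB (fun _ => hV) (fun _ => le_rfl) tendsto_const_nhds

/-- By detailed balance, the derivative of the soft acceptance function has half the
limiting mean of the function itself. -/
lemma limMean_softAcceptDeriv {δ : ℝ} (hδ : 0 < δ) :
    limMean φ τ (softAcceptDeriv δ) = limMean φ τ (softAccept δ) / 2 := by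
  obtain ⟨L, hL⟩ := exists_lipschitz_softAcceptDeriv hδ
  have h1 := H.tendsto_integral_mul (τ := τ) hL (abs_softAcceptDeriv_le_one hδ)
    (memLp_const (1 : ℝ))
  have h2 := H.tendsto_integral_mul (τ := τ) (lipschitz_softAccept hδ) (abs_softAccept_le_one hδ)
    (memLp_const (1 : ℝ))
  have h3 := h1.sub (h2.div_const 2)
  have hz : ∀ n, (∫ p, 1 * softAcceptDeriv δ (logRatio φ (stepSize τ n) n p) ∂(joint φ))
      - (∫ p, 1 * softAccept δ (logRatio φ (stepSize τ n) n p) ∂(joint φ)) / 2 = 0 := by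
    intro n
    have c1 := H.continuous_comp_logRatio (τ := τ) hL.continuous n
    have c2 := H.continuous_comp_logRatio (τ := τ) (lipschitz_softAccept hδ).continuous n
    have i1 : Integrable (fun p => softAcceptDeriv δ (logRatio φ (stepSize τ n) n p)) (joint φ) :=
      Integrable.of_bound c1.aestronglyMeasurable 1
        (Eventually.of_forall fun _ => abs_softAcceptDeriv_le_one hδ _)
    have i2 : Integrable (fun p => softAccept δ (logRatio φ (stepSize τ n) n p)) (joint φ) :=
      Integrable.of_bound c2.aestronglyMeasurable 1
        (Eventually.of_forall fun _ => abs_softAccept_le_one hδ _)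
    have h := integral_reversal H.continuous (stepSize τ n) n (i1.sub (i2.div_const 2)).1
    simp only [Pi.sub_apply, logRatio_reversal, softAcceptDeriv_sub_half] at h
    rw [integral_neg, integral_sub i1 (i2.div_const 2), integral_div] at h
    simp only [one_mul]
    linarith
  simp only [hz, integral_const, probReal_univ, one_smul, mul_one] at h3
  have := tendsto_nhds_unique tendsto_const_nhds h3
  linarith

omit [IsProbabilityMeasure (target φ)] in
lemma abs_score_shift_le (n i : ℕ) (p : (ℕ → ℝ) × (ℕ → ℝ)) :
    |deriv φ (p.1 i + stepSize τ n * p.2 i) - deriv φ (p.1 i)| ≤ m (|τ| * p.2 i) := by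
  refine (H.bound _ _).trans (H.mono _ _ ?_)
  rw [abs_mul, abs_mul, abs_abs]
  exact mul_le_mul_of_nonneg_right (abs_stepSize_le τ n) (abs_nonneg _)

omit [IsProbabilityMeasure (target φ)] in
/-- The derivative of a function of the log-ratio in a noise coordinate. -/
lemma hasDerivAt_comp_logRatio {ψ' : ℝ → ℝ} (hψ : ∀ s, HasDerivAt ψ (ψ' s) s) (t : ℝ) {n i : ℕ}
    (hi : i < n) (p : (ℕ → ℝ) × (ℕ → ℝ)) :
    HasDerivAt (fun s => ψ (logRatio φ t n (p.1, Function.update p.2 i s)))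
      (ψ' (logRatio φ t n p) * (t * deriv φ (p.1 i + t * p.2 i))) (p.2 i) := by
  have h1 : HasDerivAt (fun s => logRatio φ t n (p.1, Function.update p.2 i s))
      (t * deriv φ (p.1 i + t * p.2 i)) (p.2 i) := by
    have hterm : ∀ j ∈ Finset.range n, HasDerivAt
        (fun s => φ (p.1 j + t * Function.update p.2 i s j) - φ (p.1 j))
        (if j = i then t * deriv φ (p.1 i + t * p.2 i) else 0) (p.2 i) := by
      intro j _
      by_cases hj : j = i
      · subst hj
        simp only [Function.update_self, if_true]
        have h2 : HasDerivAt (fun s => p.1 j + t * s) t (p.2 j) := by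
          simpa using ((hasDerivAt_id (p.2 j)).const_mul t).const_add (p.1 j)
        have h3 := ((H.differentiable (p.1 j + t * p.2 j)).hasDerivAt.comp (p.2 j) h2).sub_const
          (φ (p.1 j))
        exact h3.congr_deriv (by ring)
      · simp only [Function.update_of_ne hj, if_neg hj]
        exact hasDerivAt_const _ _
    have h := HasDerivAt.fun_sum hterm
    refine h.congr_deriv ?_
    simp [Finset.mem_range.2 hi]
  have h2 : HasDerivAt ψ (ψ' (logRatio φ t n p))
      (logRatio φ t n (p.1, Function.update p.2 i (p.2 i))) := by
    rw [Function.update_eq_self]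
    exact hψ _
  exact h2.comp (p.2 i) h1

/-- Quadratic functions of the noise decouple from the acceptance probability. -/
lemma tendsto_integral_noise_mul_noise {δ : ℝ} (hδ : 0 < δ) {V : (ℕ → ℝ) → ℝ} (hV : Continuous V)
    {C : ℝ} (hC : ∀ x, |V x| ≤ C) (i j : ℕ) :
    Tendsto (fun n => ∫ p, p.2 i * (V p.1 * p.2 j * softAccept δ (logRatio φ (stepSize τ n) n p))
      ∂(joint φ)) atTop
      (𝓝 (if i = j then limMean φ τ (softAccept δ) * ∫ x, V x ∂(targetInf φ) else 0)) := by
  have hC0 : 0 ≤ C := (abs_nonneg _).trans (hC 0)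
  obtain ⟨L, hL⟩ := exists_lipschitz_softAcceptDeriv hδ
  set S := fun n => logRatio φ (stepSize τ n) n with hS
  -- the term in which Stein's identity differentiates the log-ratio; it carries a factor `stepSize`
  set R : ℕ → (ℕ → ℝ) × (ℕ → ℝ) → ℝ := fun n p => V p.1 * (p.2 j * (softAcceptDeriv δ (S n p) *
    deriv φ (p.1 i + stepSize τ n * p.2 i))) with hR
  have cψ : ∀ n, Continuous fun p => softAccept δ (S n p) := fun n =>
    H.continuous_comp_logRatio (τ := τ) (lipschitz_softAccept hδ).continuous n
  have cψ' : ∀ n, Continuous fun p => softAcceptDeriv δ (S n p) := fun n =>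
    H.continuous_comp_logRatio (τ := τ) hL.continuous n
  have cφ := H.continuous_deriv
  have hmain : Tendsto (fun n => ∫ p, V p.1 * softAccept δ (S n p) ∂(joint φ)) atTop
      (𝓝 (limMean φ τ (softAccept δ) * ∫ x, V x ∂(targetInf φ))) :=
    H.tendsto_integral_mul (lipschitz_softAccept hδ) (abs_softAccept_le_one hδ)
      (MemLp.of_bound hV.aestronglyMeasurable C (Eventually.of_forall hC))
  set B : (ℕ → ℝ) × (ℕ → ℝ) → ℝ := fun p =>
    C * (|p.2 j| ^ 2 + 2 * |deriv φ (p.1 i)| ^ 2 + 2 * m (|τ| * p.2 i) ^ 2) with hB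
  have hBi : Integrable B (joint φ) := by
    have i1 : Integrable (fun p : (ℕ → ℝ) × (ℕ → ℝ) => |p.2 j| ^ 2) (joint φ) := by
      simpa using (memLp_noise j).integrable_sq
    have i2 : Integrable (fun p : (ℕ → ℝ) × (ℕ → ℝ) => |deriv φ (p.1 i)| ^ 2) (joint φ) := by
      have := (measurePreserving_coord i).integrable_comp_of_integrable H.integrable_deriv_sq
      simpa [Function.comp_def] using
        (measurePreserving_fst_joint (φ := φ)).integrable_comp_of_integrable this
    have i3 : Integrable (fun p : (ℕ → ℝ) × (ℕ → ℝ) => m (|τ| * p.2 i) ^ 2) (joint φ) := by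
      have := H.integrable_scaled |τ| 0 2
      simp only [pow_zero, one_mul] at this
      exact integrable_comp_noise this i
    exact ((i1.add (i2.const_mul 2)).add (i3.const_mul 2)).const_mul C
  have hRb : ∀ n p, |R n p| ≤ B p := by
    intro n p
    have h1 := H.abs_score_shift_le (τ := τ) n i p
    have h2 : |deriv φ (p.1 i + stepSize τ n * p.2 i)|
        ≤ |deriv φ (p.1 i)| + m (|τ| * p.2 i) := by
      have := abs_sub_abs_le_abs_sub (deriv φ (p.1 i + stepSize τ n * p.2 i)) (deriv φ (p.1 i))
      linarith
    simp only [hR, hB]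
    rw [abs_mul, abs_mul, abs_mul]
    refine mul_le_mul (hC _) ?_ (by positivity) hC0
    have h3 : |softAcceptDeriv δ (S n p)| * |deriv φ (p.1 i + stepSize τ n * p.2 i)|
        ≤ |deriv φ (p.1 i)| + m (|τ| * p.2 i) :=
      (mul_le_of_le_one_left (abs_nonneg _) (abs_softAcceptDeriv_le_one hδ _)).trans h2
    have h4 : 0 ≤ |deriv φ (p.1 i)| + m (|τ| * p.2 i) := add_nonneg (abs_nonneg _) (H.nonneg _)
    calc _ ≤ |p.2 j| * (|deriv φ (p.1 i)| + m (|τ| * p.2 i)) := by gcongr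
      _ ≤ _ := by nlinarith [sq_nonneg (|p.2 j| - (|deriv φ (p.1 i)| + m (|τ| * p.2 i))),
          sq_nonneg (|deriv φ (p.1 i)| - m (|τ| * p.2 i))]
  have hRc : ∀ n, Continuous (R n) := fun n => by
    have := cψ' n
    simp only [hR]
    fun_prop
  have hRi : ∀ n, Integrable (R n) (joint φ) := fun n =>
    hBi.mono' (hRc n).aestronglyMeasurable (Eventually.of_forall (hRb n))
  have hrem : Tendsto (fun n => stepSize τ n * ∫ p, R n p ∂(joint φ)) atTop (𝓝 0) := by
    refine squeeze_zero_norm (a := fun n => |stepSize τ n| * ∫ p, B p ∂(joint φ)) (fun n => ?_) ?_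
    · rw [norm_mul, Real.norm_eq_abs, Real.norm_eq_abs]
      exact mul_le_mul_of_nonneg_left (abs_integral_le_integral hBi (hRb n)) (abs_nonneg _)
    · simpa using (tendsto_stepSize τ).abs.mul_const (∫ p, B p ∂(joint φ))
  have hlim := (hmain.const_mul (if i = j then 1 else 0)).add hrem
  have e0 : (if i = j then (1 : ℝ) else 0) * (limMean φ τ (softAccept δ) * ∫ x, V x ∂(targetInf φ))
      + 0 = if i = j then limMean φ τ (softAccept δ) * ∫ x, V x ∂(targetInf φ) else 0 := by
    split_ifs <;> simp
  rw [e0] at hlim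
  refine hlim.congr' ?_
  filter_upwards [eventually_gt_atTop i] with n hn
  have iV : Integrable (fun p => V p.1 * softAccept δ (S n p)) (joint φ) :=
    Integrable.of_bound (by fun_prop : Continuous fun p => V p.1 * softAccept δ (S n p)
      ).aestronglyMeasurable C (Eventually.of_forall fun p => by
        rw [norm_mul]
        exact (mul_le_mul (hC _) (abs_softAccept_le_one hδ _) (abs_nonneg _) hC0).trans_eq
          (mul_one C))
  have iK : Integrable (fun p => V p.1 * p.2 j * softAccept δ (S n p)) (joint φ) := by
    have h := Integrable.bounded_mul ((memLp_noise (φ := φ) j).integrable one_le_two)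
      (g := fun p => V p.1 * softAccept δ (S n p)) (by fun_prop) (C := C) (fun p => by
        rw [abs_mul]
        exact (mul_le_mul (hC _) (abs_softAccept_le_one hδ _) (abs_nonneg _) hC0).trans_eq
          (mul_one C))
    refine h.congr (Eventually.of_forall fun p => ?_)
    simp only; ring
  have iwK : Integrable (fun p => p.2 i * (V p.1 * p.2 j * softAccept δ (S n p))) (joint φ) := by
    have h := Integrable.bounded_mul ((memLp_noise (φ := φ) i).integrable_mul (memLp_noise j))
      (g := fun p => V p.1 * softAccept δ (S n p)) (by fun_prop) (C := C) (fun p => by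
        rw [abs_mul]
        exact (mul_le_mul (hC _) (abs_softAccept_le_one hδ _) (abs_nonneg _) hC0).trans_eq
          (mul_one C))
    refine h.congr (Eventually.of_forall fun p => ?_)
    simp only [Pi.mul_apply]; ring
  have iK' : Integrable (fun p => (if i = j then 1 else 0) * (V p.1 * softAccept δ (S n p))
      + stepSize τ n * R n p) (joint φ) := (iV.const_mul _).add ((hRi n).const_mul _)
  have hst := integral_noise_mul (φ := φ) i iK iwK iK' (fun p => by
    have h1 := H.hasDerivAt_comp_logRatio (hasDerivAt_softAccept hδ) (stepSize τ n) hn p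
    have h2 : HasDerivAt (fun s => V p.1 * Function.update p.2 i s j)
        (V p.1 * if i = j then 1 else 0) (p.2 i) := by
      refine HasDerivAt.const_mul _ ?_
      by_cases hij : i = j
      · subst hij
        simpa using hasDerivAt_id' (p.2 i)
      · simp only [Function.update_of_ne (Ne.symm hij), if_neg hij]
        exact hasDerivAt_const _ _
    refine (h2.mul h1).congr_deriv ?_
    simp only [hR, hS, Function.update_eq_self]
    ring)
  rw [hst, integral_add (iV.const_mul _) ((hRi n).const_mul _), integral_const_mul,
    integral_const_mul]

end ScoreModulus

/-! ### The random walk forms -/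

lemma tendsto_shift (τ : ℝ) (p : (ℕ → ℝ) × (ℕ → ℝ)) :
    Tendsto (fun n => shift (stepSize τ n) n p) atTop (𝓝 p.1) := by
  rw [tendsto_pi_nhds]
  intro i
  have h : Tendsto (fun n => p.1 i + stepSize τ n * p.2 i) atTop (𝓝 (p.1 i)) := by
    simpa using ((tendsto_stepSize τ).mul_const (p.2 i)).const_add (p.1 i)
  refine h.congr' ?_
  filter_upwards [eventually_gt_atTop i] with n hn
  simp [shift, hn]

lemma acceptProb_eq (φ : ℝ → ℝ) (τ : ℝ) (n : ℕ) (x w : ℕ → ℝ) :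
    acceptProb φ τ n x w = min 1 (Real.exp (logRatio φ (stepSize τ n) n (x, w))) := by
  rw [acceptProb, logRatio, Finset.sum_sub_distrib, Real.exp_sub, Real.exp_sum, Real.exp_sum]
  rfl

section Forms

variable {φ : ℝ → ℝ} [IsProbabilityMeasure (target φ)]

omit [IsProbabilityMeasure (target φ)] in
lemma measurable_step (hφ : Continuous φ) (τ : ℝ) (n : ℕ) :
    Measurable fun q : (ℕ → ℝ) × (ℕ → ℝ) × ℝ => step φ τ n q.1 q.2.1 q.2.2 := by
  have hS : Measurable fun p : (ℕ → ℝ) × (ℕ → ℝ) => acceptProb φ τ n p.1 p.2 := by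
    simp only [acceptProb_eq]
    have := (continuous_logRatio hφ (stepSize τ n) n).measurable
    fun_prop
  refine measurable_pi_lambda _ fun i => ?_
  unfold step
  refine Measurable.add (by fun_prop) (Measurable.ite ?_ (by fun_prop) measurable_const)
  refine MeasurableSet.inter (MeasurableSet.const _) ?_
  exact measurableSet_lt (by fun_prop)
    (hS.comp (by fun_prop : Measurable fun q : (ℕ → ℝ) × (ℕ → ℝ) × ℝ => (q.1, q.2.1)))

/-- Integrating out the acceptance variable. -/
lemma lintegral_step (φ : ℝ → ℝ) (τ : ℝ) (n : ℕ) (h : (ℕ → ℝ) → ℝ) (x w : ℕ → ℝ) :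
    ∫⁻ u, ENNReal.ofReal ((h (step φ τ n x w u) - h x) ^ 2) ∂(volume.restrict (Set.Ioo (0 : ℝ) 1))
      = ENNReal.ofReal ((h (shift (stepSize τ n) n (x, w)) - h x) ^ 2 *
        min 1 (Real.exp (logRatio φ (stepSize τ n) n (x, w)))) := by
  rw [← acceptProb_eq]
  obtain ⟨a, ha⟩ : ∃ a, acceptProb φ τ n x w = a := ⟨_, rfl⟩
  have ha1 : a = min 1 (Real.exp (logRatio φ (stepSize τ n) n (x, w))) := by
    rw [← ha, acceptProb_eq]
  have ha0 : 0 < a := by rw [ha1]; exact lt_min one_pos (Real.exp_pos _)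
  have hale : a ≤ 1 := by rw [ha1]; exact min_le_left _ _
  have e : ∀ u : ℝ, ENNReal.ofReal ((h (step φ τ n x w u) - h x) ^ 2)
      = (Set.Iio a).indicator
        (fun _ => ENNReal.ofReal ((h (shift (stepSize τ n) n (x, w)) - h x) ^ 2)) u := by
    intro u
    by_cases hu : u < a
    · rw [Set.indicator_of_mem (Set.mem_Iio.2 hu)]
      have : step φ τ n x w u = shift (stepSize τ n) n (x, w) := by
        funext i
        by_cases hi : i < n
        · simp only [step, shift, ha, hu, hi, and_self, if_true, stepSize]
        · simp only [step, shift, hi, false_and, if_false, add_zero]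
      rw [this]
    · rw [Set.indicator_of_notMem (by simpa using hu)]
      have : step φ τ n x w u = x := by
        funext i
        simp only [step, ha, hu, and_false, if_false, add_zero]
      simp [this]
  have hvol : (volume.restrict (Set.Ioo (0 : ℝ) 1)) (Set.Iio a) = ENNReal.ofReal a := by
    rw [Measure.restrict_apply measurableSet_Iio]
    have : Set.Iio a ∩ Set.Ioo 0 1 = Set.Ioo 0 a := by
      ext u
      simp only [Set.mem_inter_iff, Set.mem_Iio, Set.mem_Ioo]
      exact ⟨fun hu => ⟨hu.2.1, hu.1⟩, fun hu => ⟨hu.2, hu.1, hu.2.trans_le hale⟩⟩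
    rw [this, Real.volume_Ioo, sub_zero]
  simp only [e]
  rw [lintegral_indicator_const measurableSet_Iio, hvol, ← ENNReal.ofReal_mul (sq_nonneg _), ha]

/-- The form as an integral over state and noise, with the acceptance variable integrated out. -/
lemma rwForm_eq (hφ : Continuous φ) (τ : ℝ) (n : ℕ) (h : L2Target φ) :
    rwForm φ τ n h = (n : ℝ≥0∞) / 2 * ∫⁻ p, ENNReal.ofReal
      ((h (shift (stepSize τ n) n p) - h p.1) ^ 2 *
        min 1 (Real.exp (logRatio φ (stepSize τ n) n p))) ∂(joint φ) := by
  obtain ⟨h', hh'⟩ : ∃ h' : (ℕ → ℝ) → ℝ, (h : (ℕ → ℝ) → ℝ) = h' := ⟨_, rfl⟩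
  have hm : Measurable h' := hh' ▸ (Lp.stronglyMeasurable h).measurable
  rw [rwForm, hh']
  have hF : Measurable fun q : (ℕ → ℝ) × (ℕ → ℝ) × ℝ =>
      ENNReal.ofReal ((h' (step φ τ n q.1 q.2.1 q.2.2) - h' q.1) ^ 2) :=
    (((hm.comp (measurable_step hφ τ n)).sub (hm.comp measurable_fst)).pow_const 2).ennreal_ofReal
  have hG : Measurable fun p => ENNReal.ofReal
      ((h' (shift (stepSize τ n) n p) - h' p.1) ^ 2 *
        min 1 (Real.exp (logRatio φ (stepSize τ n) n p))) := by
    have := (continuous_logRatio hφ (stepSize τ n) n).measurable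
    have h1 := hm.comp (measurable_shift (stepSize τ n) n)
    have h2 : Measurable fun p : (ℕ → ℝ) × (ℕ → ℝ) => h' p.1 := hm.comp measurable_fst
    exact (((h1.sub h2).pow_const 2).mul (by fun_prop)).ennreal_ofReal
  rw [noiseLaw, lintegral_prod _ hF.aemeasurable, joint, lintegral_prod _ hG.aemeasurable]
  refine congrArg _ (lintegral_congr fun x => ?_)
  have hFx : Measurable fun q : (ℕ → ℝ) × ℝ =>
      ENNReal.ofReal ((h' (step φ τ n x q.1 q.2) - h' x) ^ 2) := hF.comp measurable_prodMk_left
  exact (lintegral_prod _ hFx.aemeasurable).trans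
    (lintegral_congr fun w => lintegral_step φ τ n h' x w)

/-- Increments weighted by the acceptance function are square integrable, although the value at the
proposal alone need not be: `softAccept ≤ exp` lets detailed balance absorb the weight. -/
lemma memLp_shift_sub_mul (hφ : Continuous φ) {δ : ℝ} (hδ : 0 < δ) (t : ℝ) (n : ℕ)
    {h : (ℕ → ℝ) → ℝ} (hm : Measurable h) (hh : MemLp h 2 (targetInf φ)) :
    MemLp (fun p => (h (shift t n p) - h p.1) * √(softAccept δ (logRatio φ t n p))) 2
      (joint φ) := by
  have hS := (continuous_logRatio hφ t n).measurable
  have hψ : Measurable (softAccept δ) := (lipschitz_softAccept hδ).continuous.measurable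
  have h1 : MemLp (fun p => h (shift t n p) * √(softAccept δ (logRatio φ t n p))) 2 (joint φ) := by
    have hmeas : Measurable fun p => h (shift t n p) * √(softAccept δ (logRatio φ t n p)) := by
      have := hm.comp (measurable_shift t n)
      have := hψ.comp hS
      simp only [Function.comp_def] at *
      fun_prop
    rw [memLp_two_iff_integrable_sq hmeas.aestronglyMeasurable]
    have := integrable_reversal hφ t n (memLp_comp_fst hh).integrable_sq
    refine this.mono' (hmeas.pow_const 2).aestronglyMeasurable (Eventually.of_forall fun p => ?_)
    rw [Real.norm_of_nonneg (sq_nonneg _), mul_pow, Real.sq_sqrt (softAccept_pos _ _).le]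
    exact mul_le_mul_of_nonneg_left (softAccept_le_exp hδ _) (sq_nonneg _)
  have h2 : MemLp (fun p : (ℕ → ℝ) × (ℕ → ℝ) => h p.1 * √(softAccept δ (logRatio φ t n p))) 2
      (joint φ) := by
    have hmeas : Measurable fun p : (ℕ → ℝ) × (ℕ → ℝ) =>
        h p.1 * √(softAccept δ (logRatio φ t n p)) := by
      have : Measurable fun p : (ℕ → ℝ) × (ℕ → ℝ) => h p.1 := hm.comp measurable_fst
      have := hψ.comp hS
      simp only [Function.comp_def] at *
      fun_prop
    refine (memLp_comp_fst hh).mono hmeas.aestronglyMeasurable (Eventually.of_forall fun p => ?_)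
    rw [norm_mul]
    refine mul_le_of_le_one_right (norm_nonneg _) ?_
    rw [Real.norm_of_nonneg (Real.sqrt_nonneg _)]
    exact Real.sqrt_le_one.2 (softAccept_le_one hδ _)
  refine (h1.sub h2).ae_eq (Eventually.of_forall fun p => ?_)
  simp only [Pi.sub_apply]; ring

/-- A bound on the form bounds the increments weighted by the soft acceptance function. -/
lemma integral_le_of_rwForm_le (hφ : Continuous φ) {δ : ℝ} (hδ : 0 < δ) {τ : ℝ} {n : ℕ}
    {h : L2Target φ} {L : ℝ} (hL : 0 ≤ L) (hle : rwForm φ τ n h ≤ ENNReal.ofReal L) :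
    n * ∫ p, (h (shift (stepSize τ n) n p) - h p.1) ^ 2
      * softAccept δ (logRatio φ (stepSize τ n) n p) ∂(joint φ) ≤ 2 * L := by
  have hm : Measurable h := (Lp.stronglyMeasurable h).measurable
  have hi : Integrable (fun p => (h (shift (stepSize τ n) n p) - h p.1) ^ 2
      * softAccept δ (logRatio φ (stepSize τ n) n p)) (joint φ) := by
    refine (memLp_shift_sub_mul hφ hδ (stepSize τ n) n hm (Lp.memLp h)).integrable_sq.congr
      (Eventually.of_forall fun p => ?_)
    simp only [mul_pow, Real.sq_sqrt (softAccept_pos δ _).le]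
  have hnn : ∀ p, 0 ≤ (h (shift (stepSize τ n) n p) - h p.1) ^ 2
      * softAccept δ (logRatio φ (stepSize τ n) n p) :=
    fun p => mul_nonneg (sq_nonneg _) (softAccept_pos δ _).le
  have key : ENNReal.ofReal (n / 2 * ∫ p, (h (shift (stepSize τ n) n p) - h p.1) ^ 2
      * softAccept δ (logRatio φ (stepSize τ n) n p) ∂(joint φ)) ≤ ENNReal.ofReal L := by
    refine le_trans ?_ hle
    rw [rwForm_eq hφ, ENNReal.ofReal_mul (by positivity),
      ofReal_integral_eq_lintegral_ofReal hi (Eventually.of_forall hnn)]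
    gcongr with p
    · rw [ENNReal.ofReal_div_of_pos two_pos]
      simp
    · exact softAccept_le_min hδ _
  rw [ENNReal.ofReal_le_ofReal_iff hL] at key
  linarith

end Forms

/-! ### Test fields -/

/-- `G` is an admissible `i`-th component of a test vector field on the sequence space, with `i`-th
partial derivative `D`. The class is chosen stable under addition: compact support in finitely many
coordinates would not be, since a function of `N` coordinates is not compactly supported as a
function of `N + 1` coordinates. -/
structure IsTest (φ : ℝ → ℝ) (i : ℕ) (G D : (ℕ → ℝ) → ℝ) : Prop where
  continuous : Continuous G
  continuous_deriv : Continuous D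
  bound : ∃ C, ∀ x, |G x| ≤ C ∧ |D x| ≤ C ∧ |G x * deriv φ (x i)| ≤ C
  hasDerivAt : ∀ x, HasDerivAt (fun s => G (Function.update x i s)) (D x) (x i)

lemma shift_update_noise (t : ℝ) {n i : ℕ} (hi : i < n) (p : (ℕ → ℝ) × (ℕ → ℝ)) (s : ℝ) :
    shift t n (p.1, Function.update p.2 i s)
      = Function.update (shift t n p) i (p.1 i + t * s) := by
  ext j
  by_cases hj : j = i
  · subst hj
    simp [shift, hi]
  · simp [shift, Function.update_of_ne hj]

namespace IsTest

variable {φ : ℝ → ℝ} {i : ℕ} {G D : (ℕ → ℝ) → ℝ}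

lemma hasDerivAt_shift (T : IsTest φ i G D) (t : ℝ) {n : ℕ} (hi : i < n)
    (p : (ℕ → ℝ) × (ℕ → ℝ)) :
    HasDerivAt (fun s => G (shift t n (p.1, Function.update p.2 i s)))
      (t * D (shift t n p)) (p.2 i) := by
  simp only [shift_update_noise t hi]
  have h1 : HasDerivAt (fun s => p.1 i + t * s) t (p.2 i) := by
    simpa using ((hasDerivAt_id (p.2 i)).const_mul t).const_add (p.1 i)
  have h2 := T.hasDerivAt (shift t n p)
  have e : shift t n p i = p.1 i + t * p.2 i := by simp [shift, hi]
  rw [e] at h2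
  refine (h2.comp (p.2 i) h1).congr_deriv ?_
  ring

end IsTest

namespace ScoreModulus

variable {φ m : ℝ → ℝ} (H : ScoreModulus φ m) [IsProbabilityMeasure (target φ)] {τ : ℝ}

include H

/-- The linear form of the random walk against one component of a test field converges. -/
lemma tendsto_cross {δ : ℝ} (hδ : 0 < δ) {i : ℕ} {G D : (ℕ → ℝ) → ℝ} (T : IsTest φ i G D)
    {h : ℕ → (ℕ → ℝ) → ℝ} (hh : ∀ n, MemLp (h n) 2 (targetInf φ)) {C : ℝ}
    (hC : ∀ n, ∫ x, h n x ^ 2 ∂(targetInf φ) ≤ C) {lD lG : ℝ}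
    (hlD : Tendsto (fun n => ∫ x, h n x * D x ∂(targetInf φ)) atTop (𝓝 lD))
    (hlG : Tendsto (fun n => ∫ x, h n x * (G x * deriv φ (x i)) ∂(targetInf φ)) atTop (𝓝 lG)) :
    Tendsto (fun n : ℕ => √(n : ℝ) * ∫ p, p.2 i * (h n p.1 * (G (shift (stepSize τ n) n p) + G p.1)
      * softAccept δ (logRatio φ (stepSize τ n) n p)) ∂(joint φ)) atTop
      (𝓝 (τ * (limMean φ τ (softAccept δ) * (lD + lG)))) := by
  obtain ⟨C₁, hC₁⟩ := T.bound
  have hC₁0 : 0 ≤ C₁ := (abs_nonneg _).trans (hC₁ 0).1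
  have hC0 : 0 ≤ C := (integral_nonneg fun _ => sq_nonneg _).trans (hC 0)
  obtain ⟨L, hL⟩ := exists_lipschitz_softAcceptDeriv hδ
  set S := fun n => logRatio φ (stepSize τ n) n with hS
  set X := fun n => shift (stepSize τ n) n with hX
  set c := limMean φ τ (softAccept δ) with hc
  set Q : (ℕ → ℝ) → ℝ := fun x => G x * deriv φ (x i) with hQ
  have cψ : ∀ n, Continuous fun p => softAccept δ (S n p) := fun n =>
    H.continuous_comp_logRatio (τ := τ) (lipschitz_softAccept hδ).continuous n
  have cψ' : ∀ n, Continuous fun p => softAcceptDeriv δ (S n p) := fun n =>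
    H.continuous_comp_logRatio (τ := τ) hL.continuous n
  have cφ := H.continuous_deriv
  have cX : ∀ n, Continuous (X n) := fun n => continuous_shift _ _
  have cG := T.continuous
  have cD := T.continuous_deriv
  have cQ : Continuous Q := by simp only [hQ]; fun_prop
  -- up to the factors `h` and `stepSize`, `Y` is the derivative in `wᵢ` that Stein's identity
  -- produces; `Y₀` is `Y` with the proposal replaced by the current state, and `Z` bounds the error
  set Y : ℕ → (ℕ → ℝ) × (ℕ → ℝ) → ℝ := fun n p => D (X n p) * softAccept δ (S n p)
    + (G (X n p) + G p.1) * (softAcceptDeriv δ (S n p) *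
      deriv φ (p.1 i + stepSize τ n * p.2 i)) with hY
  set Y₀ : ℕ → (ℕ → ℝ) × (ℕ → ℝ) → ℝ := fun n p => D p.1 * softAccept δ (S n p)
    + 2 * (Q p.1 * softAcceptDeriv δ (S n p)) with hY₀
  set Z : ℕ → (ℕ → ℝ) × (ℕ → ℝ) → ℝ := fun n p => |D (X n p) - D p.1| + |Q (X n p) - Q p.1|
    + C₁ * |deriv φ (p.1 i + stepSize τ n * p.2 i) - deriv φ (p.1 i)| with hZ
  set B : (ℕ → ℝ) × (ℕ → ℝ) → ℝ := fun p => 4 * C₁ + C₁ * m (|τ| * p.2 i) with hB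
  have cY : ∀ n, Continuous (Y n) := fun n => by
    have := cψ n; have := cψ' n; have := cX n
    simp only [hY]; fun_prop
  have cY₀ : ∀ n, Continuous (Y₀ n) := fun n => by
    have := cψ n; have := cψ' n
    simp only [hY₀]; fun_prop
  have cZ : ∀ n, Continuous (Z n) := fun n => by
    have := cX n
    simp only [hZ]; fun_prop
  have hBm : MemLp B 2 (joint φ) := by
    have hm2 : MemLp (fun p : (ℕ → ℝ) × (ℕ → ℝ) => m (|τ| * p.2 i)) 2 (joint φ) := by
      have hmc : Continuous fun p : (ℕ → ℝ) × (ℕ → ℝ) => m (|τ| * p.2 i) :=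
        H.continuous_modulus.comp (by fun_prop)
      rw [memLp_two_iff_integrable_sq hmc.aestronglyMeasurable]
      have := H.integrable_scaled |τ| 0 2
      simp only [pow_zero, one_mul] at this
      exact integrable_comp_noise this i
    exact (memLp_const (4 * C₁)).add (hm2.const_mul C₁)
  have hZnn : ∀ n p, 0 ≤ Z n p := fun n p => by simp only [hZ]; positivity
  have hZB : ∀ n p, |Z n p| ≤ B p := by
    intro n p
    rw [abs_of_nonneg (hZnn n p)]
    have h1 : |D (X n p) - D p.1| ≤ 2 * C₁ :=
      (abs_sub _ _).trans (by linarith [(hC₁ (X n p)).2.1, (hC₁ p.1).2.1])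
    have h2 : |Q (X n p) - Q p.1| ≤ 2 * C₁ :=
      (abs_sub _ _).trans (by linarith [(hC₁ (X n p)).2.2, (hC₁ p.1).2.2])
    have h3 := mul_le_mul_of_nonneg_left (H.abs_score_shift_le (τ := τ) n i p) hC₁0
    simp only [hZ, hB]
    linarith
  have hYZ : ∀ n, i < n → ∀ p, |Y n p - Y₀ n p| ≤ Z n p := by
    intro n hn p
    have hXi : X n p i = p.1 i + stepSize τ n * p.2 i := by simp [hX, shift, hn]
    have e : Y n p - Y₀ n p = (D (X n p) - D p.1) * softAccept δ (S n p)
        + (Q (X n p) - Q p.1) * softAcceptDeriv δ (S n p)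
        + (G p.1 * (deriv φ (p.1 i + stepSize τ n * p.2 i) - deriv φ (p.1 i)))
          * softAcceptDeriv δ (S n p) := by
      simp only [hY, hY₀, hQ, hXi]; ring
    rw [e]
    refine (abs_add_le _ _).trans (add_le_add ((abs_add_le _ _).trans (add_le_add ?_ ?_)) ?_)
    · rw [abs_mul]
      exact mul_le_of_le_one_right (abs_nonneg _) (abs_softAccept_le_one hδ _)
    · rw [abs_mul]
      exact mul_le_of_le_one_right (abs_nonneg _) (abs_softAcceptDeriv_le_one hδ _)
    · rw [abs_mul, abs_mul]
      refine (mul_le_of_le_one_right (by positivity) (abs_softAcceptDeriv_le_one hδ _)).trans ?_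
      exact mul_le_mul_of_nonneg_right (hC₁ _).1 (abs_nonneg _)
  have hZm : ∀ n, MemLp (Z n) 2 (joint φ) := fun n =>
    hBm.mono' (cZ n).aestronglyMeasurable (Eventually.of_forall (hZB n))
  have hY₀m : ∀ n, MemLp (Y₀ n) 2 (joint φ) := fun n => by
    refine MemLp.of_bound (cY₀ n).aestronglyMeasurable (3 * C₁) (Eventually.of_forall fun p => ?_)
    simp only [hY₀, Real.norm_eq_abs]
    refine (abs_add_le _ _).trans ?_
    rw [abs_mul, abs_mul, abs_mul, abs_two]
    have h1 := mul_le_mul (hC₁ p.1).2.1 (abs_softAccept_le_one hδ (S n p)) (abs_nonneg _) hC₁0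
    have h2 := mul_le_mul (hC₁ p.1).2.2 (abs_softAcceptDeriv_le_one hδ (S n p)) (abs_nonneg _) hC₁0
    simp only [hQ]
    linarith
  have hYm : ∀ n, i < n → MemLp (Y n) 2 (joint φ) := fun n hn => by
    have hd : MemLp (fun p => Y n p - Y₀ n p) 2 (joint φ) :=
      (hZm n).mono' ((cY n).sub (cY₀ n)).aestronglyMeasurable (Eventually.of_forall (hYZ n hn))
    refine (hd.add (hY₀m n)).ae_eq (Eventually.of_forall fun p => ?_)
    simp
  have hZlim : Tendsto (fun n => ∫ p, Z n p ^ 2 ∂(joint φ)) atTop (𝓝 0) := by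
    suffices hs : Tendsto (fun n => ∫ p, Z n p ^ 2 ∂(joint φ)) atTop
        (𝓝 (∫ _, (0 : ℝ) ∂(joint φ))) by simpa using hs
    refine tendsto_integral_of_dominated_convergence (fun p => B p ^ 2)
      (fun n => ((cZ n).pow 2).aestronglyMeasurable) hBm.integrable_sq
      (fun n => Eventually.of_forall fun p => ?_) (Eventually.of_forall fun p => ?_)
    · rw [Real.norm_of_nonneg (sq_nonneg _), ← sq_abs]
      exact pow_le_pow_left₀ (abs_nonneg _) (hZB n p) 2
    · have hx := tendsto_shift τ p
      have t1 : Tendsto (fun n => |D (X n p) - D p.1|) atTop (𝓝 0) := by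
        simpa using (((cD.tendsto p.1).comp hx).sub_const (D p.1)).abs
      have t2 : Tendsto (fun n => |Q (X n p) - Q p.1|) atTop (𝓝 0) := by
        simpa using (((cQ.tendsto p.1).comp hx).sub_const (Q p.1)).abs
      have t3 : Tendsto (fun n => |deriv φ (p.1 i + stepSize τ n * p.2 i) - deriv φ (p.1 i)|)
          atTop (𝓝 0) := by
        have h1 : Tendsto (fun n => p.1 i + stepSize τ n * p.2 i) atTop (𝓝 (p.1 i)) := by
          simpa using ((tendsto_stepSize τ).mul_const (p.2 i)).const_add (p.1 i)
        simpa using (((cφ.tendsto (p.1 i)).comp h1).sub_const (deriv φ (p.1 i))).abs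
      simpa [hZ] using ((t1.add t2).add (t3.const_mul C₁)).pow 2
  have hhm : ∀ n, MemLp (fun p => h n p.1) 2 (joint φ) := fun n => memLp_comp_fst (hh n)
  have hhC : ∀ n, ∫ p, h n p.1 ^ 2 ∂(joint φ) ≤ C := fun n => by
    rw [integral_comp_fst (h := fun x => h n x ^ 2) (hh n).integrable_sq.1]
    exact hC n
  have hbddm : ∀ {R : (ℕ → ℝ) → ℝ}, Continuous R → (∀ x, |R x| ≤ C₁) → ∀ n,
      MemLp (fun x => h n x * R x) 2 (targetInf φ)
      ∧ ∫ x, (h n x * R x) ^ 2 ∂(targetInf φ) ≤ C₁ ^ 2 * C := by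
    intro R hR hRC n
    have hpt : ∀ x, |h n x * R x| ≤ |C₁ * h n x| := fun x => by
      rw [abs_mul, abs_mul, mul_comm, abs_of_nonneg hC₁0]
      exact mul_le_mul_of_nonneg_right (hRC x) (abs_nonneg _)
    have hmm : MemLp (fun x => h n x * R x) 2 (targetInf φ) :=
      ((hh n).const_mul C₁).mono ((hh n).1.mul hR.aestronglyMeasurable)
        (Eventually.of_forall hpt)
    refine ⟨hmm, ?_⟩
    calc _ ≤ ∫ x, C₁ ^ 2 * h n x ^ 2 ∂(targetInf φ) := by
          refine integral_mono hmm.integrable_sq ((hh n).integrable_sq.const_mul _) fun x => ?_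
          have := pow_le_pow_left₀ (abs_nonneg _) (hpt x) 2
          rw [sq_abs, sq_abs] at this
          simpa only [mul_pow] using this
      _ ≤ _ := by
          rw [integral_const_mul]
          exact mul_le_mul_of_nonneg_left (hC n) (sq_nonneg _)
  have l1 := H.tendsto_integral_weak (τ := τ) (lipschitz_softAccept hδ) (abs_softAccept_le_one hδ)
    (fun n => (hbddm cD (fun x => (hC₁ x).2.1) n).1)
    (fun n => (hbddm cD (fun x => (hC₁ x).2.1) n).2) hlD
  have l2 := H.tendsto_integral_weak (τ := τ) hL (abs_softAcceptDeriv_le_one hδ)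
    (fun n => (hbddm cQ (fun x => (hC₁ x).2.2) n).1)
    (fun n => (hbddm cQ (fun x => (hC₁ x).2.2) n).2) hlG
  rw [H.limMean_softAcceptDeriv hδ] at l2
  -- `softAcceptDeriv` has half the limiting mean of `softAccept`; this cancels the `2` in `Y₀`
  have hY₀lim : Tendsto (fun n => ∫ p, h n p.1 * Y₀ n p ∂(joint φ)) atTop (𝓝 (c * (lD + lG))) := by
    have l3 := l1.add (l2.const_mul 2)
    rw [show c * (lD + lG) = c * lD + 2 * (c / 2 * lG) by ring]
    refine l3.congr fun n => ?_
    have i1 : Integrable (fun p => h n p.1 * D p.1 * softAccept δ (S n p)) (joint φ) := by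
      have := Integrable.bounded_mul ((memLp_comp_fst
        (hbddm cD (fun x => (hC₁ x).2.1) n).1).integrable one_le_two) (cψ n)
        fun p => abs_softAccept_le_one hδ _
      simpa only [mul_comm] using this
    have i2 : Integrable (fun p => h n p.1 * Q p.1 * softAcceptDeriv δ (S n p)) (joint φ) := by
      have := Integrable.bounded_mul ((memLp_comp_fst
        (hbddm cQ (fun x => (hC₁ x).2.2) n).1).integrable one_le_two) (cψ' n)
        fun p => abs_softAcceptDeriv_le_one hδ _
      simpa only [mul_comm] using this
    rw [← integral_const_mul, ← integral_add i1 (i2.const_mul 2)]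
    refine integral_congr_ae (Eventually.of_forall fun p => ?_)
    simp only [hY₀]; ring
  have hdiff : Tendsto (fun n => ∫ p, h n p.1 * (Y n p - Y₀ n p) ∂(joint φ)) atTop (𝓝 0) := by
    have hb : Tendsto (fun n => √C * √(∫ p, Z n p ^ 2 ∂(joint φ))) atTop (𝓝 0) := by
      simpa using hZlim.sqrt.const_mul (√C)
    refine squeeze_zero_norm' ?_ hb
    filter_upwards [eventually_gt_atTop i] with n hn
    have hd : MemLp (fun p => Y n p - Y₀ n p) 2 (joint φ) := (hYm n hn).sub (hY₀m n)
    refine (abs_integral_mul_le (hhm n) hd).trans ?_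
    refine mul_le_mul (Real.sqrt_le_sqrt (hhC n)) (Real.sqrt_le_sqrt
      (integral_mono hd.integrable_sq (hZm n).integrable_sq fun p => ?_))
      (Real.sqrt_nonneg _) (Real.sqrt_nonneg _)
    have := pow_le_pow_left₀ (abs_nonneg _) (hYZ n hn p) 2
    simpa only [sq_abs] using this
  have hlim := (hY₀lim.add hdiff).const_mul τ
  rw [add_zero] at hlim
  refine hlim.congr' ?_
  filter_upwards [eventually_gt_atTop i, eventually_ne_atTop 0] with n hn hn0
  have iY : Integrable (fun p => h n p.1 * Y n p) (joint φ) := (hhm n).integrable_mul (hYm n hn)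
  have iY₀ : Integrable (fun p => h n p.1 * Y₀ n p) (joint φ) := (hhm n).integrable_mul (hY₀m n)
  have eY : (∫ p, h n p.1 * Y₀ n p ∂(joint φ)) + ∫ p, h n p.1 * (Y n p - Y₀ n p) ∂(joint φ)
      = ∫ p, h n p.1 * Y n p ∂(joint φ) := by
    simp only [mul_sub]
    rw [integral_sub iY iY₀]
    ring
  have hbG : ∀ p, |(G (X n p) + G p.1) * softAccept δ (S n p)| ≤ 2 * C₁ := fun p => by
    rw [abs_mul]
    refine (mul_le_of_le_one_right (abs_nonneg _) (abs_softAccept_le_one hδ _)).trans ?_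
    exact (abs_add_le _ _).trans (by linarith [(hC₁ (X n p)).1, (hC₁ p.1).1])
  have cbG : Continuous fun p => (G (X n p) + G p.1) * softAccept δ (S n p) := by
    have := cψ n; have := cX n
    fun_prop
  have iK : Integrable (fun p => h n p.1 * (G (X n p) + G p.1) * softAccept δ (S n p))
      (joint φ) := by
    refine (Integrable.bounded_mul ((hhm n).integrable one_le_two) cbG hbG).congr
      (Eventually.of_forall fun p => ?_)
    simp only; ring
  have iwK : Integrable (fun p => p.2 i * (h n p.1 * (G (X n p) + G p.1) * softAccept δ (S n p)))
      (joint φ) := by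
    refine (Integrable.bounded_mul ((memLp_noise i).integrable_mul (hhm n)) cbG hbG).congr
      (Eventually.of_forall fun p => ?_)
    simp only [Pi.mul_apply]; ring
  have hst := integral_noise_mul (φ := φ) i iK iwK (iY.const_mul (stepSize τ n)) (fun p => by
    have h1 := H.hasDerivAt_comp_logRatio (hasDerivAt_softAccept hδ) (stepSize τ n) hn p
    have h2 := ((T.hasDerivAt_shift (stepSize τ n) hn p).add_const (G p.1)).const_mul (h n p.1)
    refine (h2.mul h1).congr_deriv ?_
    simp only [hY, hS, hX, Function.update_eq_self]
    ring)
  rw [eY]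
  refine Eq.trans ?_ (congrArg (fun r => √(n : ℝ) * r) hst).symm
  rw [integral_const_mul, ← mul_assoc, sqrt_mul_stepSize τ hn0]

end ScoreModulus

/-! ### The lower bound along weakly convergent sequences -/

section L2

variable {φ : ℝ → ℝ} [IsProbabilityMeasure (target φ)]

lemma inner_toLp {h : L2Target φ} {V : (ℕ → ℝ) → ℝ} (hV : MemLp V 2 (targetInf φ)) :
    inner ℝ h (hV.toLp V) = ∫ x, h x * V x ∂(targetInf φ) := by
  rw [L2.inner_def]
  refine integral_congr_ae ?_
  filter_upwards [hV.coeFn_toLp] with x hx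
  rw [hx]
  simp [mul_comm]

lemma integral_sq_eq (h : L2Target φ) : ∫ x, h x ^ 2 ∂(targetInf φ) = ‖h‖ ^ 2 := by
  rw [← real_inner_self_eq_norm_sq, L2.inner_def]
  exact integral_congr_ae (Eventually.of_forall fun x => by simp [sq])

/-- Weakly convergent sequences are bounded. -/
lemma exists_norm_le_of_weak {E : Type*} [NormedAddCommGroup E] [InnerProductSpace ℝ E]
    [CompleteSpace E] {h : E} {hn : ℕ → E}
    (hw : ∀ g, Tendsto (fun n => inner ℝ (hn n) g) atTop (𝓝 (inner ℝ h g))) :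
    ∃ C, ∀ n, ‖hn n‖ ≤ C := by
  obtain ⟨C, hC⟩ := banach_steinhaus (g := fun n => innerSL ℝ (hn n)) fun g => by
    obtain ⟨C, hC⟩ := (hw g).norm.bddAbove_range
    exact ⟨C, fun n => hC ⟨n, rfl⟩⟩
  exact ⟨C, fun n => by simpa using hC n⟩

lemma accRate_pos (φ : ℝ → ℝ) (τ : ℝ) : 0 < accRate φ τ := by
  rw [accRate, integral_pos_iff_support_of_nonneg]
  · have : (Function.support fun s : ℝ => min 1 (Real.exp s)) = Set.univ := by
      ext s
      simpa using (lt_min one_pos (Real.exp_pos s)).ne'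
    simp [this]
  · exact fun s => (lt_min one_pos (Real.exp_pos s)).le
  · refine Integrable.of_bound (by fun_prop) 1 (Eventually.of_forall fun s => ?_)
    rw [Real.norm_of_nonneg (lt_min one_pos (Real.exp_pos s)).le]
    exact min_le_left _ _

lemma abs_accRate_sub_le (φ : ℝ → ℝ) (τ : ℝ) {δ : ℝ} (hδ : 0 < δ) :
    |limMean φ τ (softAccept δ) - accRate φ τ| ≤ √δ / 2 := by
  rw [accRate, limMean, ← integral_sub]
  · refine (abs_integral_le_integral (integrable_const (√δ / 2)) fun s => ?_).trans (by simp)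
    rw [abs_sub_comm, abs_of_nonneg (by linarith [softAccept_le_min hδ s])]
    linarith [min_le_softAccept_add hδ s]
  · exact Integrable.of_bound (lipschitz_softAccept hδ).continuous.aestronglyMeasurable 1
      (Eventually.of_forall fun s => abs_softAccept_le_one hδ s)
  · refine Integrable.of_bound (by fun_prop) 1 (Eventually.of_forall fun s => ?_)
    rw [Real.norm_of_nonneg (lt_min one_pos (Real.exp_pos s)).le]
    exact min_le_left _ _

lemma tendsto_limMean_softAccept (φ : ℝ → ℝ) (τ : ℝ) :
    Tendsto (fun δ => limMean φ τ (softAccept δ)) (𝓝[>] 0) (𝓝 (accRate φ τ)) := by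
  rw [tendsto_iff_norm_sub_tendsto_zero]
  have h : Tendsto (fun δ : ℝ => √δ / 2) (𝓝[>] 0) (𝓝 0) := by
    have : Tendsto (fun δ : ℝ => √δ / 2) (𝓝 0) (𝓝 (√0 / 2)) :=
      (Real.continuous_sqrt.div_const 2).tendsto 0
    simpa using this.mono_left nhdsWithin_le_nhds
  refine squeeze_zero' (Eventually.of_forall fun _ => norm_nonneg _) ?_ h
  filter_upwards [self_mem_nhdsWithin] with δ hδ using abs_accRate_sub_le φ τ hδ

/-- Reversing the proposal turns increments of `h` into sums of values of the test function. -/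
lemma integral_shift_sub_mul (hφ : Continuous φ) {δ : ℝ} (hδ : 0 < δ) (t : ℝ) {n i : ℕ}
    (hi : i < n) {h : (ℕ → ℝ) → ℝ} (hh : MemLp h 2 (targetInf φ))
    {G : (ℕ → ℝ) → ℝ} (hG : Continuous G) {C : ℝ} (hC : ∀ x, |G x| ≤ C) :
    Integrable (fun p => (h (shift t n p) - h p.1) *
        (p.2 i * G p.1 * softAccept δ (logRatio φ t n p))) (joint φ) ∧
    ∫ p, (h (shift t n p) - h p.1) * (p.2 i * G p.1 * softAccept δ (logRatio φ t n p)) ∂(joint φ)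
      = -∫ p, p.2 i * (h p.1 * (G (shift t n p) + G p.1)
        * softAccept δ (logRatio φ t n p)) ∂(joint φ) := by
  have cψ : Continuous fun p => softAccept δ (logRatio φ t n p) :=
    (lipschitz_softAccept hδ).continuous.comp (continuous_logRatio hφ t n)
  have cX := continuous_shift t n
  have hwh : Integrable (fun p => p.2 i * h p.1) (joint φ) :=
    (memLp_noise i).integrable_mul (memLp_comp_fst hh)
  have i0 : Integrable (fun p => (G p.1 * softAccept δ (logRatio φ t n p)) * (p.2 i * h p.1))
      (joint φ) := by
    refine Integrable.bounded_mul hwh (by fun_prop) (C := C) fun p => ?_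
    rw [abs_mul]
    exact (mul_le_of_le_one_right (abs_nonneg _) (abs_softAccept_le_one hδ _)).trans (hC _)
  have i1 : Integrable (fun p => (G (shift t n p) * softAccept δ (logRatio φ t n p))
      * (p.2 i * h p.1)) (joint φ) := by
    refine Integrable.bounded_mul hwh (by fun_prop) (C := C) fun p => ?_
    rw [abs_mul]
    exact (mul_le_of_le_one_right (abs_nonneg _) (abs_softAccept_le_one hδ _)).trans (hC _)
  have e : ∀ p, -((G (shift t n (reversal t n p)) *
      softAccept δ (logRatio φ t n (reversal t n p))) * ((reversal t n p).2 i
        * h (reversal t n p).1)) * Real.exp (logRatio φ t n p)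
      = h (shift t n p) * (p.2 i * G p.1 * softAccept δ (logRatio φ t n p)) := by
    intro p
    have h2 : (reversal t n p).2 i = -p.2 i := by simp [reversal, hi]
    have h1 : (reversal t n p).1 = shift t n p := rfl
    rw [shift_reversal, logRatio_reversal, h2, h1, ← exp_mul_softAccept_neg δ (logRatio φ t n p)]
    ring
  have r1 := integrable_reversal hφ t n i1.neg
  have r2 := integral_reversal hφ t n i1.neg.1
  simp only [Pi.neg_apply, e] at r1 r2
  have e2 : ∀ p : (ℕ → ℝ) × (ℕ → ℝ), (h (shift t n p) - h p.1) *
      (p.2 i * G p.1 * softAccept δ (logRatio φ t n p))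
      = h (shift t n p) * (p.2 i * G p.1 * softAccept δ (logRatio φ t n p))
        - (G p.1 * softAccept δ (logRatio φ t n p)) * (p.2 i * h p.1) := fun p => by ring
  simp only [e2]
  refine ⟨r1.sub i0, ?_⟩
  rw [integral_sub r1 i0, r2, integral_neg, ← neg_add', ← integral_add i1 i0]
  refine congrArg Neg.neg (integral_congr_ae (Eventually.of_forall fun p => ?_))
  simp only; ring

end L2

namespace ScoreModulus

variable {φ m : ℝ → ℝ} (H : ScoreModulus φ m) [IsProbabilityMeasure (target φ)] {τ : ℝ}

include H

/-- The energy of a linear function of the noise, weighted by the acceptance function. -/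
lemma tendsto_integral_linear_sq {δ : ℝ} (hδ : 0 < δ) {N : ℕ} {G : ℕ → (ℕ → ℝ) → ℝ}
    (hG : ∀ i < N, Continuous (G i)) {C : ℝ} (hC : ∀ i < N, ∀ x, |G i x| ≤ C) :
    Tendsto (fun n => ∫ p, (∑ i ∈ Finset.range N, p.2 i * G i p.1) ^ 2
      * softAccept δ (logRatio φ (stepSize τ n) n p) ∂(joint φ)) atTop
      (𝓝 (limMean φ τ (softAccept δ) *
        ∑ i ∈ Finset.range N, ∫ x, G i x ^ 2 ∂(targetInf φ))) := by
  have key : Tendsto (fun n => ∑ i ∈ Finset.range N, ∑ j ∈ Finset.range N,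
      ∫ p, p.2 i * ((G i p.1 * G j p.1) * p.2 j
        * softAccept δ (logRatio φ (stepSize τ n) n p)) ∂(joint φ)) atTop
      (𝓝 (∑ i ∈ Finset.range N, ∑ j ∈ Finset.range N,
        if i = j then limMean φ τ (softAccept δ) * ∫ x, G i x * G j x ∂(targetInf φ) else 0)) := by
    refine tendsto_finsetSum _ fun i hi => tendsto_finsetSum _ fun j hj => ?_
    have hi := hG i (Finset.mem_range.1 hi)
    have hj := hG j (Finset.mem_range.1 hj)
    refine H.tendsto_integral_noise_mul_noise hδ (V := fun x => G i x * G j x) (by fun_prop)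
      (C := C * C) (fun x => ?_) i j
    rename_i hi' hj'
    rw [abs_mul]
    have h1 := hC i (Finset.mem_range.1 hi') x
    exact mul_le_mul h1 (hC j (Finset.mem_range.1 hj') x) (abs_nonneg _) ((abs_nonneg _).trans h1)
  have e : (∑ i ∈ Finset.range N, ∑ j ∈ Finset.range N,
        if i = j then limMean φ τ (softAccept δ) * ∫ x, G i x * G j x ∂(targetInf φ) else 0)
      = limMean φ τ (softAccept δ) * ∑ i ∈ Finset.range N, ∫ x, G i x ^ 2 ∂(targetInf φ) := by
    rw [Finset.mul_sum]
    refine Finset.sum_congr rfl fun i hi => ?_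
    rw [Finset.sum_ite_eq, if_pos hi]
    simp only [sq]
  rw [e] at key
  refine key.congr fun n => ?_
  have cψ := H.continuous_comp_logRatio (τ := τ) (lipschitz_softAccept hδ).continuous n
  have hi : ∀ i ∈ Finset.range N, ∀ j ∈ Finset.range N, Integrable (fun p => p.2 i *
      ((G i p.1 * G j p.1) * p.2 j * softAccept δ (logRatio φ (stepSize τ n) n p))) (joint φ) := by
    intro i hi j hj
    have cGi := hG i (Finset.mem_range.1 hi)
    have cGj := hG j (Finset.mem_range.1 hj)
    have := Integrable.bounded_mul ((memLp_noise (φ := φ) i).integrable_mul (memLp_noise j))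
      (g := fun p => (G i p.1 * G j p.1) * softAccept δ (logRatio φ (stepSize τ n) n p))
      (by fun_prop) (C := C * C) fun p => by
        rw [abs_mul, abs_mul]
        refine (mul_le_of_le_one_right (by positivity) (abs_softAccept_le_one hδ _)).trans ?_
        have h1 := hC i (Finset.mem_range.1 hi) p.1
        exact mul_le_mul h1 (hC j (Finset.mem_range.1 hj) _) (abs_nonneg _)
          ((abs_nonneg _).trans h1)
    refine this.congr (Eventually.of_forall fun p => ?_)
    simp only [Pi.mul_apply]; ring
  have hsum : ∀ i ∈ Finset.range N, (∑ j ∈ Finset.range N, ∫ p, p.2 i *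
      ((G i p.1 * G j p.1) * p.2 j * softAccept δ (logRatio φ (stepSize τ n) n p)) ∂(joint φ))
      = ∫ p, ∑ j ∈ Finset.range N, p.2 i *
      ((G i p.1 * G j p.1) * p.2 j * softAccept δ (logRatio φ (stepSize τ n) n p)) ∂(joint φ) :=
    fun i hi' => (integral_finsetSum _ (hi i hi')).symm
  rw [Finset.sum_congr rfl hsum,
    ← integral_finsetSum _ fun i hi' => integrable_finsetSum _ (hi i hi')]
  refine integral_congr_ae (Eventually.of_forall fun p => ?_)
  simp only
  rw [sq, Finset.sum_mul_sum, Finset.sum_mul]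
  refine Finset.sum_congr rfl fun i _ => ?_
  rw [Finset.sum_mul]
  exact Finset.sum_congr rfl fun j _ => by ring

/-- The energy inequality behind the lower bound, tested against a finite family of test
functions. -/
lemma sq_divergence_le {N : ℕ} {G D : ℕ → (ℕ → ℝ) → ℝ}
    (T : ∀ i < N, IsTest φ i (G i) (D i)) {h : L2Target φ} {hn : ℕ → L2Target φ}
    (hw : ∀ g, Tendsto (fun n => inner ℝ (hn n) g) atTop (𝓝 (inner ℝ h g)))
    {L : ℝ} (hL : 0 ≤ L) (hfreq : ∃ᶠ n in atTop, rwForm φ τ n (hn n) ≤ ENNReal.ofReal L) :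
    τ ^ 2 * accRate φ τ * (∑ i ∈ Finset.range N,
      ∫ x, h x * (D i x + G i x * deriv φ (x i)) ∂(targetInf φ)) ^ 2
      ≤ 2 * L * ∑ i ∈ Finset.range N, ∫ x, G i x ^ 2 ∂(targetInf φ) := by
  set B := ∑ i ∈ Finset.range N,
      ∫ x, h x * (D i x + G i x * deriv φ (x i)) ∂(targetInf φ) with hB
  set E := ∑ i ∈ Finset.range N, ∫ x, G i x ^ 2 ∂(targetInf φ) with hE
  obtain ⟨C₀, hC₀⟩ := exists_norm_le_of_weak hw
  have hC : ∀ n, ∫ x, hn n x ^ 2 ∂(targetInf φ) ≤ C₀ ^ 2 := fun n => by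
    rw [integral_sq_eq]
    exact pow_le_pow_left₀ (norm_nonneg _) (hC₀ n) 2
  obtain ⟨Cb, hCb⟩ : ∃ C, ∀ i < N, ∀ x, |G i x| ≤ C := by
    choose! K hK using fun i hi => (T i hi).bound
    refine ⟨∑ i ∈ Finset.range N, K i, fun i hi x => ((hK i hi x).1).trans ?_⟩
    exact Finset.single_le_sum (f := K)
      (fun j hj => (abs_nonneg _).trans (hK j (Finset.mem_range.1 hj) 0).1) (Finset.mem_range.2 hi)
  have cφ := H.continuous_deriv
  have hbd : ∀ {V : (ℕ → ℝ) → ℝ}, Continuous V → (∃ C, ∀ x, |V x| ≤ C) →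
      MemLp V 2 (targetInf φ) := fun hV ⟨C, hC⟩ =>
    MemLp.of_bound hV.aestronglyMeasurable C (Eventually.of_forall hC)
  have hweak : ∀ {V : (ℕ → ℝ) → ℝ}, MemLp V 2 (targetInf φ) →
      Tendsto (fun n => ∫ x, hn n x * V x ∂(targetInf φ)) atTop
        (𝓝 (∫ x, h x * V x ∂(targetInf φ))) := fun hV => by
    simpa only [inner_toLp] using hw (hV.toLp _)
  -- for fixed `δ` the constant appears squared on the left; one factor cancels after `δ → 0`
  have hdelta : ∀ δ : ℝ, 0 < δ → τ ^ 2 * limMean φ τ (softAccept δ) ^ 2 * B ^ 2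
      ≤ 2 * L * (limMean φ τ (softAccept δ) * E) := by
    intro δ hδ
    set c := limMean φ τ (softAccept δ) with hc
    set ψ : ℕ → (ℕ → ℝ) × (ℕ → ℝ) → ℝ :=
      fun n p => softAccept δ (logRatio φ (stepSize τ n) n p) with hψ
    set X := fun n => shift (stepSize τ n) n with hX
    set v : (ℕ → ℝ) × (ℕ → ℝ) → ℝ := fun p => ∑ i ∈ Finset.range N, p.2 i * G i p.1 with hv
    set a : ℕ → ℝ := fun n : ℕ =>
      √(n : ℝ) * ∫ p, (hn n (X n p) - hn n p.1) * (v p * ψ n p) ∂(joint φ)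
      with ha
    have hm : ∀ n, Measurable (hn n) := fun n => (Lp.stronglyMeasurable (hn n)).measurable
    have hE2 := H.tendsto_integral_linear_sq (τ := τ) hδ (N := N) (G := G)
      (fun i hi => (T i hi).continuous) hCb
    have hcross : Tendsto (fun n : ℕ => ∑ i ∈ Finset.range N, (√(n : ℝ) *
        ∫ p, p.2 i * (hn n p.1 * (G i (X n p) + G i p.1) * ψ n p) ∂(joint φ))) atTop
        (𝓝 (∑ i ∈ Finset.range N, τ * (c *
          ∫ x, h x * (D i x + G i x * deriv φ (x i)) ∂(targetInf φ)))) := by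
      refine tendsto_finsetSum _ fun i hi => ?_
      have Ti := T i (Finset.mem_range.1 hi)
      obtain ⟨K, hK⟩ := Ti.bound
      have cG := Ti.continuous
      have hD := hbd Ti.continuous_deriv ⟨K, fun x => (hK x).2.1⟩
      have hQ : MemLp (fun x => G i x * deriv φ (x i)) 2 (targetInf φ) :=
        hbd (by fun_prop) ⟨K, fun x => (hK x).2.2⟩
      have hlim := H.tendsto_cross (τ := τ) hδ Ti (h := fun n => hn n) (fun n => Lp.memLp (hn n))
        hC (hweak hD) (hweak hQ)
      have e : ∫ x, h x * (D i x + G i x * deriv φ (x i)) ∂(targetInf φ)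
          = (∫ x, h x * D i x ∂(targetInf φ))
            + ∫ x, h x * (G i x * deriv φ (x i)) ∂(targetInf φ) := by
        have i1 : Integrable (fun x => h x * D i x) (targetInf φ) := (Lp.memLp h).integrable_mul hD
        have i2 : Integrable (fun x => h x * (G i x * deriv φ (x i))) (targetInf φ) :=
          (Lp.memLp h).integrable_mul hQ
        rw [← integral_add i1 i2]
        exact integral_congr_ae (Eventually.of_forall fun x => mul_add _ _ _)
      rw [e]
      exact hlim
    have halim : Tendsto a atTop (𝓝 (-(τ * c * B))) := by
      have e : -∑ i ∈ Finset.range N, τ * (c *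
          ∫ x, h x * (D i x + G i x * deriv φ (x i)) ∂(targetInf φ)) = -(τ * c * B) := by
        rw [hB, Finset.mul_sum]
        simp only [mul_assoc]
      rw [← e]
      refine hcross.neg.congr' ?_
      filter_upwards [eventually_ge_atTop N] with n hnN
      have hs : ∀ i ∈ Finset.range N, _ := fun i hi =>
        integral_shift_sub_mul H.continuous hδ (stepSize τ n)
          ((Finset.mem_range.1 hi).trans_le hnN) (Lp.memLp (hn n))
          (T i (Finset.mem_range.1 hi)).continuous (hCb i (Finset.mem_range.1 hi))
      have e2 : ∀ p, (hn n (X n p) - hn n p.1) * (v p * ψ n p) = ∑ i ∈ Finset.range N,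
          (hn n (X n p) - hn n p.1) * (p.2 i * G i p.1 * ψ n p) := fun p => by
        rw [hv, Finset.sum_mul, Finset.mul_sum]
      simp only [ha, e2]
      rw [integral_finsetSum _ fun i hi => (hs i hi).1, Finset.mul_sum, ← Finset.sum_neg_distrib]
      refine Finset.sum_congr rfl fun i hi => ?_
      rw [(hs i hi).2, mul_neg]
    -- Cauchy–Schwarz for the measure with weight `ψ n`
    have hineq : ∃ᶠ n in atTop, a n ^ 2 ≤ 2 * L * ∫ p, v p ^ 2 * ψ n p ∂(joint φ) := by
      refine hfreq.mono fun n hle => ?_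
      have hle' := integral_le_of_rwForm_le H.continuous hδ hL hle
      have mA := memLp_shift_sub_mul H.continuous hδ (stepSize τ n) n (hm n) (Lp.memLp (hn n))
      have cψ := H.continuous_comp_logRatio (τ := τ) (lipschitz_softAccept hδ).continuous n
      have cv : Continuous v := by
        refine continuous_finsetSum _ fun i hi => ?_
        have := (T i (Finset.mem_range.1 hi)).continuous
        fun_prop
      have mv : MemLp v 2 (joint φ) := by
        refine memLp_finsetSum _ fun i hi => ?_
        have cG := (T i (Finset.mem_range.1 hi)).continuous
        refine ((memLp_noise i).const_mul Cb).mono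
          (by fun_prop) (Eventually.of_forall fun p => ?_)
        have h1 := hCb i (Finset.mem_range.1 hi) p.1
        rw [norm_mul, norm_mul, mul_comm]
        exact mul_le_mul_of_nonneg_right (h1.trans (le_abs_self _)) (norm_nonneg _)
      have mB : MemLp (fun p => v p * √(ψ n p)) 2 (joint φ) := by
        refine mv.mono (by fun_prop) (Eventually.of_forall fun p => ?_)
        rw [norm_mul]
        refine mul_le_of_le_one_right (norm_nonneg _) ?_
        rw [Real.norm_of_nonneg (Real.sqrt_nonneg _)]
        exact Real.sqrt_le_one.2 (softAccept_le_one hδ _)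
      have hcs := sq_integral_mul_le mA mB
      have hsq : ∀ p, √(ψ n p) * √(ψ n p) = ψ n p := fun p =>
        Real.mul_self_sqrt (softAccept_pos δ _).le
      have e1 : ∫ p, (hn n (X n p) - hn n p.1) * √(ψ n p) * (v p * √(ψ n p)) ∂(joint φ)
          = ∫ p, (hn n (X n p) - hn n p.1) * (v p * ψ n p) ∂(joint φ) := by
        refine integral_congr_ae (Eventually.of_forall fun p => ?_)
        linear_combination ((hn n (X n p) - hn n p.1) * v p) * hsq p
      have e2 : ∫ p, ((hn n (X n p) - hn n p.1) * √(ψ n p)) ^ 2 ∂(joint φ)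
          = ∫ p, (hn n (X n p) - hn n p.1) ^ 2 * ψ n p ∂(joint φ) := by
        refine integral_congr_ae (Eventually.of_forall fun p => ?_)
        linear_combination (hn n (X n p) - hn n p.1) ^ 2 * hsq p
      have e3 : ∫ p, (v p * √(ψ n p)) ^ 2 ∂(joint φ) = ∫ p, v p ^ 2 * ψ n p ∂(joint φ) := by
        refine integral_congr_ae (Eventually.of_forall fun p => ?_)
        linear_combination v p ^ 2 * hsq p
      have hcs' : (∫ p, (hn n (X n p) - hn n p.1) * (v p * ψ n p) ∂(joint φ)) ^ 2
          ≤ (∫ p, (hn n (X n p) - hn n p.1) ^ 2 * ψ n p ∂(joint φ))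
            * ∫ p, v p ^ 2 * ψ n p ∂(joint φ) := by
        rw [← e1, ← e2, ← e3]; exact hcs
      have hnn : 0 ≤ ∫ p, v p ^ 2 * ψ n p ∂(joint φ) :=
        integral_nonneg fun p => mul_nonneg (sq_nonneg _) (softAccept_pos δ _).le
      calc a n ^ 2 = n * (∫ p, (hn n (X n p) - hn n p.1) * (v p * ψ n p) ∂(joint φ)) ^ 2 := by
            rw [ha, mul_pow, Real.sq_sqrt (Nat.cast_nonneg _)]
        _ ≤ n * ((∫ p, (hn n (X n p) - hn n p.1) ^ 2 * ψ n p ∂(joint φ))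
            * ∫ p, v p ^ 2 * ψ n p ∂(joint φ)) := mul_le_mul_of_nonneg_left hcs' (Nat.cast_nonneg _)
        _ ≤ _ := by
            rw [← mul_assoc]
            exact mul_le_mul_of_nonneg_right hle' hnn
    have := le_of_tendsto_of_tendsto_of_frequently (halim.pow 2) (hE2.const_mul (2 * L)) hineq
    calc _ = (-(τ * c * B)) ^ 2 := by ring
      _ ≤ _ := this
  have hlim1 := tendsto_limMean_softAccept φ τ
  have h0 : τ ^ 2 * accRate φ τ ^ 2 * B ^ 2 ≤ 2 * L * (accRate φ τ * E) := by
    refine le_of_tendsto_of_tendsto (((hlim1.pow 2).const_mul (τ ^ 2)).mul_const (B ^ 2))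
      ((hlim1.mul_const E).const_mul (2 * L)) ?_
    filter_upwards [self_mem_nhdsWithin] with δ hδ using hdelta δ hδ
  have hc := accRate_pos φ τ
  refine le_of_mul_le_mul_left ?_ hc
  calc _ = τ ^ 2 * accRate φ τ ^ 2 * B ^ 2 := by ring
    _ ≤ _ := h0
    _ = _ := by ring

end ScoreModulus

/-! ### Recovery sequences -/

/-- The `i`-th partial derivative of the cylinder function `x ↦ u (x₀, …, x_{N-1})`. -/
def cylGrad {N : ℕ} (u : (Fin N → ℝ) → ℝ) (i : ℕ) (x : ℕ → ℝ) : ℝ :=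
  if hi : i < N then fderiv ℝ u (proj N x) (Pi.single ⟨i, hi⟩ 1) else 0

section CylGrad

variable {N : ℕ} {u : (Fin N → ℝ) → ℝ}

lemma continuous_proj (N : ℕ) : Continuous fun x : ℕ → ℝ => proj N x :=
  continuous_pi fun j => continuous_apply (j : ℕ)

lemma continuous_cylGrad (hu : ContDiff ℝ 1 u) (i : ℕ) : Continuous (cylGrad u i) := by
  unfold cylGrad
  split_ifs with hi
  · exact ((hu.continuous_fderiv (by simp)).comp (continuous_proj N)).clm_apply continuous_const
  · exact continuous_const

lemma exists_abs_cylGrad_le (hu : ContDiff ℝ 1 u) (hs : HasCompactSupport u) :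
    ∃ C, ∀ i x, |cylGrad u i x| ≤ C := by
  obtain ⟨C, hC⟩ := (hs.fderiv (𝕜 := ℝ)).exists_bound_of_continuous
    (hu.continuous_fderiv (by simp))
  have hC0 : 0 ≤ C := (norm_nonneg _).trans (hC 0)
  refine ⟨C, fun i x => ?_⟩
  unfold cylGrad
  split_ifs with hi
  · refine ((fderiv ℝ u (proj N x)).le_opNorm _).trans ?_
    rw [Pi.norm_single, norm_one, mul_one]
    exact hC _
  · simpa using hC0

lemma fderiv_proj_eq_sum (u : (Fin N → ℝ) → ℝ) (x w : ℕ → ℝ) :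
    fderiv ℝ u (proj N x) (proj N w) = ∑ i ∈ Finset.range N, w i * cylGrad u i x := by
  rw [Finset.sum_range]
  conv_lhs => rw [pi_eq_sum_univ (proj N w), map_sum]
  refine Finset.sum_congr rfl fun i _ => ?_
  rw [map_smul, smul_eq_mul]
  have : (fun j => if i = j then (1 : ℝ) else 0) = Pi.single i 1 := by
    ext j
    by_cases h : i = j
    · subst h; simp
    · simp [h]
  rw [this]
  simp [cylGrad, proj]

/-- Difference quotients of a cylinder function along the proposal converge to the directional
derivative. -/
lemma tendsto_sqrt_mul_shift_sub (hu : ContDiff ℝ ∞ u) {τ : ℝ} (hτ : 0 < τ)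
    (p : (ℕ → ℝ) × (ℕ → ℝ)) :
    Tendsto (fun n : ℕ => √(n : ℝ) * (u (proj N (shift (stepSize τ n) n p)) - u (proj N p.1)))
      atTop (𝓝 (τ * ∑ i ∈ Finset.range N, p.2 i * cylGrad u i p.1)) := by
  rw [← fderiv_proj_eq_sum]
  have hd : HasFDerivAt u (fderiv ℝ u (proj N p.1)) (proj N p.1) :=
    (hu.differentiable (by simp) _).hasFDerivAt
  have hl := (hasDerivAt_iff_tendsto_slope_zero.1 (hd.hasLineDerivAt (proj N p.2)))
  simp only [zero_smul, add_zero, zero_add] at hl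
  have ht : Tendsto (stepSize τ) atTop (𝓝[≠] 0) := by
    refine tendsto_nhdsWithin_iff.2 ⟨tendsto_stepSize τ, ?_⟩
    filter_upwards [eventually_ne_atTop 0] with n hn
    have : (0 : ℝ) < n := by positivity
    exact (div_pos hτ (Real.sqrt_pos.2 this)).ne'
  refine ((hl.comp ht).const_mul τ).congr' ?_
  filter_upwards [eventually_ge_atTop N, eventually_ne_atTop 0] with n hn hn0
  have e : proj N (shift (stepSize τ n) n p) = proj N p.1 + stepSize τ n • proj N p.2 := by
    ext j
    simp [proj, shift, j.2.trans_le hn]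
  have h0 : stepSize τ n ≠ 0 := by
    have : (0 : ℝ) < n := by positivity
    exact (div_pos hτ (Real.sqrt_pos.2 this)).ne'
  simp only [Function.comp, smul_eq_mul, e]
  nth_rewrite 1 [← sqrt_mul_stepSize τ hn0]
  rw [mul_assoc, mul_inv_cancel_left₀ h0]

lemma abs_sqrt_mul_shift_sub_le {K : ℝ≥0} (hK : LipschitzWith K u) (τ : ℝ) (n : ℕ)
    (p : (ℕ → ℝ) × (ℕ → ℝ)) :
    |√(n : ℝ) * (u (proj N (shift (stepSize τ n) n p)) - u (proj N p.1))|
      ≤ K * |τ| * ∑ i ∈ Finset.range N, |p.2 i| := by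
  have hS : 0 ≤ ∑ i ∈ Finset.range N, |p.2 i| := Finset.sum_nonneg fun _ _ => abs_nonneg _
  rcases eq_or_ne n 0 with rfl | hn
  · simpa using by positivity
  have h1 := hK.dist_le_mul (proj N (shift (stepSize τ n) n p)) (proj N p.1)
  have h2 : dist (proj N (shift (stepSize τ n) n p)) (proj N p.1)
      ≤ |stepSize τ n| * ∑ i ∈ Finset.range N, |p.2 i| := by
    refine (dist_pi_le_iff (by positivity)).2 fun j => ?_
    have h3 : |p.2 j| ≤ ∑ i ∈ Finset.range N, |p.2 i| :=
      Finset.single_le_sum (f := fun i => |p.2 i|) (fun _ _ => abs_nonneg _)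
        (Finset.mem_range.2 j.2)
    rw [Real.dist_eq]
    by_cases hj : (j : ℕ) < n
    · have : proj N (shift (stepSize τ n) n p) j - proj N p.1 j = stepSize τ n * p.2 j := by
        simp [proj, shift, hj]
      rw [this, abs_mul]
      exact mul_le_mul_of_nonneg_left h3 (abs_nonneg _)
    · have : proj N (shift (stepSize τ n) n p) j - proj N p.1 j = 0 := by
        simp [proj, shift, hj]
      rw [this, abs_zero]
      positivity
  rw [abs_mul, abs_of_nonneg (Real.sqrt_nonneg _), ← Real.dist_eq]
  have h4 : √(n : ℝ) * |stepSize τ n| = |τ| := by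
    nth_rewrite 2 [← sqrt_mul_stepSize τ hn]
    rw [abs_mul, abs_of_nonneg (Real.sqrt_nonneg _)]
  calc _ ≤ √(n : ℝ) * (K * (|stepSize τ n| * ∑ i ∈ Finset.range N, |p.2 i|)) :=
        mul_le_mul_of_nonneg_left (h1.trans (mul_le_mul_of_nonneg_left h2 K.2))
          (Real.sqrt_nonneg _)
    _ = K * (√(n : ℝ) * |stepSize τ n|) * ∑ i ∈ Finset.range N, |p.2 i| := by ring
    _ = _ := by rw [h4]

end CylGrad

namespace ScoreModulus

variable {φ m : ℝ → ℝ} (H : ScoreModulus φ m) [IsProbabilityMeasure (target φ)] {τ : ℝ}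

include H

/-- The forms of a smooth cylinder function are asymptotically bounded by the limiting form. -/
lemma limsup_rwForm_le_of_cylinder (hτ : 0 < τ) {N : ℕ} {u : (Fin N → ℝ) → ℝ}
    (hu : ContDiff ℝ ∞ u) (hs : HasCompactSupport u) {h : L2Target φ}
    (hh : ∀ᵐ x ∂(targetInf φ), h x = u (proj N x)) :
    limsup (fun n => rwForm φ τ n h) atTop ≤ ENNReal.ofReal (1 / 2 * τ ^ 2 * accRate φ τ *
      ∑ i ∈ Finset.range N, ∫ x, cylGrad u i x ^ 2 ∂(targetInf φ)) := by
  obtain ⟨K, hK⟩ := hu.lipschitzWith_of_hasCompactSupport hs (by simp)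
  obtain ⟨Cg, hCg⟩ := exists_abs_cylGrad_le (hu.of_le (by simp)) hs
  have cu : Continuous u := hu.continuous
  have cproj := continuous_proj N
  set E := ∑ i ∈ Finset.range N, ∫ x, cylGrad u i x ^ 2 ∂(targetInf φ) with hE
  set v : (ℕ → ℝ) × (ℕ → ℝ) → ℝ := fun p => ∑ i ∈ Finset.range N, p.2 i * cylGrad u i p.1 with hv
  set R : ℕ → (ℕ → ℝ) × (ℕ → ℝ) → ℝ := fun n p =>
    √(n : ℝ) * (u (proj N (shift (stepSize τ n) n p)) - u (proj N p.1)) with hR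
  set B : (ℕ → ℝ) × (ℕ → ℝ) → ℝ := fun p => K * |τ| * ∑ i ∈ Finset.range N, |p.2 i| with hB
  have cv : Continuous v := by
    refine continuous_finsetSum _ fun i _ => ?_
    have := continuous_cylGrad (hu.of_le (by simp)) i
    fun_prop
  have cR : ∀ n, Continuous (R n) := fun n => by
    have := continuous_shift (stepSize τ n) n
    simp only [hR]; fun_prop
  have mB : MemLp B 2 (joint φ) :=
    (memLp_finsetSum _ fun i _ => (memLp_noise (φ := φ) i).abs).const_mul _
  have hRB : ∀ n p, |R n p| ≤ B p := fun n p => abs_sqrt_mul_shift_sub_le hK τ n p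
  have hRv : ∀ p, Tendsto (fun n => R n p) atTop (𝓝 (τ * v p)) := fun p =>
    tendsto_sqrt_mul_shift_sub hu hτ p
  have mR : ∀ n, MemLp (R n) 2 (joint φ) := fun n =>
    mB.mono' (cR n).aestronglyMeasurable (Eventually.of_forall (hRB n))
  have hvB : ∀ p, |τ * v p| ≤ B p := fun p =>
    le_of_tendsto (hRv p).abs (Eventually.of_forall fun n => hRB n p)
  have mv : MemLp (fun p => τ * v p) 2 (joint φ) :=
    mB.mono' (by fun_prop) (Eventually.of_forall hvB)
  set d : ℕ → ℝ := fun n => ∫ p, |R n p ^ 2 - (τ * v p) ^ 2| ∂(joint φ) with hd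
  set M := ∫ p, (τ * v p) ^ 2 ∂(joint φ) with hM
  have hid : ∀ n, Integrable (fun p => |R n p ^ 2 - (τ * v p) ^ 2|) (joint φ) := fun n =>
    ((mR n).integrable_sq.sub mv.integrable_sq).abs
  have hdlim : Tendsto d atTop (𝓝 0) := by
    suffices hs : Tendsto d atTop (𝓝 (∫ _, (0 : ℝ) ∂(joint φ))) by simpa using hs
    refine tendsto_integral_of_dominated_convergence (fun p => 2 * B p ^ 2)
      (fun n => (hid n).1) (mB.integrable_sq.const_mul 2)
      (fun n => Eventually.of_forall fun p => ?_) (Eventually.of_forall fun p => ?_)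
    · have h1 := pow_le_pow_left₀ (abs_nonneg _) (hRB n p) 2
      have h2 := pow_le_pow_left₀ (abs_nonneg _) (hvB p) 2
      rw [sq_abs] at h1 h2
      rw [Real.norm_of_nonneg (abs_nonneg _), abs_le]
      constructor <;> nlinarith [sq_nonneg (R n p), sq_nonneg (τ * v p)]
    · have := (((hRv p).pow 2).sub_const ((τ * v p) ^ 2)).abs
      rwa [sub_self, abs_zero] at this
  -- `h` is only almost everywhere equal to the cylinder function, also at the proposal (`ae_shift`)
  have hform : ∀ n, rwForm φ τ n h = ENNReal.ofReal (1 / 2 *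
      ∫ p, R n p ^ 2 * min 1 (Real.exp (logRatio φ (stepSize τ n) n p)) ∂(joint φ)) := by
    intro n
    have cS := continuous_logRatio H.continuous (stepSize τ n) n
    have hmin0 : ∀ s : ℝ, 0 < min 1 (Real.exp s) := fun s => lt_min one_pos (Real.exp_pos s)
    have hint : Integrable (fun p => R n p ^ 2 *
        min 1 (Real.exp (logRatio φ (stepSize τ n) n p))) (joint φ) := by
      refine (mR n).integrable_sq.mono' (by have := cR n; fun_prop)
        (Eventually.of_forall fun p => ?_)
      rw [Real.norm_of_nonneg (mul_nonneg (sq_nonneg _) (hmin0 _).le)]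
      exact mul_le_of_le_one_right (sq_nonneg _) (min_le_left _ _)
    rw [rwForm_eq H.continuous, ENNReal.ofReal_mul (by norm_num),
      ofReal_integral_eq_lintegral_ofReal hint
        (Eventually.of_forall fun p => mul_nonneg (sq_nonneg _) (hmin0 _).le)]
    have e : ∀ᵐ p ∂(joint φ), ENNReal.ofReal (R n p ^ 2 *
        min 1 (Real.exp (logRatio φ (stepSize τ n) n p)))
        = (n : ℝ≥0∞) * ENNReal.ofReal ((h (shift (stepSize τ n) n p) - h p.1) ^ 2 *
        min 1 (Real.exp (logRatio φ (stepSize τ n) n p))) := by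
      filter_upwards [ae_shift H.continuous (stepSize τ n) n hh,
        measurePreserving_fst_joint.quasiMeasurePreserving.ae hh] with p h1 h2
      rw [h1, h2, ← ENNReal.ofReal_natCast, ← ENNReal.ofReal_mul (Nat.cast_nonneg _)]
      congr 1
      simp only [hR]
      rw [mul_pow, Real.sq_sqrt (Nat.cast_nonneg _), mul_assoc]
    rw [lintegral_congr_ae e, lintegral_const_mul' _ _ (by simp), ← mul_assoc]
    congr 1
    rw [ENNReal.ofReal_div_of_pos two_pos, ENNReal.ofReal_one, ENNReal.ofReal_ofNat,
      one_div, mul_comm, ENNReal.div_eq_inv_mul, mul_comm]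
  -- the error `√δ / 2` of `softAccept δ` disappears as `δ → 0`
  have hdelta : ∀ δ : ℝ, 0 < δ → limsup (fun n => rwForm φ τ n h) atTop
      ≤ ENNReal.ofReal (1 / 2 * (τ ^ 2 * (limMean φ τ (softAccept δ) * E) + √δ / 2 * M)) := by
    intro δ hδ
    have hE2 := (H.tendsto_integral_linear_sq (τ := τ) hδ (N := N) (G := cylGrad u)
      (fun i _ => continuous_cylGrad (hu.of_le (by simp)) i) (fun i _ => hCg i)).const_mul (τ ^ 2)
    have hb : Tendsto (fun n => 1 / 2 * ((τ ^ 2 * ∫ p, v p ^ 2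
        * softAccept δ (logRatio φ (stepSize τ n) n p) ∂(joint φ) + √δ / 2 * M)
        + (1 + √δ / 2) * d n)) atTop
        (𝓝 (1 / 2 * (τ ^ 2 * (limMean φ τ (softAccept δ) * E) + √δ / 2 * M))) := by
      have := ((hE2.add_const (√δ / 2 * M)).add (hdlim.const_mul (1 + √δ / 2))).const_mul (1 / 2)
      rwa [mul_zero, add_zero] at this
    rw [← ((ENNReal.continuous_ofReal.tendsto _).comp hb).limsup_eq]
    refine limsup_le_limsup (Eventually.of_forall fun n => ?_)
    simp only [hform, Function.comp]
    refine ENNReal.ofReal_le_ofReal (mul_le_mul_of_nonneg_left ?_ (by norm_num))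
    have cS := continuous_logRatio H.continuous (stepSize τ n) n
    have cψ := H.continuous_comp_logRatio (τ := τ) (lipschitz_softAccept hδ).continuous n
    have iv : Integrable (fun p => (τ * v p) ^ 2
        * softAccept δ (logRatio φ (stepSize τ n) n p)) (joint φ) := by
      refine (Integrable.bounded_mul mv.integrable_sq cψ
        fun p => abs_softAccept_le_one hδ _).congr (Eventually.of_forall fun p => mul_comm _ _)
    have iT : Integrable (fun p => ((τ * v p) ^ 2
        * softAccept δ (logRatio φ (stepSize τ n) n p) + √δ / 2 * (τ * v p) ^ 2)
        + (1 + √δ / 2) * |R n p ^ 2 - (τ * v p) ^ 2|) (joint φ) :=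
      (iv.add (mv.integrable_sq.const_mul _)).add ((hid n).const_mul _)
    have hle : ∫ p, R n p ^ 2 * min 1 (Real.exp (logRatio φ (stepSize τ n) n p)) ∂(joint φ)
        ≤ ∫ p, ((τ * v p) ^ 2
        * softAccept δ (logRatio φ (stepSize τ n) n p) + √δ / 2 * (τ * v p) ^ 2)
        + (1 + √δ / 2) * |R n p ^ 2 - (τ * v p) ^ 2| ∂(joint φ) := by
      refine integral_mono_of_nonneg (Eventually.of_forall fun p =>
        mul_nonneg (sq_nonneg _) (lt_min one_pos (Real.exp_pos _)).le) iT
        (Eventually.of_forall fun p => ?_)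
      have h1 := min_le_softAccept_add hδ (logRatio φ (stepSize τ n) n p)
      have h2 := softAccept_le_one hδ (logRatio φ (stepSize τ n) n p)
      have h3 := (softAccept_pos δ (logRatio φ (stepSize τ n) n p)).le
      have h4 := Real.sqrt_nonneg δ
      have h5 : R n p ^ 2 ≤ (τ * v p) ^ 2 + |R n p ^ 2 - (τ * v p) ^ 2| := by
        linarith [le_abs_self (R n p ^ 2 - (τ * v p) ^ 2)]
      have h6 := abs_nonneg (R n p ^ 2 - (τ * v p) ^ 2)
      calc R n p ^ 2 * min 1 (Real.exp (logRatio φ (stepSize τ n) n p))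
          ≤ R n p ^ 2 * (softAccept δ (logRatio φ (stepSize τ n) n p) + √δ / 2) :=
            mul_le_mul_of_nonneg_left h1 (sq_nonneg _)
        _ ≤ ((τ * v p) ^ 2 + |R n p ^ 2 - (τ * v p) ^ 2|)
            * (softAccept δ (logRatio φ (stepSize τ n) n p) + √δ / 2) :=
            mul_le_mul_of_nonneg_right h5 (by positivity)
        _ ≤ _ := by nlinarith
    refine hle.trans (le_of_eq ?_)
    have i2 : Integrable (fun p => √δ / 2 * (τ * v p) ^ 2) (joint φ) :=
      mv.integrable_sq.const_mul _
    have i12 : Integrable (fun p => (τ * v p) ^ 2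
        * softAccept δ (logRatio φ (stepSize τ n) n p) + √δ / 2 * (τ * v p) ^ 2) (joint φ) :=
      iv.add i2
    rw [integral_add i12 ((hid n).const_mul _), integral_add iv i2, integral_const_mul,
      integral_const_mul]
    congr 2
    rw [← integral_const_mul]
    refine integral_congr_ae (Eventually.of_forall fun p => ?_)
    simp only; ring
  have hlim : Tendsto (fun δ : ℝ => ENNReal.ofReal (1 / 2 *
      (τ ^ 2 * (limMean φ τ (softAccept δ) * E) + √δ / 2 * M))) (𝓝[>] 0)
      (𝓝 (ENNReal.ofReal (1 / 2 * (τ ^ 2 * (accRate φ τ * E) + √0 / 2 * M)))) := by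
    refine (ENNReal.continuous_ofReal.tendsto _).comp (Tendsto.const_mul _ (Tendsto.add
      (((tendsto_limMean_softAccept φ τ).mul_const E).const_mul _) ?_))
    exact (((Real.continuous_sqrt.div_const 2).mul_const M).tendsto 0).mono_left
      nhdsWithin_le_nhds
  rw [Real.sqrt_zero, zero_div, zero_mul, add_zero] at hlim
  refine (ge_of_tendsto hlim ?_).trans (le_of_eq (congrArg _ (by ring)))
  filter_upwards [self_mem_nhdsWithin] with δ hδ using hdelta δ hδ

end ScoreModulus

section Energy

variable {φ : ℝ → ℝ} [IsProbabilityMeasure (target φ)]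

lemma lintegral_norm_sq_eq (g : Lp EllTwo 2 (targetInf φ)) :
    ∫⁻ x, ENNReal.ofReal (‖g x‖ ^ 2) ∂(targetInf φ) = ENNReal.ofReal (‖g‖ ^ 2) := by
  have hi : Integrable (fun x => ‖g x‖ ^ 2) (targetInf φ) := (Lp.memLp g).norm.integrable_sq
  rw [← ofReal_integral_eq_lintegral_ofReal hi (Eventually.of_forall fun x => sq_nonneg _),
    ← real_inner_self_eq_norm_sq, L2.inner_def]
  simp only [real_inner_self_eq_norm_sq]

lemma lintegral_norm_sq_of_cylinder {N : ℕ} {u : (Fin N → ℝ) → ℝ}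
    (hu : ContDiff ℝ ∞ u) (hs : HasCompactSupport u) {g : Lp EllTwo 2 (targetInf φ)}
    (hg : ∀ᵐ x ∂(targetInf φ), ∀ i : ℕ, g x i = cylGrad u i x) :
    ∫⁻ x, ENNReal.ofReal (‖g x‖ ^ 2) ∂(targetInf φ)
      = ENNReal.ofReal (∑ i ∈ Finset.range N, ∫ x, cylGrad u i x ^ 2 ∂(targetInf φ)) := by
  obtain ⟨C, hC⟩ := exists_abs_cylGrad_le (hu.of_le (by simp)) hs
  have hi : ∀ i ∈ Finset.range N, Integrable (fun x => cylGrad u i x ^ 2) (targetInf φ) :=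
    fun i _ => (MemLp.of_bound (continuous_cylGrad (hu.of_le (by simp)) i).aestronglyMeasurable C
      (Eventually.of_forall (hC i))).integrable_sq
  rw [← integral_finsetSum _ hi, ofReal_integral_eq_lintegral_ofReal
    (integrable_finsetSum _ hi)
    (Eventually.of_forall fun x => Finset.sum_nonneg fun i _ => sq_nonneg _)]
  refine lintegral_congr_ae ?_
  filter_upwards [hg] with x hx
  congr 1
  have h2 : (0 : ℝ) < ENNReal.toReal 2 := by norm_num
  have := lp.norm_rpow_eq_tsum h2 (g x)
  simp only [ENNReal.toReal_ofNat, Real.rpow_two, Real.norm_eq_abs, sq_abs] at this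
  rw [this, tsum_eq_sum (s := Finset.range N)]
  · exact Finset.sum_congr rfl fun i _ => by rw [hx i]
  · intro i hi
    rw [hx i, cylGrad, dif_neg (by simpa using hi)]
    simp

/-- A diagonal argument: a limsup bound that holds along a dense family passes to the limit. -/
lemma exists_limsup_le_of_tendsto {E : Type*} [TopologicalSpace E] {F : ℕ → E → ℝ≥0∞}
    {u : ℕ → E} {h : E} (hu : Tendsto u atTop (𝓝 h)) {Λ : ℕ → ℝ≥0∞} {l : ℝ≥0∞}
    (hΛ : Tendsto Λ atTop (𝓝 l)) (hfin : ∀ k, Λ k ≠ ⊤)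
    (hF : ∀ k, limsup (fun n => F n (u k)) atTop ≤ Λ k) :
    ∃ hn : ℕ → E, Tendsto hn atTop (𝓝 h) ∧ limsup (fun n => F n (hn n)) atTop ≤ l := by
  have hε : Tendsto (fun k : ℕ => ((k : ℝ≥0∞) + 1)⁻¹) atTop (𝓝 0) := by
    have := (tendsto_add_atTop_iff_nat 1).2 ENNReal.tendsto_inv_nat_nhds_zero
    simpa using this
  have hN : ∀ k, ∃ m, ∀ n ≥ m, F n (u k) ≤ Λ k + ((k : ℝ≥0∞) + 1)⁻¹ := fun k => by
    have hlt : limsup (fun n => F n (u k)) atTop < Λ k + ((k : ℝ≥0∞) + 1)⁻¹ :=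
      (hF k).trans_lt (ENNReal.lt_add_right (hfin k) (by simp))
    obtain ⟨m, hm⟩ := eventually_atTop.1 (eventually_lt_of_limsup_lt hlt)
    exact ⟨m, fun n hn => (hm n hn).le⟩
  choose m hm using hN
  -- the largest index, at most `n`, whose bound is already valid at `n`
  set κ : ℕ → ℕ := fun n => Nat.findGreatest (fun k => m k ≤ n) n with hκ
  have hκt : Tendsto κ atTop atTop := by
    refine tendsto_atTop.2 fun k => ?_
    filter_upwards [eventually_ge_atTop (max k (m k))] with n hn
    exact Nat.le_findGreatest (le_trans (le_max_left _ _) hn) (le_trans (le_max_right _ _) hn)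
  refine ⟨fun n => u (κ n), hu.comp hκt, ?_⟩
  have hl := (hΛ.add hε).comp hκt
  rw [add_zero] at hl
  rw [← hl.limsup_eq]
  refine limsup_le_limsup ?_
  filter_upwards [eventually_ge_atTop (m 0)] with n hn
  exact hm (κ n) n (Nat.findGreatest_spec (P := fun k => m k ≤ n) (Nat.zero_le n) hn)

lemma limitForm_eq (τ : ℝ) {h : L2Target φ} (hh : h ∈ sobolev φ) :
    limitForm φ τ h = ENNReal.ofReal (1 / 2 * τ ^ 2 * accRate φ τ)
      * ENNReal.ofReal (‖grad φ h hh‖ ^ 2) := by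
  rw [limitForm, dif_pos hh, lintegral_norm_sq_eq]

/-- Recovery sequences. Outside the domain of the limiting form there is nothing to show; inside,
they are drawn from the smooth cylinder functions that define the Sobolev space. -/
lemma ScoreModulus.exists_recovery {m : ℝ → ℝ} (H : ScoreModulus φ m) {τ : ℝ} (hτ : 0 < τ)
    (h : L2Target φ) : ∃ hn : ℕ → L2Target φ, Tendsto hn atTop (𝓝 h) ∧
      limsup (fun n => rwForm φ τ n (hn n)) atTop ≤ limitForm φ τ h := by
  by_cases hh : h ∈ sobolev φ
  · obtain ⟨q, hq, hlim⟩ := mem_closure_iff_seq_limit.1 hh.choose_spec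
    have hlim1 := (continuous_fst.tendsto _).comp hlim
    have hlim2 := (continuous_snd.tendsto _).comp hlim
    rw [limitForm_eq τ hh]
    refine exists_limsup_le_of_tendsto (u := fun k => (q k).1)
      (Λ := fun k => ENNReal.ofReal (1 / 2 * τ ^ 2 * accRate φ τ)
        * ENNReal.ofReal (‖(q k).2‖ ^ 2)) hlim1 ?_ (fun k => by finiteness) fun k => ?_
    · exact ENNReal.Tendsto.const_mul
        ((ENNReal.continuous_ofReal.tendsto _).comp (hlim2.norm.pow 2)) (Or.inr (by finiteness))
    · obtain ⟨N, -, u, hu, hs, h1, h2⟩ := hq k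
      have hc := (accRate_pos φ τ).le
      refine (H.limsup_rwForm_le_of_cylinder hτ hu hs h1).trans (le_of_eq ?_)
      rw [ENNReal.ofReal_mul (by positivity), ← lintegral_norm_sq_of_cylinder hu hs h2,
        lintegral_norm_sq_eq]
  · rw [limitForm, dif_neg hh]
    exact ⟨fun _ => h, tendsto_const_nhds, le_top⟩

end Energy

/-! ### Square integrable vector fields -/

section Fields

variable {φ : ℝ → ℝ} [IsProbabilityMeasure (target φ)]

/-- The `i`-th component of a square integrable vector field. -/
def coord (g : Lp EllTwo 2 (targetInf φ)) (i : ℕ) : L2Target φ :=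
  (lp.evalCLM ℝ (fun _ : ℕ => ℝ) 2 i).compLp g

lemma coord_ae (g : Lp EllTwo 2 (targetInf φ)) :
    ∀ᵐ x ∂(targetInf φ), ∀ i, coord g i x = g x i := by
  refine ae_all_iff.2 fun i => ?_
  filter_upwards [(lp.evalCLM ℝ (fun _ : ℕ => ℝ) 2 i).coeFn_compLp g] with x hx using hx

lemma norm_ellTwo_sq (a : EllTwo) : ENNReal.ofReal (‖a‖ ^ 2) = ∑' i, ENNReal.ofReal (a i ^ 2) := by
  have h2 : (0 : ℝ) < ENNReal.toReal 2 := by norm_num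
  have h := lp.hasSum_norm h2 a
  simp only [ENNReal.toReal_ofNat, Real.rpow_two, Real.norm_eq_abs, sq_abs] at h
  rw [← h.tsum_eq, ENNReal.ofReal_tsum_of_nonneg (fun _ => sq_nonneg _) h.summable]

lemma lintegral_sq_eq (f : L2Target φ) :
    ∫⁻ x, ENNReal.ofReal (f x ^ 2) ∂(targetInf φ) = ENNReal.ofReal (‖f‖ ^ 2) := by
  rw [← integral_sq_eq, ofReal_integral_eq_lintegral_ofReal (Lp.memLp f).integrable_sq
    (Eventually.of_forall fun x => sq_nonneg _)]

/-- Parseval: the squared norm of a vector field is the sum of those of its components. -/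
lemma hasSum_coord (g : Lp EllTwo 2 (targetInf φ)) :
    HasSum (fun i => ‖coord g i‖ ^ 2) (‖g‖ ^ 2) := by
  have h : ENNReal.ofReal (‖g‖ ^ 2) = ∑' i, ENNReal.ofReal (‖coord g i‖ ^ 2) := by
    rw [← lintegral_norm_sq_eq]
    simp only [← lintegral_sq_eq, norm_ellTwo_sq]
    rw [lintegral_tsum fun i => ?_]
    · refine tsum_congr fun i => lintegral_congr_ae ?_
      filter_upwards [coord_ae g] with x hx
      rw [hx]
    · have h1 : AEMeasurable (fun x => coord g i x) (targetInf φ) :=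
        (Lp.stronglyMeasurable (coord g i)).measurable.aemeasurable
      refine ((h1.pow_const 2).ennreal_ofReal).congr ?_
      filter_upwards [coord_ae g] with x hx
      rw [hx]
  have hs : Summable fun i => ‖coord g i‖ ^ 2 := by
    have h1 : ∑' i, ENNReal.ofReal (‖coord g i‖ ^ 2) ≠ ⊤ := h ▸ ENNReal.ofReal_ne_top
    have := ENNReal.summable_toReal h1
    simpa only [ENNReal.toReal_ofReal (sq_nonneg _)] using this
  rw [← ENNReal.ofReal_tsum_of_nonneg (fun _ => sq_nonneg _) hs] at h
  rw [(ENNReal.ofReal_eq_ofReal_iff (sq_nonneg _) (tsum_nonneg fun _ => sq_nonneg _)).1 h]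
  exact hs.hasSum

lemma inner_field_eq_sum (g v : Lp EllTwo 2 (targetInf φ)) {N : ℕ} {G : ℕ → (ℕ → ℝ) → ℝ}
    (hv : ∀ᵐ x ∂(targetInf φ), ∀ i, v x i = G i x) (hG : ∀ i, N ≤ i → G i = 0) :
    inner ℝ g v = ∑ i ∈ Finset.range N, ∫ x, coord g i x * G i x ∂(targetInf φ) := by
  have hi : ∀ i ∈ Finset.range N, Integrable (fun x => coord g i x * G i x) (targetInf φ) := by
    intro i _
    have h1 : Integrable (fun x => coord g i x * coord v i x) (targetInf φ) :=
      (Lp.memLp (coord g i)).integrable_mul (Lp.memLp (coord v i))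
    refine h1.congr ?_
    filter_upwards [coord_ae v, hv] with x h2 h3
    rw [h2, h3]
  rw [L2.inner_def, ← integral_finsetSum _ hi]
  refine integral_congr_ae ?_
  filter_upwards [coord_ae g, hv] with x h1 h2
  rw [lp.inner_eq_tsum, tsum_eq_sum (s := Finset.range N)]
  · refine Finset.sum_congr rfl fun i _ => ?_
    rw [h1, h2]
    simp [mul_comm]
  · intro i hi
    rw [h2, hG i (by simpa using hi)]
    simp

/-- Finitely many bounded continuous components define a square integrable vector field. -/
lemma exists_field {N : ℕ} {G : ℕ → (ℕ → ℝ) → ℝ} (hc : ∀ i < N, Continuous (G i))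
    (hb : ∀ i < N, ∃ C, ∀ x, |G i x| ≤ C) (h0 : ∀ i, N ≤ i → G i = 0) :
    ∃ v : Lp EllTwo 2 (targetInf φ), ∀ᵐ x ∂(targetInf φ), ∀ i, v x i = G i x := by
  set V : (ℕ → ℝ) → EllTwo := fun x => ∑ i ∈ Finset.range N, lp.single 2 i (G i x) with hV
  have hm : MemLp V 2 (targetInf φ) := by
    refine memLp_finsetSum _ fun i hi => ?_
    obtain ⟨C, hC⟩ := hb i (Finset.mem_range.1 hi)
    refine MemLp.of_bound (Continuous.aestronglyMeasurable ?_) C (Eventually.of_forall fun x => ?_)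
    · exact (lp.singleContinuousLinearMap ℝ (fun _ : ℕ => ℝ) 2 i).continuous.comp
        (hc i (Finset.mem_range.1 hi))
    · rw [lp.norm_single (by norm_num)]
      exact hC x
  refine ⟨hm.toLp V, ?_⟩
  filter_upwards [hm.coeFn_toLp] with x hx i
  rw [hx, hV]
  have e : (∑ j ∈ Finset.range N, lp.single 2 j (G j x) : EllTwo) i
      = ∑ j ∈ Finset.range N, (lp.single 2 j (G j x) : EllTwo) i := by
    have := map_sum (lp.evalCLM ℝ (fun _ : ℕ => ℝ) 2 i)
      (fun j => (lp.single 2 j (G j x) : EllTwo)) (Finset.range N)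
    exact this
  rw [e]
  by_cases hi : i < N
  · rw [Finset.sum_eq_single i, lp.single_apply_self]
    · intro j _ hj
      exact lp.single_apply_ne _ _ _ hj.symm
    · intro h
      exact absurd (Finset.mem_range.2 hi) h
  · rw [h0 i (not_lt.1 hi)]
    refine Finset.sum_eq_zero fun j hj => lp.single_apply_ne _ _ _ ?_
    have := Finset.mem_range.1 hj
    omega

end Fields

/-! ### Smooth cylinder functions are total -/

/-- Sets depending on finitely many coordinates generate the product sigma-algebra. -/
lemma generateFrom_proj {X : Type*} [MeasurableSpace X] (N₀ : ℕ) :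
    (MeasurableSpace.pi : MeasurableSpace (ℕ → X)) =
    MeasurableSpace.generateFrom
      {s | ∃ N, N₀ ≤ N ∧ ∃ B : Set (Fin N → X), MeasurableSet B ∧ proj N ⁻¹' B = s} := by
  refine le_antisymm (iSup_le fun i => ?_) (MeasurableSpace.generateFrom_le ?_)
  · rintro s ⟨A, hA, rfl⟩
    refine MeasurableSpace.measurableSet_generateFrom ⟨max N₀ (i + 1), le_max_left _ _,
      (fun z => z ⟨i, by omega⟩) ⁻¹' A, measurable_pi_apply _ hA, rfl⟩
  · rintro s ⟨N, -, B, hB, rfl⟩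
    exact measurable_proj N hB

lemma isPiSystem_proj {X : Type*} [MeasurableSpace X] (N₀ : ℕ) : IsPiSystem
    {s | ∃ N, N₀ ≤ N ∧ ∃ B : Set (Fin N → X), MeasurableSet B ∧ proj N ⁻¹' B = s} := by
  have lift : ∀ {N M : ℕ} (h : N ≤ M) {B : Set (Fin N → X)}, MeasurableSet B →
      ∃ B' : Set (Fin M → X), MeasurableSet B' ∧ proj (X := X) M ⁻¹' B' = proj N ⁻¹' B := by
    intro N M h B hB
    refine ⟨(fun z j => z (Fin.castLE h j)) ⁻¹' B, ?_, rfl⟩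
    exact (measurable_pi_lambda _ fun j => measurable_pi_apply (Fin.castLE h j)) hB
  rintro s ⟨N, hN, B, hB, rfl⟩ t ⟨M, -, A, hA, rfl⟩ -
  obtain ⟨B', hB', e1⟩ := lift (le_max_left N M) hB
  obtain ⟨A', hA', e2⟩ := lift (le_max_right N M) hA
  exact ⟨max N M, hN.trans (le_max_left _ _), B' ∩ A', hB'.inter hA', by
    rw [Set.preimage_inter, e1, e2]⟩

section Total

variable {φ : ℝ → ℝ} [IsProbabilityMeasure (target φ)]

/-- A square integrable function that is orthogonal to all smooth compactly supported functions of
`N ≥ N₀` coordinates vanishes. -/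
lemma eq_zero_of_integral_proj_eq_zero (hφ : Continuous φ) (N₀ : ℕ) (h : L2Target φ)
    (hz : ∀ N, N₀ ≤ N → ∀ u : (Fin N → ℝ) → ℝ, ContDiff ℝ ∞ u → HasCompactSupport u →
      ∫ x, h x * u (proj N x) ∂(targetInf φ) = 0) : h = 0 := by
  have hint : Integrable h (targetInf φ) := (Lp.memLp h).integrable one_le_two
  have key : ∀ N, N₀ ≤ N → ∀ B : Set (Fin N → ℝ), MeasurableSet B →
      ∫ x in proj N ⁻¹' B, h x ∂(targetInf φ) = 0 := by
    intro N hN B hB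
    obtain ⟨k, hk, hkb⟩ := exists_marginal (target φ) N hint
    have hd := continuous_density hφ N
    have hdm : Measurable fun z : Fin N → ℝ => ENNReal.ofReal (density φ N z) := by fun_prop
    have hk' : Integrable (fun z => density φ N z * k z) := by
      rw [pi_target hφ, integrable_withDensity_iff_integrable_smul' hdm
        (Eventually.of_forall fun _ => ENNReal.ofReal_lt_top)] at hk
      simpa only [ENNReal.toReal_ofReal (density_pos _ _).le, smul_eq_mul] using hk
    have hae : ∀ᵐ z : Fin N → ℝ, density φ N z * k z = 0 := by
      refine ae_eq_zero_of_integral_contDiff_smul_eq_zero hk'.locallyIntegrable fun u hu hs => ?_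
      have h1 := hkb u hu.continuous.measurable (hs.exists_bound_of_continuous hu.continuous)
      rw [pi_target hφ, integral_withDensity_eq_integral_toReal_smul hdm
        (Eventually.of_forall fun _ => ENNReal.ofReal_lt_top)] at h1
      simp only [ENNReal.toReal_ofReal (density_pos _ _).le, smul_eq_mul] at h1
      have h2 := hz N hN u hu hs
      simp only [smul_eq_mul]
      rw [show (∫ z, u z * (density φ N z * k z)) = ∫ z, density φ N z * (u z * k z) from
        integral_congr_ae (Eventually.of_forall fun z => by simp only; ring), ← h1, ← h2]
      exact integral_congr_ae (Eventually.of_forall fun z => mul_comm _ _)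
    have h3 := hkb (B.indicator 1) (measurable_one.indicator hB)
      ⟨1, fun z => by by_cases hz : z ∈ B <;> simp [hz]⟩
    have h4 : ∫ z, B.indicator 1 z * k z ∂(Measure.pi fun _ : Fin N => target φ) = 0 := by
      rw [pi_target hφ, integral_withDensity_eq_integral_toReal_smul hdm
        (Eventually.of_forall fun _ => ENNReal.ofReal_lt_top)]
      refine integral_eq_zero_of_ae ?_
      filter_upwards [hae] with z hz
      have : k z = 0 := (mul_eq_zero.1 hz).resolve_left (density_pos _ _).ne'
      simp [this]
    rw [← integral_indicator (measurable_proj N hB)]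
    rw [h4] at h3
    rw [← h3]
    refine integral_congr_ae (Eventually.of_forall fun x => ?_)
    by_cases hx : proj N x ∈ B <;> simp [hx]
  have hall : ∀ s : Set (ℕ → ℝ), MeasurableSet s → ∫ x in s, h x ∂(targetInf φ) = 0 := by
    have huniv : ∫ x, h x ∂(targetInf φ) = 0 := by
      simpa using key N₀ le_rfl Set.univ MeasurableSet.univ
    refine MeasurableSpace.induction_on_inter (generateFrom_proj N₀) (isPiSystem_proj N₀)
      (by simp) ?_ ?_ ?_
    · rintro t ⟨N, hN, B, hB, rfl⟩
      exact key N hN B hB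
    · intro t ht h0
      rw [← huniv, ← integral_add_compl ht hint, h0, zero_add]
    · intro f hd hf h0
      rw [integral_iUnion hf hd hint.integrableOn]
      simp [h0]
  rw [Lp.eq_zero_iff_ae_eq_zero]
  exact hint.ae_eq_zero_of_forall_setIntegral_eq_zero fun s hs _ => hall s hs

end Total

/-! ### Weak gradients -/

namespace IsTest

variable {φ : ℝ → ℝ} {i : ℕ} {G D G' D' : (ℕ → ℝ) → ℝ}

lemma zero (φ : ℝ → ℝ) (i : ℕ) : IsTest φ i 0 0 where
  continuous := continuous_const
  continuous_deriv := continuous_const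
  bound := ⟨0, fun x => by simp⟩
  hasDerivAt x := by simpa using hasDerivAt_const (x i) (0 : ℝ)

lemma add (T : IsTest φ i G D) (T' : IsTest φ i G' D') : IsTest φ i (G + G') (D + D') where
  continuous := T.continuous.add T'.continuous
  continuous_deriv := T.continuous_deriv.add T'.continuous_deriv
  bound := by
    obtain ⟨C, hC⟩ := T.bound
    obtain ⟨C', hC'⟩ := T'.bound
    refine ⟨C + C', fun x => ⟨?_, ?_, ?_⟩⟩
    · exact (abs_add_le _ _).trans (add_le_add (hC x).1 (hC' x).1)
    · exact (abs_add_le _ _).trans (add_le_add (hC x).2.1 (hC' x).2.1)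
    · rw [Pi.add_apply, add_mul]
      exact (abs_add_le _ _).trans (add_le_add (hC x).2.2 (hC' x).2.2)
  hasDerivAt x := (T.hasDerivAt x).add (T'.hasDerivAt x)

lemma smul (T : IsTest φ i G D) (c : ℝ) : IsTest φ i (c • G) (c • D) where
  continuous := T.continuous.const_smul c
  continuous_deriv := T.continuous_deriv.const_smul c
  bound := by
    obtain ⟨C, hC⟩ := T.bound
    refine ⟨|c| * C, fun x => ⟨?_, ?_, ?_⟩⟩
    · simpa [abs_mul] using mul_le_mul_of_nonneg_left (hC x).1 (abs_nonneg c)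
    · simpa [abs_mul] using mul_le_mul_of_nonneg_left (hC x).2.1 (abs_nonneg c)
    · simpa [abs_mul, mul_assoc] using mul_le_mul_of_nonneg_left (hC x).2.2 (abs_nonneg c)
  hasDerivAt x := (T.hasDerivAt x).const_smul c

end IsTest

/-- Partial derivatives of a cylinder function, in all coordinates. -/
lemma hasDerivAt_cylinder {N : ℕ} {u : (Fin N → ℝ) → ℝ} (hu : Differentiable ℝ u) (i : ℕ)
    (x : ℕ → ℝ) :
    HasDerivAt (fun s => u (proj N (Function.update x i s))) (cylGrad u i x) (x i) := by
  unfold cylGrad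
  split_ifs with hi
  · have e : ∀ s, proj N (Function.update x i s) = Function.update (proj N x) ⟨i, hi⟩ s := by
      intro s
      ext j
      by_cases hj : (j : ℕ) = i
      · have : j = ⟨i, hi⟩ := Fin.ext hj
        subst this
        simp [proj]
      · have : j ≠ ⟨i, hi⟩ := fun h => hj (by rw [h])
        simp [proj, hj, this]
    simp only [e]
    have h1 : HasFDerivAt u (fderiv ℝ u (proj N x))
        (Function.update (proj N x) ⟨i, hi⟩ (x i)) := by
      have : Function.update (proj N x) ⟨i, hi⟩ (x i) = proj N x := by
        rw [← e, Function.update_eq_self]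
      rw [this]
      exact (hu _).hasFDerivAt
    exact h1.comp_hasDerivAt (x i) (hasDerivAt_update (proj N x) ⟨i, hi⟩ (x i))
  · have e : ∀ s, proj N (Function.update x i s) = proj N x := by
      intro s
      ext j
      have : (j : ℕ) ≠ i := fun h => hi (h ▸ j.2)
      simp [proj, this]
    simp only [e]
    exact hasDerivAt_const _ _

/-- A compactly supported continuously differentiable cylinder function is a test function. -/
lemma IsTest.of_cylinder {φ : ℝ → ℝ} (hφ' : Continuous (deriv φ)) {N : ℕ}
    {u : (Fin N → ℝ) → ℝ} (hu : ContDiff ℝ 1 u) (hs : HasCompactSupport u) {i : ℕ} (hi : i < N) :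
    IsTest φ i (fun x => u (proj N x)) (cylGrad u i) where
  continuous := hu.continuous.comp (continuous_proj N)
  continuous_deriv := continuous_cylGrad hu i
  bound := by
    obtain ⟨C₁, h₁⟩ := hs.exists_bound_of_continuous hu.continuous
    obtain ⟨C₂, h₂⟩ := exists_abs_cylGrad_le hu hs
    have hs' : HasCompactSupport fun z : Fin N → ℝ => u z * deriv φ (z ⟨i, hi⟩) :=
      hs.mul_right
    have hc := hu.continuous
    obtain ⟨C₃, h₃⟩ := hs'.exists_bound_of_continuous (by fun_prop)
    refine ⟨max C₁ (max C₂ C₃), fun x => ⟨?_, ?_, ?_⟩⟩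
    · exact (h₁ (proj N x)).trans (le_max_left _ _)
    · exact (h₂ i x).trans ((le_max_left _ _).trans (le_max_right _ _))
    · exact (h₃ (proj N x)).trans ((le_max_right _ _).trans (le_max_right _ _))
  hasDerivAt := hasDerivAt_cylinder (hu.differentiable one_ne_zero) i

section Weak

variable {φ : ℝ → ℝ} [IsProbabilityMeasure (target φ)]

/-- The pair `(v, d)` consists of a vector field with finitely many nonzero components, all of them
test functions, and of minus its divergence with respect to the target measure. -/
def IsTestField (φ : ℝ → ℝ) [IsProbabilityMeasure (target φ)]
    (p : Lp EllTwo 2 (targetInf φ) × L2Target φ) : Prop :=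
  ∃ (N : ℕ) (G D : ℕ → (ℕ → ℝ) → ℝ), (∀ i, IsTest φ i (G i) (D i)) ∧
    (∀ i, N ≤ i → G i = 0 ∧ D i = 0) ∧
    (∀ᵐ x ∂(targetInf φ), ∀ i, p.1 x i = G i x) ∧
    ∀ᵐ x ∂(targetInf φ), p.2 x = -∑ i ∈ Finset.range N, (D i x + G i x * deriv φ (x i))

lemma sum_range_eq_of_zero {f : ℕ → ℝ} {N M : ℕ} (h : N ≤ M) (h0 : ∀ i, N ≤ i → f i = 0) :
    ∑ i ∈ Finset.range N, f i = ∑ i ∈ Finset.range M, f i :=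
  Finset.sum_subset (Finset.range_mono h) fun i _ hi => h0 i (by simpa using hi)

variable (φ) in
/-- The space of test fields, paired with minus their divergences. -/
def testFields : Submodule ℝ (Lp EllTwo 2 (targetInf φ) × L2Target φ) where
  carrier := {p | IsTestField φ p}
  zero_mem' := by
    refine ⟨0, fun _ => 0, fun _ => 0, fun i => IsTest.zero φ i, fun i _ => ⟨rfl, rfl⟩, ?_, ?_⟩
    · filter_upwards [Lp.coeFn_zero EllTwo 2 (targetInf φ)] with x hx i
      exact congrArg (fun a : EllTwo => a i) hx
    · exact Eventually.of_forall fun x => by simp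
  add_mem' := by
    rintro ⟨v, d⟩ ⟨v', d'⟩ ⟨N, G, D, hT, h0, hv, hd⟩ ⟨N', G', D', hT', h0', hv', hd'⟩
    refine ⟨max N N', fun i => G i + G' i, fun i => D i + D' i, fun i => (hT i).add (hT' i),
      fun i hi => ?_, ?_, ?_⟩
    · obtain ⟨h1, h2⟩ := h0 i ((le_max_left _ _).trans hi)
      obtain ⟨h3, h4⟩ := h0' i ((le_max_right _ _).trans hi)
      simp [h1, h2, h3, h4]
    · filter_upwards [Lp.coeFn_add v v', hv, hv'] with x hx h1 h2 i
      have : (v + v') x i = v x i + v' x i := by rw [hx]; rfl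
      exact this.trans (by rw [h1, h2]; rfl)
    · filter_upwards [Lp.coeFn_add d d', hd, hd'] with x hx h1 h2
      have : (d + d') x = d x + d' x := by rw [hx]; rfl
      refine this.trans ?_
      rw [h1, h2, sum_range_eq_of_zero (le_max_left N N') fun i hi => by simp [h0 i hi],
        sum_range_eq_of_zero (le_max_right N N') fun i hi => by simp [h0' i hi], ← neg_add,
        ← Finset.sum_add_distrib]
      refine congrArg Neg.neg (Finset.sum_congr rfl fun i _ => ?_)
      simp only [Pi.add_apply]; ring
  smul_mem' := by
    rintro c ⟨v, d⟩ ⟨N, G, D, hT, h0, hv, hd⟩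
    refine ⟨N, fun i => c • G i, fun i => c • D i, fun i => (hT i).smul c, fun i hi => ?_, ?_, ?_⟩
    · simp [h0 i hi]
    · filter_upwards [Lp.coeFn_smul c v, hv] with x hx h1 i
      have : (c • v) x i = c * v x i := by rw [hx]; rfl
      exact this.trans (by rw [h1]; rfl)
    · filter_upwards [Lp.coeFn_smul c d, hd] with x hx h1
      have : (c • d) x = c * d x := by rw [hx]; rfl
      refine this.trans ?_
      rw [h1, mul_neg, Finset.mul_sum]
      refine congrArg Neg.neg (Finset.sum_congr rfl fun i _ => ?_)
      simp only [Pi.smul_apply, smul_eq_mul]; ring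

lemma IsTest.memLp {i : ℕ} {G D : (ℕ → ℝ) → ℝ} (T : IsTest φ i G D) :
    MemLp G 2 (targetInf φ) := by
  obtain ⟨C, hC⟩ := T.bound
  exact MemLp.of_bound T.continuous.aestronglyMeasurable C (Eventually.of_forall fun x => (hC x).1)

lemma IsTest.memLp_div (hφ' : Continuous (deriv φ)) {i : ℕ} {G D : (ℕ → ℝ) → ℝ}
    (T : IsTest φ i G D) : MemLp (fun x => D x + G x * deriv φ (x i)) 2 (targetInf φ) := by
  obtain ⟨C, hC⟩ := T.bound
  have h1 := T.continuous
  have h2 := T.continuous_deriv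
  refine MemLp.of_bound (by fun_prop) (C + C) (Eventually.of_forall fun x => ?_)
  exact (abs_add_le _ _).trans (add_le_add (hC x).2.1 (hC x).2.2)

/-- The second component of a test field represents minus the weighted divergence of the first. -/
lemma inner_testField (hφ' : Continuous (deriv φ)) (h : L2Target φ) {N : ℕ}
    {G D : ℕ → (ℕ → ℝ) → ℝ} (hT : ∀ i, IsTest φ i (G i) (D i)) {d : L2Target φ}
    (hd : ∀ᵐ x ∂(targetInf φ), d x
      = -∑ i ∈ Finset.range N, (D i x + G i x * deriv φ (x i))) :
    inner ℝ h d = -∑ i ∈ Finset.range N,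
      ∫ x, h x * (D i x + G i x * deriv φ (x i)) ∂(targetInf φ) := by
  have hi : ∀ i ∈ Finset.range N, Integrable
      (fun x => h x * (D i x + G i x * deriv φ (x i))) (targetInf φ) := fun i _ =>
    (Lp.memLp h).integrable_mul ((hT i).memLp_div hφ')
  rw [L2.inner_def, ← integral_finsetSum _ hi, ← integral_neg]
  refine integral_congr_ae ?_
  filter_upwards [hd] with x hx
  rw [hx, ← Finset.mul_sum]
  simp [mul_comm]

/-- A single test function is a test field. -/
lemma exists_testField (hφ' : Continuous (deriv φ)) {i : ℕ} {G D : (ℕ → ℝ) → ℝ}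
    (T : IsTest φ i G D) : ∃ p ∈ testFields φ,
      (∀ g, inner ℝ g p.1 = ∫ x, coord g i x * G x ∂(targetInf φ)) ∧
      ∀ h : L2Target φ, inner ℝ h p.2
        = -∫ x, h x * (D x + G x * deriv φ (x i)) ∂(targetInf φ) := by
  set G' : ℕ → (ℕ → ℝ) → ℝ := fun j => if j = i then G else 0 with hG'
  set D' : ℕ → (ℕ → ℝ) → ℝ := fun j => if j = i then D else 0 with hD'
  have hT : ∀ j, IsTest φ j (G' j) (D' j) := by
    intro j
    by_cases hj : j = i
    · subst hj; simpa [hG', hD'] using T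
    · simpa [hG', hD', hj] using IsTest.zero φ j
  have h0 : ∀ j, i + 1 ≤ j → G' j = 0 ∧ D' j = 0 := by
    intro j hj
    have : j ≠ i := by omega
    simp [hG', hD', this]
  obtain ⟨v, hv⟩ := exists_field (φ := φ) (N := i + 1) (G := G') (fun j _ => (hT j).continuous)
    (fun j _ => by
      obtain ⟨C, hC⟩ := (hT j).bound
      exact ⟨C, fun x => (hC x).1⟩) (fun j hj => (h0 j hj).1)
  have hm : MemLp (fun x => -∑ j ∈ Finset.range (i + 1), (D' j x + G' j x * deriv φ (x j))) 2
      (targetInf φ) := (memLp_finsetSum _ fun j _ => (hT j).memLp_div hφ').neg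
  have hd := hm.coeFn_toLp
  refine ⟨(v, hm.toLp _), ⟨i + 1, G', D', hT, h0, hv, hd⟩, fun g => ?_, fun h => ?_⟩
  · rw [inner_field_eq_sum g v hv fun j hj => (h0 j hj).1, Finset.sum_eq_single i]
    · simp [hG']
    · intro j _ hj
      simp [hG', hj]
    · simp
  · rw [inner_testField hφ' h hT hd, Finset.sum_eq_single i]
    · simp [hG', hD']
    · intro j _ hj
      simp [hG', hD', hj]
    · simp

/-- Riesz representation of a functional given on a linear relation. -/
lemma exists_riesz {E F : Type*} [NormedAddCommGroup E] [InnerProductSpace ℝ E] [CompleteSpace E]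
    [NormedAddCommGroup F] [InnerProductSpace ℝ F] (A : Submodule ℝ (E × F)) (h : F) {C : ℝ}
    (hC : 0 ≤ C) (hA : ∀ p ∈ A, inner ℝ h p.2 ≤ C * ‖p.1‖) :
    ∃ g : E, ∀ p ∈ A, inner ℝ g p.1 = inner ℝ h p.2 := by
  let f : (E × F) →ₗ.[ℝ] ℝ :=
    ⟨A, ((innerSL ℝ h).toLinearMap.comp (LinearMap.snd ℝ E F)).domRestrict A⟩
  obtain ⟨k, hk, hkN⟩ := exists_extension_of_le_sublinear f (fun p => C * ‖p.1‖)
    (fun c hc p => by simp [norm_smul, abs_of_pos hc]; ring)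
    (fun p q => by
      rw [← mul_add]
      exact mul_le_mul_of_nonneg_left (norm_add_le _ _) hC)
    (fun p => hA p.1 p.2)
  -- the extension does not see the second component, on which the sublinear bound vanishes
  have hk0 : ∀ d : F, k (0, d) = 0 := by
    intro d
    have h1 := hkN (0, d)
    have h2 := hkN (0, -d)
    have h3 : k (0, -d) = -k (0, d) := by rw [← map_neg]; simp
    simp only [norm_zero, mul_zero] at h1 h2
    linarith
  let ℓ : E →L[ℝ] ℝ := (k.comp (LinearMap.inl ℝ E F)).mkContinuous C fun v => by
    have h1 := hkN (v, 0)
    have h2 := hkN (-v, 0)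
    have h3 : k (-v, 0) = -k (v, 0) := by rw [← map_neg]; simp
    simp only [norm_neg] at h1 h2
    rw [Real.norm_eq_abs, abs_le]
    simp only [LinearMap.comp_apply, LinearMap.inl_apply]
    constructor <;> linarith
  refine ⟨(InnerProductSpace.toDual ℝ E).symm ℓ, fun p hp => ?_⟩
  rw [InnerProductSpace.toDual_symm_apply]
  have h1 : k p = k (p.1, 0) + k (0, p.2) := by rw [← map_add]; simp
  have h2 := hk ⟨p, hp⟩
  calc ℓ p.1 = k (p.1, 0) := rfl
    _ = k p := by rw [h1, hk0, add_zero]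
    _ = _ := h2

/-- Integration by parts extends to the closure of the smooth gradients. -/
lemma inner_eq_of_isSobolevGradient (hφ : Differentiable ℝ φ) (hφ' : Continuous (deriv φ))
    {h : L2Target φ} {g : Lp EllTwo 2 (targetInf φ)} (hg : IsSobolevGradient φ h g)
    {p : Lp EllTwo 2 (targetInf φ) × L2Target φ} (hp : p ∈ testFields φ) :
    inner ℝ g p.1 = inner ℝ h p.2 := by
  have hcl : IsClosed {q : L2Target φ × Lp EllTwo 2 (targetInf φ) |
      inner ℝ q.2 p.1 = inner ℝ q.1 p.2} :=
    isClosed_eq (by fun_prop) (by fun_prop)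
  refine (closure_minimal ?_ hcl hg : _)
  rintro ⟨h, g⟩ ⟨M, -, u, hu, hs, hh, hgu⟩
  obtain ⟨N, G, D, hT, h0, hv, hd⟩ := hp
  simp only [Set.mem_ofPred_eq]
  have hgu' : ∀ᵐ x ∂(targetInf φ), ∀ i, g x i = cylGrad u i x := hgu
  have hu1 : ContDiff ℝ 1 u := hu.of_le (by simp)
  rw [inner_field_eq_sum g p.1 hv fun i hi => (h0 i hi).1, inner_testField hφ' h hT hd,
    ← Finset.sum_neg_distrib]
  refine Finset.sum_congr rfl fun i _ => ?_
  obtain ⟨Cu, hCu⟩ := hs.exists_bound_of_continuous hu.continuous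
  obtain ⟨Cg, hCg⟩ := exists_abs_cylGrad_le hu1 hs
  have cu : Continuous fun x : ℕ → ℝ => u (proj M x) := hu.continuous.comp (continuous_proj M)
  have iG : Integrable (G i) (targetInf φ) := (hT i).memLp.integrable one_le_two
  have iK : Integrable (fun x => u (proj M x) * G i x) (targetInf φ) :=
    Integrable.bounded_mul iG cu fun x => hCu (proj M x)
  have i1 : Integrable (fun x => cylGrad u i x * G i x) (targetInf φ) :=
    Integrable.bounded_mul iG (continuous_cylGrad hu1 i) (hCg i)
  have i2 : Integrable (fun x => u (proj M x) * (D i x + G i x * deriv φ (x i)))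
      (targetInf φ) :=
    Integrable.bounded_mul (((hT i).memLp_div hφ').integrable one_le_two) cu
      fun x => hCu (proj M x)
  have key := integral_deriv_add_targetInf_eq_zero hφ i (K := fun x => u (proj M x) * G i x)
    (K' := fun x => cylGrad u i x * G i x + u (proj M x) * D i x) iK
    ((i1.add i2).congr (Eventually.of_forall fun x => by simp only [Pi.add_apply]; ring))
    fun x => by
      have := (hasDerivAt_cylinder (hu1.differentiable one_ne_zero) i x).mul ((hT i).hasDerivAt x)
      refine this.congr_deriv ?_
      simp only [Function.update_eq_self]
  have e1 : ∫ x, coord g i x * G i x ∂(targetInf φ)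
      = ∫ x, cylGrad u i x * G i x ∂(targetInf φ) := by
    refine integral_congr_ae ?_
    filter_upwards [coord_ae g, hgu'] with x h1 h2
    rw [h1, h2]
  have e2 : ∫ x, h x * (D i x + G i x * deriv φ (x i)) ∂(targetInf φ)
      = ∫ x, u (proj M x) * (D i x + G i x * deriv φ (x i)) ∂(targetInf φ) := by
    refine integral_congr_ae ?_
    filter_upwards [hh] with x h1
    rw [show h x = u (proj M x) from h1]
  rw [e1, e2, eq_neg_iff_add_eq_zero, ← integral_add i1 i2, ← key]
  exact integral_congr_ae (Eventually.of_forall fun x => by simp only; ring)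

/-- Test fields are dense, so that a gradient is controlled by its pairings with test fields. -/
lemma norm_le_of_inner_testField_le (hφ : Continuous φ) (hφ' : Continuous (deriv φ))
    {g : Lp EllTwo 2 (targetInf φ)} {C : ℝ} (hC : 0 ≤ C)
    (hg : ∀ p ∈ testFields φ, inner ℝ g p.1 ≤ C * ‖p.1‖) : ‖g‖ ≤ C := by
  set A : Submodule ℝ (Lp EllTwo 2 (targetInf φ)) :=
    (testFields φ).map (LinearMap.fst ℝ _ _) with hA
  have hdense : A.topologicalClosure = ⊤ := by
    rw [Submodule.topologicalClosure_eq_top_iff, Submodule.eq_bot_iff]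
    intro w hw
    have hz : ∀ i, coord w i = 0 := by
      intro i
      refine eq_zero_of_integral_proj_eq_zero hφ (i + 1) _ fun N hN u hu hs => ?_
      obtain ⟨p, hp, hp1, -⟩ := exists_testField hφ'
        (IsTest.of_cylinder hφ' (hu.of_le (by simp)) hs (show i < N by omega))
      rw [← hp1]
      exact (Submodule.mem_orthogonal' A w).1 hw p.1 ⟨p, hp, rfl⟩
    have h1 := hasSum_coord w
    simp only [hz, norm_zero, ne_eq, OfNat.ofNat_ne_zero, not_false_eq_true, zero_pow] at h1
    have h2 := h1.unique hasSum_zero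
    simpa using h2
  have hcl : IsClosed {v : Lp EllTwo 2 (targetInf φ) | inner ℝ g v ≤ C * ‖v‖} :=
    isClosed_le (by fun_prop) (by fun_prop)
  have hsub : (A : Set (Lp EllTwo 2 (targetInf φ))) ⊆ {v | inner ℝ g v ≤ C * ‖v‖} := by
    rintro v ⟨p, hp, rfl⟩
    exact hg p hp
  have hmem : g ∈ closure (A : Set (Lp EllTwo 2 (targetInf φ))) := by
    rw [← Submodule.topologicalClosure_coe, hdense]
    trivial
  have h1 : inner ℝ g g ≤ C * ‖g‖ := closure_minimal hsub hcl hmem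
  rw [real_inner_self_eq_norm_sq, sq] at h1
  rcases (norm_nonneg g).eq_or_lt with h2 | h2
  · rwa [← h2]
  · exact le_of_mul_le_mul_right h1 h2

end Weak

/-! ### Mollification -/

/-- A cutoff function `χ` and a mollifying kernel `ρ` on `ℝ^N`, adapted to the product density: on
the scale of `ρ` the density varies by a factor at most two over the support of `χ`. The gradient
of `χ`, its oscillation on the scale of `ρ` and the mass of `1 - χ` are controlled by `η`. -/
structure IsMollifier (φ : ℝ → ℝ) {N : ℕ} (η : ℝ) (χ ρ : (Fin N → ℝ) → ℝ) : Prop where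
  contDiff_cut : ContDiff ℝ ∞ χ
  compact_cut : HasCompactSupport χ
  cut_nonneg : ∀ x, 0 ≤ χ x
  cut_le_one : ∀ x, χ x ≤ 1
  contDiff_ker : ContDiff ℝ ∞ ρ
  compact_ker : HasCompactSupport ρ
  ker_nonneg : ∀ v, 0 ≤ ρ v
  integral_ker : ∫ v, ρ v = 1
  norm_le : ∀ v, ρ v ≠ 0 → ‖v‖ ≤ η
  density_le : ∀ x ∈ tsupport χ, ∀ z, ρ (z - x) ≠ 0 → density φ N z ≤ 2 * density φ N x
  cut_sub : ∀ x z, ρ (z - x) ≠ 0 → |χ x - χ z| ≤ η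
  grad_cut : ∀ x, ∑ j : Fin N, fderiv ℝ χ x (Pi.single j 1) ^ 2 ≤ η
  mass : ∫ z, (1 - χ z) ^ 2 ∂(Measure.pi fun _ : Fin N => target φ) ≤ η

/-- Wide cutoff functions have small gradients and miss little mass of a given measure. -/
lemma exists_cutoff {N : ℕ} (ν : Measure (Fin N → ℝ)) [IsProbabilityMeasure ν] {η : ℝ}
    (hη : 0 < η) : ∃ χ : (Fin N → ℝ) → ℝ, ContDiff ℝ ∞ χ ∧ HasCompactSupport χ ∧ (∀ x, 0 ≤ χ x) ∧
      (∀ x, χ x ≤ 1) ∧ (∀ x, ∑ j : Fin N, fderiv ℝ χ x (Pi.single j 1) ^ 2 ≤ η) ∧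
      ∫ z, (1 - χ z) ^ 2 ∂ν ≤ η := by
  let b : ContDiffBump (0 : Fin N → ℝ) := ⟨1, 2, one_pos, one_lt_two⟩
  have hb : ContDiff ℝ ∞ b := b.contDiff
  have hbs : HasCompactSupport b := b.hasCompactSupport
  obtain ⟨C, hC⟩ := (hbs.fderiv (𝕜 := ℝ)).exists_bound_of_continuous
    (hb.continuous_fderiv (by simp))
  set c : ℕ → ℝ := fun n => 1 / ((n : ℝ) + 1) with hc
  have hc0 : Tendsto c atTop (𝓝 0) := tendsto_one_div_add_atTop_nhds_zero_nat
  have hcpos : ∀ n, 0 < c n := fun n => by positivity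
  have h1 : ∀ᶠ n in atTop, (N : ℝ) * (c n * C) ^ 2 ≤ η := by
    have : Tendsto (fun n => (N : ℝ) * (c n * C) ^ 2) atTop (𝓝 ((N : ℝ) * (0 * C) ^ 2)) :=
      ((hc0.mul_const C).pow 2).const_mul _
    simp only [zero_mul, ne_eq, OfNat.ofNat_ne_zero, not_false_eq_true, zero_pow, mul_zero] at this
    exact (this.eventually (gt_mem_nhds hη)).mono fun n hn => hn.le
  have h2 : ∀ᶠ n in atTop, ∫ z, (1 - b (c n • z)) ^ 2 ∂ν ≤ η := by
    have : Tendsto (fun n => ∫ z, (1 - b (c n • z)) ^ 2 ∂ν) atTop (𝓝 (∫ _, (0 : ℝ) ∂ν)) := by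
      refine tendsto_integral_of_dominated_convergence (fun _ => 1)
        (fun n => ?_) (integrable_const _) (fun n => Eventually.of_forall fun z => ?_)
        (Eventually.of_forall fun z => ?_)
      · have := b.continuous
        fun_prop
      · have h3 := b.nonneg' (c n • z)
        have h4 := b.le_one (x := c n • z)
        rw [Real.norm_of_nonneg (sq_nonneg _)]
        nlinarith
      · have h3 : Tendsto (fun n => c n • z) atTop (𝓝 0) := by
          simpa using hc0.smul_const z
        have h4 := (((b.continuous.tendsto 0).comp h3).const_sub 1).pow 2
        have h5 : b 0 = 1 := b.one_of_mem_closedBall (by simp [b])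
        simpa [Function.comp_def, h5] using h4
    rw [integral_zero] at this
    exact (this.eventually (gt_mem_nhds hη)).mono fun n hn => hn.le
  obtain ⟨n, hn1, hn2⟩ := (h1.and h2).exists
  refine ⟨fun x => b (c n • x), hb.comp (contDiff_const_smul _), hbs.comp_smul (hcpos n).ne',
    fun x => b.nonneg' _, fun x => b.le_one, fun x => ?_, hn2⟩
  refine le_trans (le_trans (Finset.sum_le_card_nsmul Finset.univ _ ((c n * C) ^ 2) fun j _ => ?_)
    ?_) hn1
  · have hf : fderiv ℝ (fun x => b (c n • x)) x = c n • fderiv ℝ b (c n • x) := fderiv_comp_smul _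
    rw [hf]
    refine sq_le_sq' ?_ ?_ <;>
    · have h3 : |(c n • fderiv ℝ b (c n • x)) (Pi.single j 1)| ≤ c n * C := by
        rw [_root_.smul_apply, smul_eq_mul, abs_mul, abs_of_pos (hcpos n)]
        refine mul_le_mul_of_nonneg_left ?_ (hcpos n).le
        refine ((fderiv ℝ b (c n • x)).le_opNorm _).trans ?_
        rw [Pi.norm_single, norm_one, mul_one]
        exact hC _
      have h4 := abs_le.1 h3
      linarith [h4.1, h4.2]
  · simp

/-- The scale of the kernel is chosen after the cutoff, by uniform continuity of the log-density on
a neighbourhood of its compact support. -/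
lemma exists_isMollifier {φ : ℝ → ℝ} (hφ : Continuous φ) [IsProbabilityMeasure (target φ)]
    (N : ℕ) {η : ℝ} (hη : 0 < η) : ∃ χ ρ : (Fin N → ℝ) → ℝ, IsMollifier φ η χ ρ := by
  obtain ⟨χ, h1, h2, h3, h4, h5, h6⟩ :=
    exists_cutoff (Measure.pi fun _ : Fin N => target φ) hη
  have huc := h2.uniformContinuous_of_continuous h1.continuous
  obtain ⟨ε₁, hε₁, hχ⟩ := Metric.uniformContinuous_iff.1 huc η hη
  set K := Metric.cthickening 1 (tsupport χ) with hK
  have hKc : IsCompact K := IsCompact.cthickening h2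
  have hg : Continuous fun z : Fin N → ℝ => ∑ j, φ (z j) := by fun_prop
  obtain ⟨ε₂, hε₂, hd⟩ := Metric.uniformContinuousOn_iff.1
    (hKc.uniformContinuousOn_of_continuous hg.continuousOn) (Real.log 2) (Real.log_pos one_lt_two)
  set ε := min (min ε₁ ε₂) (min 1 η) with hε
  have hε0 : 0 < ε := lt_min (lt_min hε₁ hε₂) (lt_min one_pos hη)
  let b : ContDiffBump (0 : Fin N → ℝ) := ⟨ε / 2, ε, half_pos hε0, half_lt_self hε0⟩
  have hsupp : ∀ v, b.normed volume v ≠ 0 → ‖v‖ < ε := by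
    intro v hv
    have : v ∈ Function.support (b.normed volume) := hv
    rw [b.support_normed_eq] at this
    simpa using this
  refine ⟨χ, b.normed volume, h1, h2, h3, h4, b.contDiff_normed, b.hasCompactSupport_normed,
    b.nonneg_normed, b.integral_normed, fun v hv => ?_, fun x hx z hz => ?_, fun x z hz => ?_,
    h5, h6⟩
  · exact (hsupp v hv).le.trans ((min_le_right _ _).trans (min_le_right _ _))
  · have hdist : dist z x < ε := by rw [dist_eq_norm]; exact hsupp _ hz
    have hxK : x ∈ K := Metric.self_subset_cthickening _ hx
    have hzK : z ∈ K := Metric.mem_cthickening_of_dist_le z x 1 _ hx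
      (hdist.le.trans ((min_le_right _ _).trans (min_le_left _ _)))
    have h := hd z hzK x hxK (hdist.trans_le ((min_le_left _ _).trans (min_le_right _ _)))
    rw [Real.dist_eq] at h
    have h' := (abs_lt.1 h).2
    rw [density, density, ← Real.exp_log two_pos, ← Real.exp_add, Real.exp_le_exp]
    linarith
  · have hdist : dist x z < ε := by rw [dist_comm, dist_eq_norm]; exact hsupp _ hz
    exact (hχ (hdist.trans_le ((min_le_left _ _).trans (min_le_left _ _)))).le

/-- The mollification, as a function on `ℝ^N`, of the function `b (x₀, …, x_{N-1}) F (x)` on the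
sequence space: `F` is averaged over the remaining coordinates as well. -/
def mollify (φ : ℝ → ℝ) [IsProbabilityMeasure (target φ)] {N : ℕ} (ρ b : (Fin N → ℝ) → ℝ)
    (F : (ℕ → ℝ) → ℝ) (z : Fin N → ℝ) : ℝ :=
  ∫ y, ρ (z - proj N y) * (b (proj N y) / density φ N (proj N y)) * F y ∂(targetInf φ)

section Mollify

variable {φ : ℝ → ℝ} [IsProbabilityMeasure (target φ)] {N : ℕ}

lemma integral_pi_target (hφ : Continuous φ) (G : (Fin N → ℝ) → ℝ) :
    ∫ z, G z ∂(Measure.pi fun _ : Fin N => target φ) = ∫ z, density φ N z * G z := by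
  have hd := continuous_density hφ N
  rw [pi_target hφ, integral_withDensity_eq_integral_toReal_smul (by fun_prop)
    (Eventually.of_forall fun _ => ENNReal.ofReal_lt_top)]
  simp only [ENNReal.toReal_ofReal (density_pos _ _).le, smul_eq_mul]

lemma integrable_pi_target_iff (hφ : Continuous φ) {G : (Fin N → ℝ) → ℝ} :
    Integrable G (Measure.pi fun _ : Fin N => target φ)
      ↔ Integrable fun z => density φ N z * G z := by
  have hd := continuous_density hφ N
  rw [pi_target hφ, integrable_withDensity_iff_integrable_smul' (by fun_prop)
    (Eventually.of_forall fun _ => ENNReal.ofReal_lt_top)]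
  simp only [ENNReal.toReal_ofReal (density_pos _ _).le, smul_eq_mul]

lemma integral_proj (hφ : Continuous φ) {G : (Fin N → ℝ) → ℝ} (hG : Measurable G) :
    ∫ y, G (proj N y) ∂(targetInf φ) = ∫ z, density φ N z * G z := by
  have hp := measurePreserving_proj (target φ) N
  rw [← integral_pi_target hφ, ← hp.map_eq, integral_map hp.aemeasurable hG.aestronglyMeasurable]
  rfl

/-- The mollification is a convolution with an integrable function of compact support. -/
lemma exists_mollify_eq_convolution (hφ : Continuous φ) {b : (Fin N → ℝ) → ℝ} (hb : Continuous b)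
    (hbs : HasCompactSupport b) {F : (ℕ → ℝ) → ℝ} (hF : Integrable F (targetInf φ)) :
    ∃ κ : (Fin N → ℝ) → ℝ, Integrable κ ∧ HasCompactSupport κ ∧
      ∀ ρ : (Fin N → ℝ) → ℝ, Continuous ρ → HasCompactSupport ρ →
        mollify φ ρ b F = convolution κ ρ (ContinuousLinearMap.mul ℝ ℝ) volume := by
  obtain ⟨k, hk, hkb⟩ := exists_marginal (target φ) N hF
  have hd := continuous_density hφ N
  have hd0 : ∀ z, density φ N z ≠ 0 := fun z => (density_pos N z).ne'
  obtain ⟨C, hC⟩ := hbs.exists_bound_of_continuous hb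
  have hk' := (integrable_pi_target_iff hφ).1 hk
  have hw : Continuous fun z => b z / density φ N z := hb.div hd hd0
  have hws : HasCompactSupport fun z => b z / density φ N z := by
    simp only [div_eq_mul_inv]
    exact hbs.mul_right
  refine ⟨fun z => b z * k z, ?_, hbs.mul_right, fun ρ hρ hρs => ?_⟩
  · obtain ⟨C', hC'⟩ := hws.exists_bound_of_continuous hw
    refine (Integrable.bounded_mul hk' hw hC').congr (Eventually.of_forall fun z => ?_)
    have := hd0 z
    simp only
    field_simp
  · ext z
    have h1 := hkb (fun x => ρ (z - x) * (b x / density φ N x)) (by fun_prop) (by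
      have : HasCompactSupport fun x => ρ (z - x) * (b x / density φ N x) := hws.mul_left
      exact this.exists_bound_of_continuous (by fun_prop))
    rw [mollify, convolution_def]
    refine h1.trans ?_
    rw [integral_pi_target hφ]
    refine integral_congr_ae (Eventually.of_forall fun x => ?_)
    have := hd0 x
    simp only [ContinuousLinearMap.mul_apply']
    field_simp

lemma contDiff_mollify (hφ : Continuous φ) {b ρ : (Fin N → ℝ) → ℝ} (hb : Continuous b)
    (hbs : HasCompactSupport b) {F : (ℕ → ℝ) → ℝ} (hF : Integrable F (targetInf φ))
    (hρ : ContDiff ℝ ∞ ρ) (hρs : HasCompactSupport ρ) : ContDiff ℝ ∞ (mollify φ ρ b F) := by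
  obtain ⟨κ, hκ, -, h⟩ := exists_mollify_eq_convolution hφ hb hbs hF
  rw [h ρ hρ.continuous hρs]
  exact hρs.contDiff_convolution_right _ hκ.locallyIntegrable hρ

lemma hasCompactSupport_mollify (hφ : Continuous φ) {b ρ : (Fin N → ℝ) → ℝ} (hb : Continuous b)
    (hbs : HasCompactSupport b) {F : (ℕ → ℝ) → ℝ} (hF : Integrable F (targetInf φ))
    (hρ : Continuous ρ) (hρs : HasCompactSupport ρ) : HasCompactSupport (mollify φ ρ b F) := by
  obtain ⟨κ, -, hκs, h⟩ := exists_mollify_eq_convolution hφ hb hbs hF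
  rw [h ρ hρ hρs]
  exact hκs.convolution _ hρs

lemma fderiv_mollify (hφ : Continuous φ) {b ρ : (Fin N → ℝ) → ℝ} (hb : Continuous b)
    (hbs : HasCompactSupport b) {F : (ℕ → ℝ) → ℝ} (hF : Integrable F (targetInf φ))
    (hρ : ContDiff ℝ ∞ ρ) (hρs : HasCompactSupport ρ) (z e : Fin N → ℝ) :
    fderiv ℝ (mollify φ ρ b F) z e = mollify φ (fun v => fderiv ℝ ρ v e) b F z := by
  obtain ⟨κ, hκ, -, h⟩ := exists_mollify_eq_convolution hφ hb hbs hF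
  have hρ1 : ContDiff ℝ 1 ρ := hρ.of_le (by simp)
  have hρ' := hρ1.continuous_fderiv one_ne_zero
  rw [h ρ hρ.continuous hρs, h (fun v => fderiv ℝ ρ v e) (by fun_prop) (hρs.fderiv_apply ℝ e),
    (hρs.hasFDerivAt_convolution_right _ hκ.locallyIntegrable hρ1 z).fderiv,
    convolution_precompR_apply _ hκ.locallyIntegrable (hρs.fderiv ℝ) hρ']

end Mollify

section MollifyBound

variable {φ : ℝ → ℝ} [IsProbabilityMeasure (target φ)] {N : ℕ}

lemma lintegral_pi_target (hφ : Continuous φ) {G : (Fin N → ℝ) → ℝ≥0∞} (hG : Measurable G) :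
    ∫⁻ z, G z ∂(Measure.pi fun _ : Fin N => target φ)
      = ∫⁻ z, ENNReal.ofReal (density φ N z) * G z := by
  have hd := continuous_density hφ N
  rw [pi_target hφ, lintegral_withDensity_eq_lintegral_mul _ (by fun_prop) hG]
  rfl

namespace IsMollifier

variable {η : ℝ} {χ ρ : (Fin N → ℝ) → ℝ}

omit [IsProbabilityMeasure (target φ)] in
lemma integrable_ker (M : IsMollifier φ η χ ρ) : Integrable ρ :=
  M.contDiff_ker.continuous.integrable_of_hasCompactSupport M.compact_ker

omit [IsProbabilityMeasure (target φ)] in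
lemma integral_ker_sub (M : IsMollifier φ η χ ρ) (z : Fin N → ℝ) : ∫ x, ρ (z - x) = 1 := by
  rw [integral_sub_left_eq_self, M.integral_ker]

/-- Schur's test: mollification is bounded in `L²`, uniformly in the mollifier. -/
lemma integral_mollify_sq_le (M : IsMollifier φ η χ ρ) (hφ : Continuous φ)
    {b : (Fin N → ℝ) → ℝ} (hb : Continuous b) (hbs : tsupport b ⊆ tsupport χ)
    {F : (ℕ → ℝ) → ℝ} (hFm : Measurable F) (hF : MemLp F 2 (targetInf φ)) :
    ∫ y, mollify φ ρ b F (proj N y) ^ 2 ∂(targetInf φ)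
      ≤ 2 * ∫ y, (b (proj N y) * F y) ^ 2 ∂(targetInf φ) := by
  have hd := continuous_density hφ N
  have hd0 : ∀ z, 0 < density φ N z := fun z => density_pos N z
  have hρ := M.contDiff_ker.continuous
  have hbc : HasCompactSupport b := M.compact_cut.of_isClosed_subset (isClosed_tsupport b) hbs
  have hF1 : Integrable F (targetInf φ) := hF.integrable one_le_two
  have hmolc : Continuous (mollify φ ρ b F) :=
    (contDiff_mollify hφ hb hbc hF1 M.contDiff_ker M.compact_ker).continuous
  set Q := tsupport χ with hQ
  have hQm : MeasurableSet Q := (isClosed_tsupport χ).measurableSet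
  set q : (Fin N → ℝ) → ℝ := Q.indicator fun x => (density φ N x)⁻¹ with hq
  have hqm : Measurable q := by
    have : Measurable fun x => (density φ N x)⁻¹ := hd.measurable.inv
    exact this.indicator hQm
  have hq0 : ∀ x, 0 ≤ q x := Set.indicator_nonneg fun x _ => (inv_pos.2 (hd0 x)).le
  obtain ⟨Cq, hCq⟩ : ∃ C, ∀ x, q x ≤ C := by
    obtain ⟨C, hC⟩ := (M.compact_cut : IsCompact Q).exists_bound_of_continuousOn
      (f := fun x => (density φ N x)⁻¹) (hd.inv₀ fun x => (hd0 x).ne').continuousOn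
    refine ⟨max C 0, fun x => ?_⟩
    by_cases hx : x ∈ Q
    · rw [hq, Set.indicator_of_mem hx]
      exact (le_abs_self _).trans ((hC x hx).trans (le_max_left _ _))
    · rw [hq, Set.indicator_of_notMem hx]
      exact le_max_right _ _
  obtain ⟨Cρ, hCρ⟩ := M.compact_ker.exists_bound_of_continuous hρ
  obtain ⟨Cb, hCb⟩ := hbc.exists_bound_of_continuous hb
  -- the kernel relative to the target measure; its mass in `y` is at most one
  set K : (Fin N → ℝ) → (ℕ → ℝ) → ℝ := fun z y => ρ (z - proj N y) * q (proj N y) with hK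
  have hK0 : ∀ z y, 0 ≤ K z y := fun z y => mul_nonneg (M.ker_nonneg _) (hq0 _)
  have hKm : Measurable fun p : (Fin N → ℝ) × (ℕ → ℝ) => K p.1 p.2 := by
    simp only [hK]; fun_prop
  have hKC : ∀ z y, K z y ≤ Cρ * Cq := fun z y =>
    mul_le_mul ((le_abs_self _).trans (hCρ _)) (hCq _) (hq0 _) ((abs_nonneg _).trans (hCρ 0))
  have hKz : ∀ z, Measurable (K z) := fun z => hKm.comp measurable_prodMk_left
  have hK1 : ∀ z, ∫ y, K z y ∂(targetInf φ) ≤ 1 := by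
    intro z
    rw [← M.integral_ker_sub z]
    have hm : Measurable fun x => ρ (z - x) * q x := by fun_prop
    rw [integral_proj hφ hm]
    have hi : Integrable fun x => ρ (z - x) := M.integrable_ker.comp_sub_left z
    refine integral_mono_of_nonneg (Eventually.of_forall fun x =>
      mul_nonneg (hd0 x).le (mul_nonneg (M.ker_nonneg _) (hq0 x))) hi
      (Eventually.of_forall fun x => ?_)
    by_cases hx : x ∈ Q
    · simp only [hq, Set.indicator_of_mem hx]
      have := (hd0 x).ne'
      exact le_of_eq (by field_simp)
    · simp only [hq, Set.indicator_of_notMem hx, mul_zero]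
      exact M.ker_nonneg _
  have hbF : MemLp (fun y => b (proj N y) * F y) 2 (targetInf φ) := by
    refine (hF.const_mul Cb).mono (by fun_prop) (Eventually.of_forall fun y => ?_)
    rw [norm_mul, norm_mul]
    exact mul_le_mul_of_nonneg_right ((hCb _).trans (le_abs_self _)) (norm_nonneg _)
  have hsqrtK : ∀ z, MemLp (fun y => √(K z y)) 2 (targetInf φ) := fun z => by
    refine MemLp.of_bound (hKz z).sqrt.aestronglyMeasurable (√(Cρ * Cq))
      (Eventually.of_forall fun y => ?_)
    rw [Real.norm_of_nonneg (Real.sqrt_nonneg _)]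
    exact Real.sqrt_le_sqrt (hKC z y)
  have hKbF : ∀ z, MemLp (fun y => √(K z y) * (b (proj N y) * F y)) 2 (targetInf φ) := fun z => by
    refine (hbF.const_mul (√(Cρ * Cq))).mono
      ((hKz z).sqrt.aestronglyMeasurable.mul hbF.1) (Eventually.of_forall fun y => ?_)
    rw [norm_mul, norm_mul (√(Cρ * Cq))]
    refine mul_le_mul_of_nonneg_right ?_ (norm_nonneg _)
    rw [Real.norm_of_nonneg (Real.sqrt_nonneg _), Real.norm_of_nonneg (Real.sqrt_nonneg _)]
    exact Real.sqrt_le_sqrt (hKC z y)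
  have hpt : ∀ z, mollify φ ρ b F z ^ 2
      ≤ ∫ y, K z y * (b (proj N y) * F y) ^ 2 ∂(targetInf φ) := by
    intro z
    have h1 := sq_integral_mul_le (hsqrtK z) (hKbF z)
    have e1 : ∫ y, √(K z y) * (√(K z y) * (b (proj N y) * F y)) ∂(targetInf φ)
        = mollify φ ρ b F z := by
      refine integral_congr_ae (Eventually.of_forall fun y => ?_)
      simp only
      rw [← mul_assoc, Real.mul_self_sqrt (hK0 z y)]
      by_cases hy : proj N y ∈ Q
      · simp only [hK, hq, Set.indicator_of_mem hy]
        ring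
      · have : b (proj N y) = 0 := image_eq_zero_of_notMem_tsupport fun h => hy (hbs h)
        simp [this]
    have e2 : ∫ y, √(K z y) ^ 2 ∂(targetInf φ) = ∫ y, K z y ∂(targetInf φ) :=
      integral_congr_ae (Eventually.of_forall fun y => Real.sq_sqrt (hK0 z y))
    have e3 : ∫ y, (√(K z y) * (b (proj N y) * F y)) ^ 2 ∂(targetInf φ)
        = ∫ y, K z y * (b (proj N y) * F y) ^ 2 ∂(targetInf φ) :=
      integral_congr_ae (Eventually.of_forall fun y => by
        simp only
        rw [mul_pow, Real.sq_sqrt (hK0 z y)])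
    rw [e1, e2, e3] at h1
    exact h1.trans (mul_le_of_le_one_left
      (integral_nonneg fun y => mul_nonneg (hK0 z y) (sq_nonneg _)) (hK1 z))
  have hint : ∀ z, Integrable (fun y => K z y * (b (proj N y) * F y) ^ 2) (targetInf φ) := by
    intro z
    refine (hKbF z).integrable_sq.congr (Eventually.of_forall fun y => ?_)
    simp only
    rw [mul_pow, Real.sq_sqrt (hK0 z y)]
  -- Tonelli, with the mass of the kernel in its first variable at most two
  have hcol : ∀ y, ∫⁻ z, ENNReal.ofReal (K z y) ∂(Measure.pi fun _ : Fin N => target φ) ≤ 2 := by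
    intro y
    have hm : Measurable fun z => ENNReal.ofReal (K z y) :=
      (hKm.comp measurable_prodMk_right).ennreal_ofReal
    rw [lintegral_pi_target hφ hm]
    have hi : Integrable fun z => 2 * ρ (z - proj N y) :=
      (M.integrable_ker.comp_sub_right _).const_mul 2
    have h2 : ∫⁻ z, ENNReal.ofReal (2 * ρ (z - proj N y)) = 2 := by
      rw [← ofReal_integral_eq_lintegral_ofReal hi
        (Eventually.of_forall fun z => mul_nonneg two_pos.le (M.ker_nonneg _)),
        integral_const_mul, integral_sub_right_eq_self (fun v => ρ v), M.integral_ker]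
      simp
    rw [← h2]
    refine lintegral_mono fun z => ?_
    simp only
    rw [← ENNReal.ofReal_mul (hd0 z).le]
    refine ENNReal.ofReal_le_ofReal ?_
    by_cases hy : proj N y ∈ Q
    · by_cases hz : ρ (z - proj N y) = 0
      · simp [hK, hz]
      · have h3 := M.density_le _ hy z hz
        simp only [hK, hq, Set.indicator_of_mem hy]
        have h4 : density φ N z * (density φ N (proj N y))⁻¹ ≤ 2 := by
          rw [← div_eq_mul_inv, div_le_iff₀ (hd0 _)]
          exact h3
        calc _ = density φ N z * (density φ N (proj N y))⁻¹ * ρ (z - proj N y) := by ring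
          _ ≤ _ := mul_le_mul_of_nonneg_right h4 (M.ker_nonneg _)
    · simp only [hK, hq, Set.indicator_of_notMem hy, mul_zero]
      exact mul_nonneg two_pos.le (M.ker_nonneg _)
  have hmol2 : Measurable fun z => ENNReal.ofReal (mollify φ ρ b F z ^ 2) := by
    have := hmolc.measurable
    fun_prop
  have hmols : Integrable (fun y => mollify φ ρ b F (proj N y) ^ 2) (targetInf φ) := by
    obtain ⟨C, hC⟩ := (hasCompactSupport_mollify hφ hb hbc hF1 hρ
      M.compact_ker).exists_bound_of_continuous hmolc
    have hc := hmolc.comp (continuous_proj N)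
    exact (MemLp.of_bound (p := 2) hc.aestronglyMeasurable C
      (Eventually.of_forall fun y => hC _)).integrable_sq
  have key : ∫⁻ y, ENNReal.ofReal (mollify φ ρ b F (proj N y) ^ 2) ∂(targetInf φ)
      ≤ 2 * ∫⁻ y, ENNReal.ofReal ((b (proj N y) * F y) ^ 2) ∂(targetInf φ) := by
    have e := (measurePreserving_proj (target φ) N).lintegral_comp hmol2
    have hmb : Measurable fun y => ENNReal.ofReal ((b (proj N y) * F y) ^ 2) := by
      have := hb.measurable
      fun_prop
    calc _ = ∫⁻ z, ENNReal.ofReal (mollify φ ρ b F z ^ 2)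
          ∂(Measure.pi fun _ : Fin N => target φ) := e
      _ ≤ ∫⁻ z, ∫⁻ y, ENNReal.ofReal (K z y) * ENNReal.ofReal ((b (proj N y) * F y) ^ 2)
          ∂(targetInf φ) ∂(Measure.pi fun _ : Fin N => target φ) := by
          refine lintegral_mono fun z => ?_
          refine (ENNReal.ofReal_le_ofReal (hpt z)).trans (le_of_eq ?_)
          rw [ofReal_integral_eq_lintegral_ofReal (hint z)
            (Eventually.of_forall fun y => mul_nonneg (hK0 z y) (sq_nonneg _))]
          simp only [ENNReal.ofReal_mul (hK0 _ _)]
      _ = ∫⁻ y, ∫⁻ z, ENNReal.ofReal (K z y) * ENNReal.ofReal ((b (proj N y) * F y) ^ 2)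
          ∂(Measure.pi fun _ : Fin N => target φ) ∂(targetInf φ) := by
          rw [lintegral_lintegral_swap]
          exact (hKm.ennreal_ofReal.mul (hmb.comp measurable_snd)).aemeasurable
      _ ≤ ∫⁻ y, 2 * ENNReal.ofReal ((b (proj N y) * F y) ^ 2) ∂(targetInf φ) := by
          refine lintegral_mono fun y => ?_
          simp only
          rw [lintegral_mul_const' _ _ ENNReal.ofReal_ne_top]
          exact mul_le_mul_left (hcol y) _
      _ = _ := lintegral_const_mul _ hmb
  rw [← ofReal_integral_eq_lintegral_ofReal hmols (Eventually.of_forall fun _ => sq_nonneg _),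
    ← ofReal_integral_eq_lintegral_ofReal hbF.integrable_sq
      (Eventually.of_forall fun _ => sq_nonneg _), ← ENNReal.ofReal_ofNat 2,
    ← ENNReal.ofReal_mul two_pos.le, ENNReal.ofReal_le_ofReal_iff (mul_nonneg two_pos.le
      (integral_nonneg fun _ => sq_nonneg _))] at key
  exact key

end IsMollifier

end MollifyBound

/-! ### Strong convergence of the mollifications -/

/-- Uniformly bounded linear maps that converge to the identity on a total set do so everywhere. -/
lemma tendsto_of_total {E : Type*} [NormedAddCommGroup E] [InnerProductSpace ℝ E]
    [CompleteSpace E] {T : ℕ → E →ₗ[ℝ] E} {C : ℝ} (hC : 0 ≤ C) (hT : ∀ n x, ‖T n x‖ ≤ C * ‖x‖)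
    {s : Set E} (hs : ∀ x ∈ s, Tendsto (fun n => T n x) atTop (𝓝 x))
    (hs0 : ∀ w : E, (∀ x ∈ s, inner ℝ w x = 0) → w = 0) (x : E) :
    Tendsto (fun n => T n x) atTop (𝓝 x) := by
  have hspan : ∀ x ∈ Submodule.span ℝ s, Tendsto (fun n => T n x) atTop (𝓝 x) := by
    intro x hx
    induction hx using Submodule.span_induction with
    | mem x hx => exact hs x hx
    | zero => simp
    | add x y _ _ hx hy => simpa using hx.add hy
    | smul c x _ hx => simpa using hx.const_smul c
  have hdense : (Submodule.span ℝ s).topologicalClosure = ⊤ := by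
    rw [Submodule.topologicalClosure_eq_top_iff, Submodule.eq_bot_iff]
    exact fun w hw => hs0 w fun x hx =>
      (Submodule.mem_orthogonal' _ w).1 hw x (Submodule.subset_span hx)
  have hx : x ∈ closure (Submodule.span ℝ s : Set E) := by
    rw [← Submodule.topologicalClosure_coe, hdense]
    trivial
  rw [Metric.tendsto_atTop]
  intro ε hε
  obtain ⟨y, hy, hxy⟩ := Metric.mem_closure_iff.1 hx (ε / (2 * (C + 1))) (by positivity)
  obtain ⟨n₀, hn₀⟩ := Metric.tendsto_atTop.1 (hspan y hy) (ε / 2) (half_pos hε)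
  refine ⟨n₀, fun n hn => ?_⟩
  have h1 : dist (T n x) (T n y) ≤ C * dist x y := by
    rw [dist_eq_norm, dist_eq_norm, ← map_sub]
    exact hT n _
  have h2 := hn₀ n hn
  have h3 : dist (T n x) x ≤ dist (T n x) (T n y) + dist (T n y) y + dist y x :=
    dist_triangle4 _ _ _ _
  rw [dist_comm y x] at h3
  rw [lt_div_iff₀ (by positivity)] at hxy
  nlinarith

section

variable {φ : ℝ → ℝ} [IsProbabilityMeasure (target φ)] {N : ℕ}

lemma integrable_mollify_integrand (hφ : Continuous φ) {b ρ : (Fin N → ℝ) → ℝ} (hb : Continuous b)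
    (hbs : HasCompactSupport b) (hρ : Continuous ρ) {F : (ℕ → ℝ) → ℝ}
    (hF : Integrable F (targetInf φ)) (z : Fin N → ℝ) :
    Integrable (fun y => ρ (z - proj N y) * (b (proj N y) / density φ N (proj N y)) * F y)
      (targetInf φ) := by
  have hd := continuous_density hφ N
  have hd0 : ∀ z, density φ N z ≠ 0 := fun z => (density_pos N z).ne'
  have hc : Continuous fun x => ρ (z - x) * (b x / density φ N x) := by
    have : Continuous fun x => b x / density φ N x := hb.div hd hd0
    fun_prop
  have hs : HasCompactSupport fun x => ρ (z - x) * (b x / density φ N x) := by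
    simp only [div_eq_mul_inv]
    exact (hbs.mul_right (f' := fun x => (density φ N x)⁻¹)).mul_left
  obtain ⟨C, hC⟩ := hs.exists_bound_of_continuous hc
  exact Integrable.bounded_mul hF (hc.comp (continuous_proj N)) fun y => hC (proj N y)

lemma mollify_congr {b ρ : (Fin N → ℝ) → ℝ} {F F' : (ℕ → ℝ) → ℝ}
    (h : F =ᵐ[targetInf φ] F') : mollify φ ρ b F = mollify φ ρ b F' := by
  ext z
  refine integral_congr_ae ?_
  filter_upwards [h] with y hy
  rw [hy]

lemma memLp_mollify (hφ : Continuous φ) {b ρ : (Fin N → ℝ) → ℝ} (hb : Continuous b)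
    (hbs : HasCompactSupport b) (hρ : ContDiff ℝ ∞ ρ) (hρs : HasCompactSupport ρ) (F : L2Target φ) :
    MemLp (fun y => mollify φ ρ b F (proj N y)) 2 (targetInf φ) := by
  have hF : Integrable F (targetInf φ) := (Lp.memLp F).integrable one_le_two
  have hc := (contDiff_mollify hφ hb hbs hF hρ hρs).continuous
  obtain ⟨C, hC⟩ := (hasCompactSupport_mollify hφ hb hbs hF hρ.continuous
    hρs).exists_bound_of_continuous hc
  exact MemLp.of_bound (hc.comp (continuous_proj N)).aestronglyMeasurable C
    (Eventually.of_forall fun y => hC _)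

namespace IsMollifier

variable {η : ℝ} {χ ρ : (Fin N → ℝ) → ℝ}

/-- Mollification with the cutoff, as a linear map on `L²`. -/
def toLinearMap (M : IsMollifier φ η χ ρ) (hφ : Continuous φ) : L2Target φ →ₗ[ℝ] L2Target φ where
  toFun F := (memLp_mollify hφ M.contDiff_cut.continuous M.compact_cut M.contDiff_ker
    M.compact_ker F).toLp _
  map_add' F F' := by
    rw [← MemLp.toLp_add]
    refine MemLp.toLp_congr _ _ (Eventually.of_forall fun y => ?_)
    have hi : ∀ F : L2Target φ, _ := fun F => integrable_mollify_integrand hφ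
      M.contDiff_cut.continuous M.compact_cut M.contDiff_ker.continuous
      ((Lp.memLp F).integrable one_le_two) (proj N y)
    simp only [Pi.add_apply]
    rw [mollify_congr (Lp.coeFn_add F F')]
    simp only [mollify, Pi.add_apply, mul_add]
    exact integral_add (hi F) (hi F')
  map_smul' c F := by
    rw [RingHom.id_apply, ← MemLp.toLp_const_smul]
    refine MemLp.toLp_congr _ _ (Eventually.of_forall fun y => ?_)
    simp only [Pi.smul_apply, smul_eq_mul]
    rw [mollify_congr (Lp.coeFn_smul c F)]
    simp only [mollify, Pi.smul_apply, smul_eq_mul]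
    rw [← integral_const_mul]
    exact integral_congr_ae (Eventually.of_forall fun x => by simp only; ring)

lemma toLinearMap_ae (M : IsMollifier φ η χ ρ) (hφ : Continuous φ) (F : L2Target φ) :
    ∀ᵐ y ∂(targetInf φ), M.toLinearMap hφ F y = mollify φ ρ χ F (proj N y) :=
  (memLp_mollify hφ M.contDiff_cut.continuous M.compact_cut M.contDiff_ker M.compact_ker
    F).coeFn_toLp

lemma norm_toLinearMap_le (M : IsMollifier φ η χ ρ) (hφ : Continuous φ) (F : L2Target φ) :
    ‖M.toLinearMap hφ F‖ ≤ 2 * ‖F‖ := by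
  have h1 : ‖M.toLinearMap hφ F‖ ^ 2 ≤ 2 * ‖F‖ ^ 2 := by
    rw [← integral_sq_eq, ← integral_sq_eq]
    have e : ∫ y, M.toLinearMap hφ F y ^ 2 ∂(targetInf φ)
        = ∫ y, mollify φ ρ χ F (proj N y) ^ 2 ∂(targetInf φ) := by
      refine integral_congr_ae ?_
      filter_upwards [M.toLinearMap_ae hφ F] with y hy
      rw [hy]
    rw [e]
    refine (M.integral_mollify_sq_le hφ M.contDiff_cut.continuous subset_rfl
      (Lp.stronglyMeasurable F).measurable (Lp.memLp F)).trans ?_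
    refine mul_le_mul_of_nonneg_left ?_ two_pos.le
    refine integral_mono_of_nonneg (Eventually.of_forall fun _ => sq_nonneg _)
      (Lp.memLp F).integrable_sq (Eventually.of_forall fun y => ?_)
    simp only
    rw [mul_pow]
    exact mul_le_of_le_one_left (sq_nonneg _)
      (pow_le_one₀ (M.cut_nonneg _) (M.cut_le_one _))
  refine le_of_sq_le_sq ?_ (by positivity)
  nlinarith [sq_nonneg ‖F‖]

/-- The mollification of a bounded Lipschitz cylinder function is uniformly close to it, up to the
cutoff. -/
lemma abs_mollify_cylinder_sub_le (M : IsMollifier φ η χ ρ) (hφ : Continuous φ)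
    {u : (Fin N → ℝ) → ℝ} {L : ℝ≥0} (hu : LipschitzWith L u) {B : ℝ} (hB : ∀ x, |u x| ≤ B)
    (z : Fin N → ℝ) :
    |mollify φ ρ χ (fun y => u (proj N y)) z - u z| ≤ (B + L) * η + B * (1 - χ z) := by
  have hd := continuous_density hφ N
  have hd0 : ∀ z, density φ N z ≠ 0 := fun z => (density_pos N z).ne'
  have hρ := M.contDiff_ker.continuous
  have hχ := M.contDiff_cut.continuous
  have cu := hu.continuous
  have hB0 : 0 ≤ B := (abs_nonneg _).trans (hB 0)
  have hiρ : Integrable fun x => ρ (z - x) := M.integrable_ker.comp_sub_left z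
  have e1 : mollify φ ρ χ (fun y => u (proj N y)) z = ∫ x, (χ x * u x) * ρ (z - x) := by
    have hm : Measurable fun x => ρ (z - x) * (χ x / density φ N x) * u x := by
      have : Continuous fun x => χ x / density φ N x := hχ.div hd hd0
      fun_prop
    rw [mollify, integral_proj hφ hm]
    refine integral_congr_ae (Eventually.of_forall fun x => ?_)
    have := hd0 x
    simp only
    field_simp
  have i1 : Integrable fun x => (χ x * u x) * ρ (z - x) := by
    refine Integrable.bounded_mul hiρ (by fun_prop) (C := 1 * B) fun x => ?_
    rw [abs_mul, abs_of_nonneg (M.cut_nonneg x)]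
    exact mul_le_mul (M.cut_le_one x) (hB x) (abs_nonneg _) zero_le_one
  have e2 : u z = ∫ x, u z * ρ (z - x) := by
    rw [integral_const_mul, M.integral_ker_sub, mul_one]
  have e3 : mollify φ ρ χ (fun y => u (proj N y)) z - u z
      = ∫ x, ((χ x * u x) * ρ (z - x) - u z * ρ (z - x)) := by
    rw [integral_sub i1 (hiρ.const_mul _), ← e1, ← e2]
  set c := (B + L) * η + B * (1 - χ z) with hc
  have e4 : c = ∫ x, c * ρ (z - x) := by
    rw [integral_const_mul, M.integral_ker_sub, mul_one]
  rw [e3, e4]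
  refine abs_integral_le_integral (hiρ.const_mul c) fun x => ?_
  rw [← sub_mul, abs_mul, abs_of_nonneg (M.ker_nonneg _)]
  by_cases hx : ρ (z - x) = 0
  · simp [hx]
  refine mul_le_mul_of_nonneg_right ?_ (M.ker_nonneg _)
  have h1 := M.cut_sub x z hx
  have h2 : |u x - u z| ≤ L * η := by
    have := hu.dist_le_mul x z
    rw [Real.dist_eq, dist_comm, dist_eq_norm] at this
    exact this.trans (mul_le_mul_of_nonneg_left (M.norm_le _ hx) L.2)
  have h3 : χ x * u x - u z = (χ x - χ z) * u x + χ z * (u x - u z) + -((1 - χ z) * u z) := by ring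
  have h4 := M.cut_nonneg z
  have h5 := M.cut_le_one z
  rw [h3]
  refine (abs_add_three _ _ _).trans ?_
  rw [abs_neg, abs_mul, abs_mul, abs_mul, abs_of_nonneg h4, abs_of_nonneg (sub_nonneg.2 h5)]
  have h6 := mul_le_mul h1 (hB x) (abs_nonneg _) ((abs_nonneg _).trans h1)
  have h7 : χ z * |u x - u z| ≤ L * η := (mul_le_of_le_one_left (abs_nonneg _) h5).trans h2
  have h8 := mul_le_mul_of_nonneg_left (hB z) (sub_nonneg.2 h5)
  rw [hc]
  linarith

lemma norm_toLinearMap_cylinder_sub_le (M : IsMollifier φ η χ ρ) (hφ : Continuous φ)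
    {u : (Fin N → ℝ) → ℝ} {L : ℝ≥0} (hu : LipschitzWith L u) {B : ℝ} (hB : ∀ x, |u x| ≤ B)
    {F : L2Target φ} (hF : ∀ᵐ y ∂(targetInf φ), F y = u (proj N y)) :
    ‖M.toLinearMap hφ F - F‖ ^ 2 ≤ 2 * ((B + L) * η) ^ 2 + 2 * B ^ 2 * η := by
  have hp := measurePreserving_proj (target φ) N
  have hχ := M.contDiff_cut.continuous
  have hi : Integrable (fun y => (1 - χ (proj N y)) ^ 2) (targetInf φ) := by
    have hc : Continuous fun y => (1 - χ (proj N y)) := by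
      have := continuous_proj N
      fun_prop
    refine (MemLp.of_bound (p := 2) hc.aestronglyMeasurable 1
      (Eventually.of_forall fun y => ?_)).integrable_sq
    have h4 := M.cut_nonneg (proj N y)
    have h5 := M.cut_le_one (proj N y)
    rw [Real.norm_of_nonneg (by linarith)]
    linarith
  have hmass : ∫ y, (1 - χ (proj N y)) ^ 2 ∂(targetInf φ) ≤ η := by
    refine le_trans (le_of_eq ?_) M.mass
    have hm : Measurable fun z => (1 - χ z) ^ 2 := by
      have := hχ.measurable
      fun_prop
    rw [← hp.map_eq, integral_map hp.aemeasurable hm.aestronglyMeasurable]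
    rfl
  rw [← integral_sq_eq]
  calc _ ≤ ∫ y, (2 * ((B + L) * η) ^ 2 + 2 * B ^ 2 * (1 - χ (proj N y)) ^ 2) ∂(targetInf φ) := by
        refine integral_mono_ae (Lp.memLp _).integrable_sq
          ((integrable_const _).add (hi.const_mul _)) ?_
        filter_upwards [Lp.coeFn_sub (M.toLinearMap hφ F) F, M.toLinearMap_ae hφ F, hF]
          with y h1 h2 h3
        rw [h1, Pi.sub_apply, h2, h3, mollify_congr hF, ← sq_abs]
        have h := M.abs_mollify_cylinder_sub_le hφ hu hB (proj N y)
        have h' := pow_le_pow_left₀ (abs_nonneg _) h 2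
        nlinarith [sq_nonneg ((B + L) * η - B * (1 - χ (proj N y)))]
    _ = 2 * ((B + L) * η) ^ 2 + 2 * B ^ 2 * ∫ y, (1 - χ (proj N y)) ^ 2 ∂(targetInf φ) := by
        rw [integral_add (integrable_const _) (hi.const_mul _), integral_const,
          integral_const_mul (2 * B ^ 2)]
        simp
    _ ≤ _ := by
        have := mul_le_mul_of_nonneg_left hmass (show 0 ≤ 2 * B ^ 2 by positivity)
        linarith

end IsMollifier

/-- Mollifications along vanishing scales and growing numbers of coordinates converge strongly. -/
lemma tendsto_toLinearMap (hφ : Continuous φ) {χ ρ : ∀ N : ℕ, (Fin N → ℝ) → ℝ}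
    (M : ∀ N : ℕ, IsMollifier φ (1 / ((N : ℝ) + 1)) (χ N) (ρ N)) (F : L2Target φ) :
    Tendsto (fun N => (M N).toLinearMap hφ F) atTop (𝓝 F) := by
  refine tendsto_of_total (s := {F : L2Target φ | ∃ (N₀ : ℕ) (u : (Fin N₀ → ℝ) → ℝ),
    ContDiff ℝ ∞ u ∧ HasCompactSupport u ∧ ∀ᵐ y ∂(targetInf φ), F y = u (proj N₀ y)}) two_pos.le
    (fun N F => (M N).norm_toLinearMap_le hφ F) ?_ ?_ F
  · rintro F ⟨N₀, u, hu, hs, hF⟩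
    obtain ⟨L, hL⟩ := hu.lipschitzWith_of_hasCompactSupport hs (by simp)
    obtain ⟨B, hB⟩ := hs.exists_bound_of_continuous hu.continuous
    have hη : Tendsto (fun N : ℕ => 1 / ((N : ℝ) + 1)) atTop (𝓝 0) :=
      tendsto_one_div_add_atTop_nhds_zero_nat
    have hb : Tendsto (fun N : ℕ => √(2 * ((B + L) * (1 / ((N : ℝ) + 1))) ^ 2
        + 2 * B ^ 2 * (1 / ((N : ℝ) + 1)))) atTop (𝓝 0) := by
      have := ((((hη.const_mul (B + L)).pow 2).const_mul 2).add (hη.const_mul (2 * B ^ 2))).sqrt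
      simpa using this
    rw [tendsto_iff_norm_sub_tendsto_zero]
    refine squeeze_zero' (Eventually.of_forall fun _ => norm_nonneg _) ?_ hb
    filter_upwards [eventually_ge_atTop N₀] with N hN
    refine Real.le_sqrt_of_sq_le ?_
    refine (M N).norm_toLinearMap_cylinder_sub_le hφ
      (u := fun z => u fun j => z (Fin.castLE hN j)) (L := L) ?_ (fun z => hB _) hF
    refine LipschitzWith.of_dist_le_mul fun z z' => (hL.dist_le_mul _ _).trans ?_
    refine mul_le_mul_of_nonneg_left ?_ L.2
    exact (dist_pi_le_iff dist_nonneg).2 fun j => dist_le_pi_dist z z' (Fin.castLE hN j)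
  · intro w hw
    refine eq_zero_of_integral_proj_eq_zero hφ 0 w fun N _ u hu hs => ?_
    obtain ⟨B, hB⟩ := hs.exists_bound_of_continuous hu.continuous
    have hm : MemLp (fun y => u (proj N y)) 2 (targetInf φ) :=
      MemLp.of_bound (hu.continuous.comp (continuous_proj N)).aestronglyMeasurable B
        (Eventually.of_forall fun y => hB _)
    rw [← inner_toLp hm]
    exact hw _ ⟨N, u, hu, hs, hm.coeFn_toLp⟩

end

/-! ### Weak gradients are strong gradients -/

section

variable {φ : ℝ → ℝ} {N : ℕ}

lemma exists_hasFDerivAt_inv_density (hφ : Differentiable ℝ φ) (x : Fin N → ℝ) :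
    ∃ A : (Fin N → ℝ) →L[ℝ] ℝ, HasFDerivAt (fun x => (density φ N x)⁻¹) A x ∧
      ∀ j, A (Pi.single j 1) = -((density φ N x)⁻¹ * deriv φ (x j)) := by
  have h1 : ∀ i ∈ (Finset.univ : Finset (Fin N)), HasFDerivAt (fun x : Fin N → ℝ => φ (x i))
      (deriv φ (x i) • ContinuousLinearMap.proj (R := ℝ) (φ := fun _ : Fin N => ℝ) i) x :=
    fun i _ => (hφ (x i)).hasDerivAt.comp_hasFDerivAt x (hasFDerivAt_apply i x)
  have h2 := (HasFDerivAt.fun_sum h1).fun_neg.exp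
  simp only [Real.exp_neg] at h2
  refine ⟨_, h2, fun j => ?_⟩
  simp [density, Pi.single_apply]

lemma contDiff_inv_density (hφ : Differentiable ℝ φ) (hφ' : Continuous (deriv φ)) :
    ContDiff ℝ 1 fun x => (density φ N x)⁻¹ := by
  have h : ContDiff ℝ 1 φ := contDiff_one_iff_deriv.2 ⟨hφ, hφ'⟩
  have h1 : ContDiff ℝ 1 (density φ N) := by
    unfold density
    fun_prop
  exact h1.inv fun x => (density_pos N x).ne'

variable [IsProbabilityMeasure (target φ)]

/-- The field `g` is the weak gradient of `h`: integration by parts holds against all test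
functions. -/
def IsWeakGradient (φ : ℝ → ℝ) [IsProbabilityMeasure (target φ)] (h : L2Target φ)
    (g : Lp EllTwo 2 (targetInf φ)) : Prop :=
  ∀ i G D, IsTest φ i G D → ∫ x, coord g i x * G x ∂(targetInf φ)
    = -∫ x, h x * (D x + G x * deriv φ (x i)) ∂(targetInf φ)

namespace IsMollifier

variable {η : ℝ} {χ ρ : (Fin N → ℝ) → ℝ}

/-- Mollification commutes with weak differentiation, up to the derivative of the cutoff. -/
lemma fderiv_mollify_eq (M : IsMollifier φ η χ ρ) (hφ : Differentiable ℝ φ)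
    (hφ' : Continuous (deriv φ)) {h : L2Target φ} {g : Lp EllTwo 2 (targetInf φ)}
    (hw : IsWeakGradient φ h g) (j : Fin N) (z : Fin N → ℝ) :
    fderiv ℝ (mollify φ ρ χ h) z (Pi.single j 1) = mollify φ ρ χ (coord g j) z
      + mollify φ ρ (fun x => fderiv ℝ χ x (Pi.single j 1)) h z := by
  have hh : Integrable h (targetInf φ) := (Lp.memLp h).integrable one_le_two
  have hχ1 : ContDiff ℝ 1 χ := M.contDiff_cut.of_le (by simp)
  have hρ1 : ContDiff ℝ 1 ρ := M.contDiff_ker.of_le (by simp)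
  have hd1 := contDiff_inv_density (N := N) hφ hφ'
  set w : (Fin N → ℝ) → ℝ := fun x => ρ (z - x) * (χ x * (density φ N x)⁻¹) with hwdef
  have hwc : ContDiff ℝ 1 w :=
    (hρ1.comp (contDiff_const.sub contDiff_id)).mul (hχ1.mul hd1)
  have hws : HasCompactSupport w := by
    have h1 : HasCompactSupport fun x => χ x * (density φ N x)⁻¹ := M.compact_cut.mul_right
    exact h1.mul_left
  have key := hw j _ _ (IsTest.of_cylinder hφ' hwc hws j.2)
  set dρ : (Fin N → ℝ) → ℝ := fun v => fderiv ℝ ρ v (Pi.single j 1) with hdρ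
  set dχ : (Fin N → ℝ) → ℝ := fun v => fderiv ℝ χ v (Pi.single j 1) with hdχ
  have hdχc : Continuous dχ := (hχ1.continuous_fderiv one_ne_zero).clm_apply continuous_const
  have hdχs : HasCompactSupport dχ := M.compact_cut.fderiv_apply ℝ _
  have hdρc : Continuous dρ := (hρ1.continuous_fderiv one_ne_zero).clm_apply continuous_const
  have hder : ∀ x, fderiv ℝ w x (Pi.single j 1) + w x * deriv φ (x j)
      = ρ (z - x) * (dχ x / density φ N x) - dρ (z - x) * (χ x / density φ N x) := by
    intro x
    obtain ⟨A, hA, hA'⟩ := exists_hasFDerivAt_inv_density hφ x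
    have h1 : HasFDerivAt (fun x => ρ (z - x)) (-fderiv ℝ ρ (z - x)) x := by
      have h2 := (hρ1.differentiable one_ne_zero (z - x)).hasFDerivAt.comp x
        ((hasFDerivAt_id x).const_sub z)
      refine h2.congr_fderiv ?_
      ext v
      simp
    have h3 := (hχ1.differentiable one_ne_zero x).hasFDerivAt
    have h4 : HasFDerivAt w _ x := h1.mul (h3.mul hA)
    rw [h4.fderiv]
    simp only [add_apply, _root_.smul_apply, neg_apply, smul_eq_mul, hA',
      hwdef, hdρ, hdχ]
    ring
  have e1 : ∫ x, coord g j x * w (proj N x) ∂(targetInf φ) = mollify φ ρ χ (coord g j) z := by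
    refine integral_congr_ae (Eventually.of_forall fun y => ?_)
    simp only [hwdef]
    ring
  have i1 := integrable_mollify_integrand hφ.continuous hdχc hdχs M.contDiff_ker.continuous hh z
  have i2 := integrable_mollify_integrand hφ.continuous hχ1.continuous M.compact_cut hdρc hh z
  have e2 : ∫ x, h x * (cylGrad w j x + w (proj N x) * deriv φ (x j)) ∂(targetInf φ)
      = mollify φ ρ dχ h z - mollify φ dρ χ h z := by
    rw [mollify, mollify, ← integral_sub i1 i2]
    refine integral_congr_ae (Eventually.of_forall fun y => ?_)
    have h1 := hder (proj N y)
    have h2 : cylGrad w j y = fderiv ℝ w (proj N y) (Pi.single j 1) := by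
      simp [cylGrad]
    simp only
    rw [h2, show y j = proj N y j from rfl, h1]
    ring
  rw [e1, e2] at key
  rw [fderiv_mollify hφ.continuous hχ1.continuous M.compact_cut hh M.contDiff_ker M.compact_ker,
    key]
  simp only [hdρ, hdχ]
  ring

end IsMollifier

/-- Weak gradients are gradients in the strong sense: mollifications of `h` with their classical
gradients converge to `h` and `g`. -/
lemma IsWeakGradient.isSobolevGradient (hφ : Differentiable ℝ φ) (hφ' : Continuous (deriv φ))
    {h : L2Target φ} {g : Lp EllTwo 2 (targetInf φ)} (hw : IsWeakGradient φ h g) :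
    IsSobolevGradient φ h g := by
  choose χ ρ M using fun N : ℕ =>
    exists_isMollifier hφ.continuous (φ := φ) N (η := 1 / ((N : ℝ) + 1)) (by positivity)
  have hc := hφ.continuous
  have hh : Integrable h (targetInf φ) := (Lp.memLp h).integrable one_le_two
  set u : ∀ N : ℕ, (Fin N → ℝ) → ℝ := fun N => mollify φ (ρ N) (χ N) h with hu
  have hus : ∀ N, ContDiff ℝ ∞ (u N) := fun N =>
    contDiff_mollify hc (M N).contDiff_cut.continuous (M N).compact_cut hh (M N).contDiff_ker
      (M N).compact_ker
  have huc : ∀ N, HasCompactSupport (u N) := fun N =>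
    hasCompactSupport_mollify hc (M N).contDiff_cut.continuous (M N).compact_cut hh
      (M N).contDiff_ker.continuous (M N).compact_ker
  have hu1 : ∀ N, ContDiff ℝ 1 (u N) := fun N => (hus N).of_le (by simp)
  have hf : ∀ N, ∃ v : Lp EllTwo 2 (targetInf φ),
      ∀ᵐ x ∂(targetInf φ), ∀ i, v x i = cylGrad (u N) i x := fun N =>
    exists_field (N := N) (fun i _ => continuous_cylGrad (hu1 N) i)
      (fun i _ => by
        obtain ⟨C, hC⟩ := exists_abs_cylGrad_le (hu1 N) (huc N)
        exact ⟨C, hC i⟩)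
      fun i hi => by
        ext x
        simp [cylGrad, not_lt.2 hi]
  choose v hv using hf
  set T := fun N => (M N).toLinearMap hc with hT
  have hTlim : ∀ F, Tendsto (fun N => T N F) atTop (𝓝 F) := tendsto_toLinearMap hc M
  have hlim1 : Tendsto (fun N => T N h) atTop (𝓝 h) := hTlim h
  -- the error produced by the derivative of the cutoff
  have hdχ : ∀ N (j : Fin N), Continuous fun x => fderiv ℝ (χ N) x (Pi.single j 1) := fun N j =>
    ((M N).contDiff_cut.continuous_fderiv (by simp)).clm_apply continuous_const
  have hdχs : ∀ N (j : Fin N), HasCompactSupport fun x => fderiv ℝ (χ N) x (Pi.single j 1) :=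
    fun N j => (M N).compact_cut.fderiv_apply ℝ _
  set E : ∀ N : ℕ, Fin N → L2Target φ := fun N j => (memLp_mollify hc (hdχ N j) (hdχs N j)
    (M N).contDiff_ker (M N).compact_ker h).toLp _ with hE
  have hEae : ∀ N j, ∀ᵐ y ∂(targetInf φ), E N j y
      = mollify φ (ρ N) (fun x => fderiv ℝ (χ N) x (Pi.single j 1)) h (proj N y) := fun N j =>
    (memLp_mollify hc (hdχ N j) (hdχs N j) (M N).contDiff_ker (M N).compact_ker h).coeFn_toLp
  have hEsum : ∀ N, ∑ j, ‖E N j‖ ^ 2 ≤ 2 * (1 / ((N : ℝ) + 1) * ‖h‖ ^ 2) := by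
    intro N
    have h1 : ∀ j, ‖E N j‖ ^ 2 ≤ 2 * ∫ y, (fderiv ℝ (χ N) (proj N y) (Pi.single j 1) * h y) ^ 2
        ∂(targetInf φ) := fun j => by
      rw [← integral_sq_eq]
      refine le_trans (le_of_eq ?_) ((M N).integral_mollify_sq_le hc (hdχ N j)
        (tsupport_fderiv_apply_subset ℝ _) (Lp.stronglyMeasurable h).measurable (Lp.memLp h))
      refine integral_congr_ae ?_
      filter_upwards [hEae N j] with y hy
      rw [hy]
    have hi : ∀ j, Integrable
        (fun y => (fderiv ℝ (χ N) (proj N y) (Pi.single j 1) * h y) ^ 2) (targetInf φ) := by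
      intro j
      obtain ⟨C, hC⟩ := (hdχs N j).exists_bound_of_continuous (hdχ N j)
      have hm : MemLp (fun y => fderiv ℝ (χ N) (proj N y) (Pi.single j 1) * h y) 2
          (targetInf φ) := by
        refine ((Lp.memLp h).const_mul C).mono
          (((hdχ N j).comp (continuous_proj N)).aestronglyMeasurable.mul (Lp.memLp h).1)
          (Eventually.of_forall fun y => ?_)
        rw [norm_mul, norm_mul]
        exact mul_le_mul_of_nonneg_right ((hC _).trans (le_abs_self _)) (norm_nonneg _)
      exact hm.integrable_sq
    refine (Finset.sum_le_sum fun j _ => h1 j).trans ?_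
    rw [← Finset.mul_sum, ← integral_finsetSum _ fun j _ => hi j]
    refine mul_le_mul_of_nonneg_left ?_ two_pos.le
    rw [← integral_sq_eq, ← integral_const_mul]
    refine integral_mono (integrable_finsetSum _ fun j _ => hi j)
      ((Lp.memLp h).integrable_sq.const_mul _) fun y => ?_
    simp only [mul_pow]
    rw [← Finset.sum_mul]
    exact mul_le_mul_of_nonneg_right ((M N).grad_cut _) (sq_nonneg _)
  have hcoord : ∀ N (j : Fin N), coord (v N) j = T N (coord g j) + E N j := by
    intro N j
    refine Lp.ext ?_
    filter_upwards [coord_ae (v N), hv N, Lp.coeFn_add (T N (coord g j)) (E N j), hEae N j,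
      (M N).toLinearMap_ae hc (coord g j)] with y h1 h2 h3 h4 h5
    rw [h1, h2, h3, Pi.add_apply, h4, h5, cylGrad, dif_pos j.2]
    exact (M N).fderiv_mollify_eq hφ hφ' hw j (proj N y)
  have hcoord0 : ∀ N j, N ≤ j → coord (v N) j = 0 := by
    intro N j hj
    rw [Lp.eq_zero_iff_ae_eq_zero]
    filter_upwards [coord_ae (v N), hv N] with y h1 h2
    rw [h1, h2, cylGrad, dif_neg (not_lt.2 hj)]
    rfl
  -- dominated convergence for the series over the components
  set c : ℕ → ℕ → ℝ := fun N j => if j < N then ‖T N (coord g j) - coord g j‖ ^ 2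
    else ‖coord g j‖ ^ 2 with hcdef
  have hcle : ∀ N j, c N j ≤ 9 * ‖coord g j‖ ^ 2 := by
    intro N j
    simp only [hcdef]
    split_ifs
    · have h1 : ‖T N (coord g j) - coord g j‖ ≤ 3 * ‖coord g j‖ := by
        refine (norm_sub_le _ _).trans ?_
        linarith [(M N).norm_toLinearMap_le hc (coord g j)]
      calc _ ≤ (3 * ‖coord g j‖) ^ 2 := pow_le_pow_left₀ (norm_nonneg _) h1 2
        _ = _ := by ring
    · nlinarith [sq_nonneg ‖coord g j‖]
  have hc0 : ∀ N j, 0 ≤ c N j := fun N j => by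
    simp only [hcdef]
    split_ifs <;> positivity
  have hsum9 : Summable fun j => 9 * ‖coord g j‖ ^ 2 := (hasSum_coord g).summable.mul_left 9
  have hcsum : ∀ N, Summable (c N) := fun N =>
    Summable.of_nonneg_of_le (hc0 N) (hcle N) hsum9
  have hclim : Tendsto (fun N => ∑' j, c N j) atTop (𝓝 0) := by
    have h1 : Tendsto (fun N => ∑' j, c N j) atTop (𝓝 (∑' _ : ℕ, (0 : ℝ))) := by
      refine tendsto_tsum_of_dominated_convergence hsum9 (fun j => ?_)
        (Eventually.of_forall fun N j => ?_)
      · have h2 := (tendsto_iff_norm_sub_tendsto_zero.1 (hTlim (coord g j))).pow 2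
        rw [zero_pow two_ne_zero] at h2
        refine h2.congr' ?_
        filter_upwards [eventually_gt_atTop j] with N hN
        simp only [hcdef, if_pos hN]
      · rw [Real.norm_of_nonneg (hc0 N j)]
        exact hcle N j
    simpa using h1
  have hcs : ∀ N, ‖v N - g‖ ^ 2 ≤ 2 * ∑' j, c N j + 4 * (1 / ((N : ℝ) + 1) * ‖h‖ ^ 2) := by
    intro N
    have h1 := hasSum_coord (v N - g)
    have hsub : ∀ j, coord (v N - g) j = coord (v N) j - coord g j := fun j => by
      unfold coord
      exact map_sub (ContinuousLinearMap.compLpL 2 (targetInf φ)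
        (lp.evalCLM ℝ (fun _ : ℕ => ℝ) 2 j)) (v N) g
    set e : ℕ → ℝ := fun j => if hj : j < N then ‖E N ⟨j, hj⟩‖ ^ 2 else 0 with he
    have hesum : HasSum e (∑ j, ‖E N j‖ ^ 2) := by
      have h2 : HasSum e (∑ j ∈ Finset.range N, e j) :=
        hasSum_sum_of_ne_finset_zero fun j hj => by
          have : ¬ j < N := by simpa using hj
          simp [he, this]
      rw [Finset.sum_range] at h2
      simpa [he] using h2
    have h3 : ∀ j, ‖coord (v N - g) j‖ ^ 2 ≤ 2 * c N j + 2 * e j := by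
      intro j
      rw [hsub]
      by_cases hj : j < N
      · have e1 := hcoord N ⟨j, hj⟩
        simp only at e1
        simp only [hcdef, he, if_pos hj, dif_pos hj]
        rw [e1, add_sub_right_comm]
        have h4 := norm_add_le (T N (coord g j) - coord g j) (E N ⟨j, hj⟩)
        have h5 := pow_le_pow_left₀ (norm_nonneg _) h4 2
        nlinarith [sq_nonneg (‖T N (coord g j) - coord g j‖ - ‖E N ⟨j, hj⟩‖)]
      · simp only [hcdef, he, if_neg hj, dif_neg hj]
        rw [hcoord0 N j (not_lt.1 hj), zero_sub, norm_neg]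
        nlinarith [sq_nonneg ‖coord g j‖]
    have h6 := hasSum_le h3 h1 (((hcsum N).hasSum.mul_left 2).add (hesum.mul_left 2))
    linarith [hEsum N]
  have hlim2 : Tendsto v atTop (𝓝 g) := by
    rw [tendsto_iff_norm_sub_tendsto_zero]
    have hη : Tendsto (fun N : ℕ => 1 / ((N : ℝ) + 1)) atTop (𝓝 0) :=
      tendsto_one_div_add_atTop_nhds_zero_nat
    have hb := ((hclim.const_mul 2).add ((hη.mul_const (‖h‖ ^ 2)).const_mul 4)).sqrt
    simp only [mul_zero, zero_mul, add_zero, Real.sqrt_zero] at hb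
    exact squeeze_zero (fun _ => norm_nonneg _) (fun N => Real.le_sqrt_of_sq_le (hcs N)) hb
  refine mem_closure_of_tendsto (hlim1.prodMk_nhds hlim2) ?_
  filter_upwards [eventually_gt_atTop 0] with N hN
  exact ⟨N, hN, u N, hus N, huc N, (M N).toLinearMap_ae hc h, hv N⟩

end

/-! ### Mosco convergence of the random walk forms -/

lemma scoreModulus_max_rpow {φ : ℝ → ℝ} (hφ : Differentiable ℝ φ)
    (hI : Integrable (fun x => |deriv φ x| ^ 2 * Real.exp (φ x)) volume) {k γ α : ℝ} (hk : 0 < k)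
    (hγ : 0 < γ) (hγα : γ ≤ α)
    (hφ' : ∀ x v : ℝ, |deriv φ (x + v) - deriv φ x| ≤ k * max (|v| ^ γ) (|v| ^ α)) :
    ScoreModulus φ fun v => k * max (|v| ^ γ) (|v| ^ α) where
  differentiable := hφ
  bound := hφ'
  continuous_modulus := by
    have h1 : Continuous fun v : ℝ => |v| ^ γ := continuous_abs.rpow_const fun _ => Or.inr hγ.le
    have h2 : Continuous fun v : ℝ => |v| ^ α :=
      continuous_abs.rpow_const fun _ => Or.inr (hγ.le.trans hγα)
    fun_prop
  modulus_zero := by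
    simp [Real.zero_rpow hγ.ne', Real.zero_rpow (hγ.trans_le hγα).ne']
  mono u v huv := mul_le_mul_of_nonneg_left (max_le_max
    (Real.rpow_le_rpow (abs_nonneg _) huv hγ.le)
    (Real.rpow_le_rpow (abs_nonneg _) huv (hγ.le.trans hγα))) hk.le
  growth := by
    refine ⟨k, ⌈α⌉₊, fun v => mul_le_mul_of_nonneg_left ?_ hk.le⟩
    have hp : 0 ≤ |v| ^ ⌈α⌉₊ := by positivity
    rcases le_total |v| 1 with hv | hv
    · refine (max_le (Real.rpow_le_one (abs_nonneg _) hv hγ.le)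
        (Real.rpow_le_one (abs_nonneg _) hv (hγ.le.trans hγα))).trans ?_
      linarith
    · have h1 : |v| ^ α ≤ |v| ^ ⌈α⌉₊ := by
        rw [← Real.rpow_natCast]
        exact Real.rpow_le_rpow_of_exponent_le hv (Nat.le_ceil α)
      refine (max_le ((Real.rpow_le_rpow_of_exponent_le hv hγα).trans h1) h1).trans ?_
      linarith
  fisher := hI

/-- A bound on the random walk forms along a weakly convergent sequence bounds the limiting form of
the limit. In particular the limit lies in the Sobolev space. -/
lemma ScoreModulus.limitForm_le {φ m : ℝ → ℝ} (H : ScoreModulus φ m)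
    [IsProbabilityMeasure (target φ)] {τ : ℝ} (hτ : 0 < τ) {h : L2Target φ}
    {hn : ℕ → L2Target φ}
    (hw : ∀ g, Tendsto (fun n => inner ℝ (hn n) g) atTop (𝓝 (inner ℝ h g)))
    {L : ℝ} (hL : 0 ≤ L) (hfreq : ∃ᶠ n in atTop, rwForm φ τ n (hn n) ≤ ENNReal.ofReal L) :
    limitForm φ τ h ≤ ENNReal.ofReal L := by
  have hφ := H.differentiable
  have hφ' := H.continuous_deriv
  have ha : 0 < τ ^ 2 * accRate φ τ := mul_pos (pow_pos hτ 2) (accRate_pos φ τ)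
  set C := √(2 * L / (τ ^ 2 * accRate φ τ)) with hC
  have hC2 : τ ^ 2 * accRate φ τ * C ^ 2 = 2 * L := by
    rw [hC, Real.sq_sqrt (by positivity), mul_div_cancel₀ _ ha.ne']
  have hA : ∀ p ∈ testFields φ, inner ℝ h p.2 ≤ C * ‖p.1‖ := by
    rintro p ⟨N, G, D, hT, h0, hv, hd⟩
    have h1 := H.sq_divergence_le (τ := τ) (N := N) (G := G) (D := D) (fun i _ => hT i) hw hL hfreq
    have h2 : ∑ i ∈ Finset.range N, ∫ x, G i x ^ 2 ∂(targetInf φ) = ‖p.1‖ ^ 2 := by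
      rw [← real_inner_self_eq_norm_sq, inner_field_eq_sum p.1 p.1 hv fun i hi => (h0 i hi).1]
      refine Finset.sum_congr rfl fun i _ => integral_congr_ae ?_
      filter_upwards [coord_ae p.1, hv] with x h3 h4
      rw [h3, h4, sq]
    have h3 := inner_testField hφ' h hT hd
    rw [h2, ← hC2, mul_assoc (τ ^ 2 * accRate φ τ)] at h1
    have h4 := le_of_mul_le_mul_left h1 ha
    rw [← mul_pow, ← neg_sq, ← h3] at h4
    exact (le_abs_self _).trans (abs_le_of_sq_le_sq h4 (by positivity))
  obtain ⟨g, hg⟩ := exists_riesz (testFields φ) h (Real.sqrt_nonneg _) hA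
  have hweak : IsWeakGradient φ h g := by
    intro i G D T
    obtain ⟨p, hp, h1, h2⟩ := exists_testField hφ' T
    rw [← h1, ← h2]
    exact hg p hp
  have hh : h ∈ sobolev φ := ⟨g, hweak.isSobolevGradient hφ hφ'⟩
  have hnorm : ‖grad φ h hh‖ ≤ C := by
    refine norm_le_of_inner_testField_le hφ.continuous hφ' (Real.sqrt_nonneg _) fun p hp => ?_
    have hgrad : IsSobolevGradient φ h (grad φ h hh) := hh.choose_spec
    rw [inner_eq_of_isSobolevGradient hφ hφ' hgrad hp]
    exact hA p hp
  rw [limitForm_eq τ hh, ← ENNReal.ofReal_mul (by linarith)]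
  refine ENNReal.ofReal_le_ofReal ?_
  have h1 := mul_le_mul_of_nonneg_left (pow_le_pow_left₀ (norm_nonneg _) hnorm 2) ha.le
  linarith

end MHRW

end

theorem theorem2p7 (φ : ℝ → ℝ) (hφ : Differentiable ℝ φ)
    [IsProbabilityMeasure (MHRW.target φ)]
    (hI : Integrable (fun x => |deriv φ x| ^ 2 * Real.exp (φ x)) volume)
    (k γ α : ℝ) (hk : 0 < k) (hγ0 : 0 < γ) (hγ1 : γ < 1) (hα : 1 < α)
    (hφ' : ∀ x v : ℝ, |deriv φ (x + v) - deriv φ x| ≤ k * max (|v| ^ γ) (|v| ^ α))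
    (τ : ℝ) (hτ : 0 < τ) :
    MHRW.MoscoConverges (fun n : ℕ => MHRW.rwForm φ τ n) (MHRW.limitForm φ τ) := by
  have H := MHRW.scoreModulus_max_rpow hφ hI hk hγ0 (hγ1.trans hα).le hφ'
  refine ⟨fun h hn hw => le_of_forall_gt_imp_ge_of_dense fun a ha => ?_,
    fun h => H.exists_recovery hτ h⟩
  rcases eq_or_ne a ⊤ with rfl | hat
  · exact le_top
  · have hfreq := (frequently_lt_of_liminf_lt (by isBoundedDefault) ha).mono fun n hn => hn.le
    rw [← ENNReal.ofReal_toReal hat] at hfreq ⊢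
    exact H.limitForm_le hτ hw ENNReal.toReal_nonneg hfreq
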